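/- Let $K$ be an algebraically closed field of arbitrary characteristic. A plane algebroid curve $C=\{f=0\}$ is the ideal generated by a nonzero $f\in K[[x,y]]$ without constant term; its multiplicity $m(C)$ is the order of $f$. The curve is reduced if $f$ has no multiple factors, a branch if $f$ is irreducible, smooth if $m(C)=1$, and singular if $m(C)\ge 2$; the branches of $C$ are the curves $\{g=0\}$ with $g$ an irreducible factor of $f$, taken up to units, and $r(C)$ is their number. Write $(C,D)_0=\dim_K K[[x,y]]/(f,g)$ for $C=\{f=0\}$, $D=\{g=0\}$. For branches put $d(C,D)=\frac{(C,D)_0}{m(C)m(D)}\in[0,\infty]$, and for reduced curves with branches $C_i$, $D_j$ put $d(C,D)=\inf_{i,j}d(C_i,D_j)$. The contact exponent of a reduced curve $C$ is $d(C)=\sup\{d(C,W): W \text{ a smooth branch}\}\in[0,\infty]$; a smooth branch $W$ has maximal contact with $C$ if $d(C,W)=d(C)$. The semigroup of a branch $C=\{f=0\}$ is $\Gamma(C)=\{(f,g)_0 : g\in K[[x,y]],\ f\nmid g\}\subseteq\mathbb N$. The Milnor number is $\mu(C)=c(C)-r(C)+1$, where $c(C)=\dim_K\overline{\mathcal O}_C/\mathcal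 C$, $\overline{\mathcal O}_C$ is the integral closure of $\mathcal O_C=K[[x,y]]/(f)$ in its total ring of fractions, and $\mathcal C$ is the conductor of $\overline{\mathcal O}_C$ in $\mathcal O_C$. Proposition. Let $C$ be a reduced singular curve. Then $$\mu(C)=(d(C)m(C)-1)(m(C)-1)$$ if and only if one of the following three conditions holds; moreover these conditions are pairwise mutually exclusive. (1) $d(C)\in\mathbb N$, all branches of $C$ are smooth, and any two distinct branches of $C$ intersect with multiplicity $d(C)$. (2) $d(C)\notin\mathbb N$, $m(C)d(C)\in\mathbb N$, and, with $r=\gcd(m(C),m(C)d(C))$, the curve $C$ has exactly $r$ branches, each with semigroup generated by $\frac{m(C)}{r}$ and $\frac{m(C)d(C)}{r}$, and any two distinct branches intersect with multiplicity $\frac{m(C)^2d(C)}{r^2}$. (3) $m(C)d(C)\notin\mathbb N$, and there are a smooth branch $L$ and a reduced curve $C'$ such that $C=L\cup C'$ (that is, $f$ is the product of equations of $L$ and $C'$), $C'$ satisfies (2), $d(C')=d(C)$, $m(C')=m(C)-1$, and $L$ has maximal contact with every branch of $C'$. -/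

import Mathlib

open scoped ENNReal

namespace AlgebroidCurve

noncomputable section

/-- The ring `K[[x, y]]`. A plane algebroid curve `{f = 0}` is the ideal generated by a
nonzero `f` without constant term; it is given here by its equation `f`, and every notion
below depends only on `f` up to a unit factor. -/
abbrev Series (K : Type*) := MvPowerSeries (Fin 2) K

variable {K : Type*} [Field K]

/-- `f` is the equation of a plane algebroid curve. -/
def IsCurve (f : Series K) : Prop :=
  f ≠ 0 ∧ MvPowerSeries.constantCoeff f = 0

/-- The multiplicity of the curve `{f = 0}`, the order of the nonzero series `f`. -/
def mult (f : Series K) : ℕ := f.order.toNat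

/-- A reduced curve: the equation has no multiple factors. -/
def IsReducedCurve (f : Series K) : Prop := IsCurve f ∧ Squarefree f

/-- A singular curve: its multiplicity is at least two. -/
def IsSingularCurve (f : Series K) : Prop := IsCurve f ∧ 2 ≤ mult f

/-- A branch: an irreducible curve. -/
def IsBranch (g : Series K) : Prop := IsCurve g ∧ Irreducible g

/-- A smooth branch: a branch of multiplicity one. -/
def IsSmoothBranch (w : Series K) : Prop := IsBranch w ∧ mult w = 1

/-- `{g = 0}` is one of the branches (irreducible components) of `{f = 0}`. Two such
equations define the same branch if and only if they are associated. -/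
def IsBranchOf (g f : Series K) : Prop := IsBranch g ∧ g ∣ f

/-- The number `r(C)` of branches, the branches being counted as ideals. -/
def numBranches (f : Series K) : ℕ :=
  {P : Ideal (Series K) | ∃ g, IsBranchOf g f ∧ P = Ideal.span {g}}.ncard

/-- The intersection number `dim_K K[[x, y]] / (f, g)`, possibly infinite. -/
def interNum (f g : Series K) : ℕ∞ :=
  Cardinal.toENat (Module.rank K (Series K ⧸ (Ideal.span {f, g} : Ideal (Series K))))

/-- The semigroup `{(f, g)₀ : g ≢ 0 mod f}` of the branch `{f = 0}`. -/
def semigroup (f : Series K) : Set ℕ :=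
  {n | ∃ g : Series K, ¬ f ∣ g ∧ interNum f g = n}

/-- The order of contact `(C, D)₀ / (m(C) m(D))` of two branches. -/
def branchContact (g h : Series K) : ℝ≥0∞ :=
  (interNum g h : ℝ≥0∞) / ((mult g : ℝ≥0∞) * (mult h : ℝ≥0∞))

/-- The order of contact `d(C, D)` of two reduced curves, the smallest order of contact of a
branch of `C` with a branch of `D`. -/
def contact (f g : Series K) : ℝ≥0∞ :=
  ⨅ (p : Series K) (_ : IsBranchOf p f) (q : Series K) (_ : IsBranchOf q g), branchContact p q

/-- The contact exponent `d(C)`, the supremum of `d(C, W)` over all smooth branches `W`. -/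
def contactExponent (f : Series K) : ℝ≥0∞ :=
  ⨆ (w : Series K) (_ : IsSmoothBranch w), contact f w

/-- The smooth branch `{w = 0}` has maximal contact with `{f = 0}`. -/
def HasMaximalContact (w f : Series K) : Prop :=
  IsSmoothBranch w ∧ contact f w = contactExponent f

/-- The local ring `𝒪_C = K[[x, y]] / (f)` of the curve. -/
abbrev LocalRing (f : Series K) := Series K ⧸ (Ideal.span {f} : Ideal (Series K))

/-- The integral closure of `𝒪_C` in its total ring of fractions. -/
abbrev Normalization (f : Series K) :=
  integralClosure (LocalRing f) (FractionRing (LocalRing f))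

/-- The conductor, as an ideal of the integral closure of `𝒪_C`: the elements `a` of the
integral closure such that every multiple of `a` in the integral closure lies in `𝒪_C`. -/
def conductorIdeal (f : Series K) : Ideal (Normalization f) where
  carrier := {a | ∀ b : Normalization f,
    a * b ∈ (algebraMap (LocalRing f) (Normalization f)).range}
  zero_mem' := fun b => by simp [zero_mem]
  add_mem' := fun {a a'} ha ha' b => by
    rw [add_mul]
    exact add_mem (ha b) (ha' b)
  smul_mem' := fun c a ha b => by
    have h : c • a * b = a * (c * b) := by
      rw [smul_eq_mul]
      ring
    rw [h]
    exact ha (c * b)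

/-- The degree of the conductor, the `K`-dimension of the integral closure of `𝒪_C` modulo
the conductor. -/
def conductorDegree (f : Series K) : ℕ∞ :=
  Cardinal.toENat (Module.rank K (Normalization f ⧸ conductorIdeal f))

/-- The Milnor number `μ(C) = c(C) - r(C) + 1`. -/
def milnor (f : Series K) : EReal :=
  ((conductorDegree f : ℝ≥0∞) : EReal) - (numBranches f : EReal) + 1

/-- `d` is a natural number. -/
def IsNat (d : ℝ≥0∞) : Prop := ∃ n : ℕ, d = n

/-- First type: `d(C)` is a natural number, all branches are smooth, and any two distinct
branches have intersection number `d(C)`. -/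
def TypeOne (f : Series K) : Prop :=
  IsNat (contactExponent f) ∧
  (∀ g, IsBranchOf g f → IsSmoothBranch g) ∧
  ∀ g h, IsBranchOf g f → IsBranchOf h f → ¬ Associated g h →
    (interNum g h : ℝ≥0∞) = contactExponent f

/-- Second type: `d(C)` is not a natural number, `N = m(C) d(C)` is one, and with
`r = gcd(m(C), N)` there are `r` branches, each with semigroup generated by `m(C) / r` and
`N / r` (exact divisions), any two of them with intersection number `m(C)² d(C) / r²`. -/
def TypeTwo (f : Series K) : Prop :=
  ¬ IsNat (contactExponent f) ∧
  ∃ N r : ℕ, (mult f : ℝ≥0∞) * contactExponent f = N ∧ r = Nat.gcd (mult f) N ∧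
    numBranches f = r ∧
    (∀ g, IsBranchOf g f →
      semigroup g = (AddSubmonoid.closure {mult f / r, N / r} : AddSubmonoid ℕ)) ∧
    ∀ g h, IsBranchOf g f → IsBranchOf h f → ¬ Associated g h →
      (interNum g h : ℝ≥0∞) = (mult f : ℝ≥0∞) ^ 2 * contactExponent f / (r : ℝ≥0∞) ^ 2

/-- Third type: `m(C) d(C)` is not a natural number and `C = L ∪ C'` with `L` smooth, `C'` of
the second type, `d(C') = d(C)`, `m(C') = m(C) - 1`, and `L` of maximal contact with each
branch of `C'`. -/
def TypeThree (f : Series K) : Prop :=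
  ¬ IsNat ((mult f : ℝ≥0∞) * contactExponent f) ∧
  ∃ l f' : Series K, f = l * f' ∧ IsSmoothBranch l ∧ IsReducedCurve f' ∧ TypeTwo f' ∧
    contactExponent f' = contactExponent f ∧ mult f' + 1 = mult f ∧
    ∀ g, IsBranchOf g f' → HasMaximalContact l g

end

end AlgebroidCurve

/-! Let `C_i` be the branches, `m_i` their multiplicities, `c_i` their conductor exponents, and `m =
m(C)`. The contact exponent is a fraction `p/q` in lowest terms, attained by some smooth `W`
(`exists_contactExponent_eq`), so `q (C_i, W)₀ ≥ p m_i` for every `i`.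

This gives two kinds of inequality: `q c_i ≥ (m_i - 1)(p m_i - q)` for each branch
(`mul_sub_le_mul_condExp`) and `q (C_i, C_j)₀ ≥ p m_i m_j` for each pair
(`mul_mul_le_mul_interNum`). Since `c(C) = ∑ c_i + ∑_{i ≠ j} (C_i, C_j)₀`, the sum of all these
defects is exactly `q μ(C) - (p m - q)(m - 1)`. Hence the Milnor formula holds if and only if every
defect vanishes (`milnor_eq_iff`).

The defect of a smooth branch is always zero. For a singular branch it vanishes only if `m_i = q`
and the semigroup is `⟨q, p⟩` (`mult_eq_of_mul_condExp_eq`), and then it does vanish because `⟨q,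
p⟩` has conductor `(q - 1)(p - 1)`. Two smooth branches with zero pair defect satisfy `q (C_i, C_j)₀
= p`, so `q = 1`. Thus `q = 1` gives type one, while for `q ≥ 2` there is at most one smooth branch:
none gives type two, one gives type three.

No Puiseux series are used, so the characteristic is arbitrary. The normalization of a branch is a
discrete valuation ring with residue field `K`, and its valuation computes intersection numbers. The
branch inequality comes from `interNum_lt_condExp_add`: for parameters `x, w` with `(f, x)₀ = n`, a
series congruent to `w ^ (n - 1)` modulo `x` cannot have value `c + n` or more. The pair inequality
comes from the Newton polygon: `w ^ n / x ^ N` is integral over the branch when `(f, w)₀ ≥ N`, which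
puts every monomial of `f` on or above one line (`mul_le_weightedOrder`). -/

namespace AlgebroidCurve
-- The ring `K[[x, y]]`: maximal ideal, factoriality, changes of coordinates.
open IsLocalRing

variable {K : Type*} [Field K]

/-- The kernels of the iterates stabilise, say at `n`. If `φ x = 0` and `x = φ^n y`, then `y` lies
in the kernel of `φ^(n+1)`, which is that of `φ^n`, so `x = 0`. -/
theorem injective_of_surjective_ringHom_self {A : Type*} [CommRing A] [IsNoetherianRing A]
    (φ : A →+* A) (hφ : Function.Surjective φ) : Function.Injective φ := by
  have hmono : Monotone fun n : ℕ => RingHom.ker (φ ^ n : A →+* A) := by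
    refine monotone_nat_of_le_succ fun n x hx => ?_
    rw [RingHom.mem_ker] at hx ⊢
    rw [pow_succ', RingHom.mul_def, RingHom.comp_apply, hx, map_zero]
  obtain ⟨n, hn⟩ := monotone_stabilizes_iff_noetherian.mpr ‹_› ⟨_, hmono⟩
  have hsn : ∀ k : ℕ, Function.Surjective (φ ^ k : A →+* A) := by
    intro k
    induction k with
    | zero => exact fun x => ⟨x, rfl⟩
    | succ k ih => rw [pow_succ', RingHom.mul_def]; exact hφ.comp ih
  rw [injective_iff_map_eq_zero]
  intro x hx
  obtain ⟨y, rfl⟩ := hsn n x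
  have h1 : y ∈ RingHom.ker (φ ^ (n + 1) : A →+* A) := by
    rw [RingHom.mem_ker, pow_succ', RingHom.mul_def, RingHom.comp_apply, hx]
  have h2 : RingHom.ker (φ ^ n : A →+* A) = RingHom.ker (φ ^ (n + 1) : A →+* A) :=
    hn (n + 1) (by omega)
  rw [← h2] at h1
  exact h1

instance : IsDomain (Series K) := NoZeroDivisors.to_isDomain _

section Coordinates

open MvPowerSeries

/-- Power series in one variable, the variable being indexed by `Fin 1`. -/
noncomputable def finOneEquiv : MvPowerSeries (Fin 1) K ≃ₐ[K] PowerSeries K :=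
  renameEquiv K (Equiv.ofUnique (Fin 1) Unit)

instance : IsDomain (MvPowerSeries (Fin 1) K) := NoZeroDivisors.to_isDomain _

instance : IsPrincipalIdealRing (MvPowerSeries (Fin 1) K) :=
  IsPrincipalIdealRing.of_surjective (finOneEquiv (K := K)).symm.toRingEquiv.toRingHom
    (finOneEquiv (K := K)).symm.surjective

instance : UniqueFactorizationMonoid (Series K) :=
  (MulEquiv.uniqueFactorizationMonoid_iff (finSuccEquiv K 1).toMulEquiv).mpr inferInstance

theorem mem_maximalIdeal_series {f : Series K} :
    f ∈ maximalIdeal (Series K) ↔ constantCoeff f = 0 := by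
  simp [mem_maximalIdeal, mem_nonunits_iff, isUnit_iff_constantCoeff]

theorem exists_eq_X_mul_add_X_mul {f : Series K} {n : ℕ} (hf : ((n + 1 : ℕ) : ℕ∞) ≤ f.order) :
    ∃ g h : Series K, f = X 0 * g + X 1 * h ∧ (n : ℕ∞) ≤ g.order ∧ (n : ℕ∞) ≤ h.order := by
  classical
  have hX : ∀ i : Fin 2, (X i : Series K).order = 1 := fun i => by
    rw [X, order_monomial_of_ne_zero one_ne_zero]; simp
  have key : ∀ (i : Fin 2) (u : Series K), ((n + 1 : ℕ) : ℕ∞) ≤ (X i * u).order →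
      (n : ℕ∞) ≤ u.order := by
    intro i u hu
    rw [order_mul, hX, add_comm 1] at hu
    exact (ENat.add_le_add_iff_right ENat.one_ne_top).mp (by exact_mod_cast hu)
  -- The monomials free of `X 0`, hence divisible by `X 1`. They are disjoint from the monomials of
  -- `f - f₁`, so neither part has smaller order than `f`.
  let f₁ : Series K := fun e => if e 0 = 0 then coeff e f else 0
  have hf₁ : ∀ e, coeff e f₁ = if e 0 = 0 then coeff e f else 0 := fun e => rfl
  have ho₁ : ((n + 1 : ℕ) : ℕ∞) ≤ f₁.order := by
    refine le_order fun d hd => ?_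
    rw [hf₁, coeff_of_lt_order (lt_of_lt_of_le hd hf), ite_self]
  have ho₂ : ((n + 1 : ℕ) : ℕ∞) ≤ (f - f₁).order := by
    refine le_order fun d hd => ?_
    rw [map_sub, coeff_of_lt_order (lt_of_lt_of_le hd hf),
      coeff_of_lt_order (lt_of_lt_of_le hd ho₁), sub_zero]
  obtain ⟨g, hg⟩ : X 0 ∣ f - f₁ := by
    rw [X_dvd_iff]
    intro e he
    simp [hf₁, he]
  obtain ⟨h, hh⟩ : X 1 ∣ f₁ := by
    rw [X_dvd_iff]
    intro e he
    rw [hf₁]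
    split_ifs with h0
    · have : e = 0 := by ext i; fin_cases i <;> simpa
      subst this
      exact coeff_of_lt_order (lt_of_lt_of_le (by simp) hf)
    · rfl
  refine ⟨g, h, by rw [← hg, ← hh]; ring, key 0 g (hg ▸ ho₂), key 1 h (hh ▸ ho₁)⟩

theorem maximalIdeal_series : maximalIdeal (Series K) = Ideal.span {X 0, X 1} := by
  apply le_antisymm
  · intro f hf
    have : ((0 + 1 : ℕ) : ℕ∞) ≤ f.order := by
      simpa [one_le_order_iff_constCoeff_eq_zero] using mem_maximalIdeal_series.mp hf
    obtain ⟨g, h, rfl, -⟩ := exists_eq_X_mul_add_X_mul this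
    exact Ideal.mem_span_pair.mpr ⟨g, h, by ring⟩
  · rw [Ideal.span_le]
    rintro f (rfl | rfl) <;> exact mem_maximalIdeal_series.mpr (constantCoeff_X _)

theorem mem_maximalIdeal_pow_iff {f : Series K} {n : ℕ} :
    f ∈ maximalIdeal (Series K) ^ n ↔ (n : ℕ∞) ≤ f.order := by
  constructor
  · intro hf
    induction n generalizing f with
    | zero => simp
    | succ n ih =>
      rw [pow_succ] at hf
      induction hf using Submodule.mul_induction_on' with
      | mem_mul_mem a ha b hb =>
        rw [order_mul]
        have hb' : 1 ≤ b.order :=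
          one_le_order_iff_constCoeff_eq_zero.mpr (mem_maximalIdeal_series.mp hb)
        push_cast
        exact add_le_add (ih ha) hb'
      | add a _ b _ ha hb => exact (le_min ha hb).trans min_order_le_add
  · intro hf
    induction n generalizing f with
    | zero => simp
    | succ n ih =>
      obtain ⟨g, h, rfl, hg, hh⟩ := exists_eq_X_mul_add_X_mul hf
      rw [pow_succ']
      have hX : ∀ i : Fin 2, (X i : Series K) ∈ maximalIdeal (Series K) := fun i =>
        mem_maximalIdeal_series.mpr (constantCoeff_X _)
      exact add_mem (Ideal.mul_mem_mul (hX 0) (ih hg)) (Ideal.mul_mem_mul (hX 1) (ih hh))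

instance : IsAdicComplete (maximalIdeal (Series K)) (Series K) := by
  have : Set.range (X : Fin 2 → Series K) = {X 0, X 1} := by
    ext; simp [Fin.exists_fin_two, eq_comm]
  rw [maximalIdeal_series, ← this]
  infer_instance

/-- An ideal that contains a power of the maximal ideal contains every series all of whose
monomials it contains. -/
theorem mem_of_forall_monomial_mem {J : Ideal (Series K)} {n : ℕ}
    (hJ : maximalIdeal (Series K) ^ n ≤ J) {g : Series K}
    (hg : ∀ e : Fin 2 →₀ ℕ, coeff e g ≠ 0 → (X 0 ^ e 0 * X 1 ^ e 1 : Series K) ∈ J) : g ∈ J := by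
  classical
  have h1 : g - (truncTotal n g : MvPolynomial (Fin 2) K) ∈ J := by
    refine hJ (mem_maximalIdeal_pow_iff.mpr (le_order fun d hd => ?_))
    have hd' : Finsupp.degree d < n := by exact_mod_cast hd
    rw [map_sub, MvPolynomial.coeff_coe, coeff_truncTotal _ hd', sub_self]
  have h2 : ((truncTotal n g : MvPolynomial (Fin 2) K) : Series K) ∈ J := by
    rw [MvPolynomial.as_sum (truncTotal n g), ← MvPolynomial.coeToMvPowerSeries.ringHom_apply,
      map_sum]
    refine Ideal.sum_mem _ fun e he => ?_
    rw [MvPolynomial.mem_support_iff, coeff_truncTotal_eq_ite] at he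
    have hc : coeff e g ≠ 0 := by
      intro h; apply he; simp [h]
    rw [MvPolynomial.monomial_eq, map_mul, Finsupp.prod_fintype _ _ (by simp), Fin.prod_univ_two]
    refine Ideal.mul_mem_left _ _ ?_
    simpa using hg e hc
  simpa using add_mem h1 h2

/-- Substitution of `x, y` for the variables carries the maximal ideal onto itself and is onto
modulo it, hence surjective by completeness; a surjective endomorphism of a noetherian ring is
injective. -/
theorem exists_algEquiv {x y : Series K} (h : Ideal.span {x, y} = maximalIdeal (Series K)) :
    ∃ φ : Series K ≃ₐ[K] Series K, φ (X 0) = x ∧ φ (X 1) = y := by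
  have hx : x ∈ maximalIdeal (Series K) := h ▸ Ideal.subset_span (by simp)
  have hy : y ∈ maximalIdeal (Series K) := h ▸ Ideal.subset_span (by simp)
  have ha : HasSubst ![x, y] := by
    refine hasSubst_of_constantCoeff_zero fun i => ?_
    fin_cases i
    · exact mem_maximalIdeal_series.mp hx
    · exact mem_maximalIdeal_series.mp hy
  let φ : Series K →ₐ[K] Series K := substAlgHom ha
  have h0 : φ (X 0) = x := substAlgHom_X ha 0
  have h1 : φ (X 1) = y := substAlgHom_X ha 1
  have hmap : (maximalIdeal (Series K)).map φ.toRingHom = maximalIdeal (Series K) := by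
    conv_lhs => rw [maximalIdeal_series]
    rw [Ideal.map_span, ← h, Set.image_pair]
    exact congrArg Ideal.span (congrArg₂ _ h0 (congrArg _ h1))
  have hsurj : Function.Surjective φ.toRingHom := by
    have : IsHausdorff ((maximalIdeal (Series K)).map φ.toRingHom) (Series K) := by
      rw [hmap]; infer_instance
    refine surjective_of_mk_map_comp_surjective (I := maximalIdeal (Series K)) _ fun z => ?_
    obtain ⟨z, rfl⟩ := Ideal.Quotient.mk_surjective z
    refine ⟨algebraMap K _ (constantCoeff z), ?_⟩
    rw [RingHom.comp_apply, Ideal.Quotient.mk_eq_mk_iff_sub_mem, hmap, mem_maximalIdeal_series]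
    have : φ.toRingHom (algebraMap K _ (constantCoeff z)) = algebraMap K _ (constantCoeff z) :=
      φ.commutes _
    rw [this, map_sub]
    simp [MvPowerSeries.algebraMap_apply]
  have hinj : Function.Injective φ.toRingHom := injective_of_surjective_ringHom_self _ hsurj
  exact ⟨AlgEquiv.ofBijective φ ⟨hinj, hsurj⟩, h0, h1⟩

end Coordinates

end AlgebroidCurve

/-! ### Lengths over `K`, the local ring of a curve, smooth branches. -/

namespace AlgebroidCurve
open IsLocalRing

/-- The residue field of the local `K`-algebra `A` is `K`. -/
class HasResidueField (K A : Type*) [Field K] [CommRing A] [IsLocalRing A] [Algebra K A] :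
    Prop where
  exists_sub_mem (K) (a : A) : ∃ c : K, a - algebraMap K A c ∈ maximalIdeal A

section LocalAlgebra

variable (K : Type*) {A : Type*} [Field K] [CommRing A] [IsLocalRing A] [Algebra K A]
  [HasResidueField K A]

/-- Simple `A`-modules are one-dimensional over `K`. This lets the dimensions in the definitions be
computed as lengths over local rings. -/
theorem length_eq_length_of_hasResidueField (M : Type*) [AddCommGroup M] [Module K M] [Module A M]
    [IsScalarTower K A M] : Module.length K M = Module.length A M := by
  have : IsLocalHom (algebraMap K A) := inferInstance
  rw [IsLocalRing.length_restrictScalars K A M]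
  have hs : Function.Surjective (algebraMap (ResidueField K) (ResidueField A)) := by
    intro a
    obtain ⟨a, rfl⟩ := residue_surjective a
    obtain ⟨c, hc⟩ := HasResidueField.exists_sub_mem K a
    refine ⟨residue K c, ?_⟩
    have h2 : residue A a = residue A (algebraMap K A c) := by
      rw [← sub_eq_zero, ← map_sub]
      exact (residue_eq_zero_iff _).mpr hc
    rw [h2]
    rfl
  rw [Module.length_eq_of_surjective (M := ResidueField A) hs,
    Module.length_eq_one (ResidueField A) (ResidueField A), mul_one]

theorem HasResidueField.of_surjective {A' : Type*} [CommRing A'] [IsLocalRing A'] [Algebra K A']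
    (φ : A →ₐ[K] A') (hφ : Function.Surjective φ) : HasResidueField K A' := by
  refine ⟨fun a => ?_⟩
  obtain ⟨a, rfl⟩ := hφ a
  obtain ⟨c, hc⟩ := HasResidueField.exists_sub_mem K a
  have : IsLocalHom φ.toRingHom := IsLocalHom.of_surjective φ.toRingHom hφ
  refine ⟨c, ?_⟩
  rw [← φ.commutes, ← map_sub]
  exact map_nonunit φ.toRingHom _ hc

end LocalAlgebra

theorem isPrecomplete_of_surjective {A M N : Type*} [CommRing A] [AddCommGroup M] [Module A M]
    [AddCommGroup N] [Module A N] (I : Ideal A) [IsPrecomplete I M] (π : M →ₗ[A] N)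
    (hπ : Function.Surjective π) : IsPrecomplete I N := by
  rw [← AdicCompletion.of_surjective_iff]
  intro z
  obtain ⟨y, rfl⟩ := AdicCompletion.map_surjective I hπ z
  obtain ⟨x, rfl⟩ := AdicCompletion.of_surjective I M y
  exact ⟨π x, by rw [AdicCompletion.map_of]⟩

variable {K : Type*} [Field K]

instance : HasResidueField K (Series K) :=
  ⟨fun a => ⟨MvPowerSeries.constantCoeff a, by
    rw [mem_maximalIdeal_series, map_sub, MvPowerSeries.algebraMap_apply]; simp⟩⟩

section Quotient

variable {f : Series K}

theorem nontrivial_localRing (hf : ¬ IsUnit f) : Nontrivial (LocalRing f) :=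
  Ideal.Quotient.nontrivial_iff.mpr (by rwa [Ne, Ideal.span_singleton_eq_top])

variable (hf : ¬ IsUnit f)
include hf

theorem isLocalRing_localRing : IsLocalRing (LocalRing f) :=
  have := nontrivial_localRing hf
  IsLocalRing.of_surjective' (Ideal.Quotient.mk _) Ideal.Quotient.mk_surjective

theorem maximalIdeal_localRing [IsLocalRing (LocalRing f)] :
    maximalIdeal (LocalRing f) = (maximalIdeal (Series K)).map (Ideal.Quotient.mk _) := by
  have := nontrivial_localRing hf
  exact (map_maximalIdeal_of_surjective _ Ideal.Quotient.mk_surjective).symm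

omit hf in
theorem hasResidueField_localRing [IsLocalRing (LocalRing f)] :
    HasResidueField K (LocalRing f) :=
  HasResidueField.of_surjective K (Ideal.Quotient.mkₐ K (Ideal.span {f}))
    Ideal.Quotient.mk_surjective

/-- Only precompleteness has to be carried over from `K[[x, y]]`; the quotient is noetherian local,
so separatedness is automatic. -/
theorem isAdicComplete_localRing [IsLocalRing (LocalRing f)] :
    IsAdicComplete (maximalIdeal (LocalRing f)) (LocalRing f) := by
  have h : IsPrecomplete (maximalIdeal (LocalRing f)) (LocalRing f) := by
    rw [maximalIdeal_localRing hf]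
    refine (IsPrecomplete.map_algebraMap_iff (R := Series K) (S := LocalRing f)).mpr ?_
    exact isPrecomplete_of_surjective _ (Ideal.span {f} : Ideal (Series K)).mkQ
      (Submodule.mkQ_surjective _)
  exact { h with }

end Quotient

theorem ringKrullDim_series_le : ringKrullDim (Series K) ≤ 2 := by
  refine (ringKrullDim_le_spanFinrank_maximalIdeal _).trans ?_
  have : (maximalIdeal (Series K)).spanFinrank ≤ 2 := by
    rw [maximalIdeal_series]
    refine (Submodule.spanFinrank_span_le_ncard_of_finite (Set.toFinite _)).trans ?_
    exact (Set.ncard_insert_le _ _).trans (by simp)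
  exact_mod_cast this

theorem krullDimLE_localRing {f : Series K} (hf : f ≠ 0) : Ring.KrullDimLE 1 (LocalRing f) := by
  rw [Ring.KrullDimLE, Order.krullDimLE_iff]
  have h := (ringKrullDim_quotient_succ_le_of_nonZeroDivisor
    (mem_nonZeroDivisors_of_ne_zero hf)).trans ringKrullDim_series_le
  have h2 : ringKrullDim (LocalRing f) + 1 ≤ (1 : ℕ) + 1 := by
    refine h.trans (le_of_eq ?_)
    norm_num
  exact ENat.WithBot.add_le_add_one_right_iff.mp h2

theorem interNum_comm (f g : Series K) : interNum f g = interNum g f := by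
  rw [interNum, interNum, Set.pair_comm]

theorem interNum_eq_length (f g : Series K) :
    interNum f g = Module.length K (Series K ⧸ (Ideal.span {f, g} : Ideal (Series K))) :=
  (Module.length_eq_rank _ _).symm

theorem interNum_eq_ord {f : Series K} (hf : ¬ IsUnit f) (g : Series K) :
    interNum f g = Ring.ord (LocalRing f) (Ideal.Quotient.mk _ g) := by
  have := isLocalRing_localRing hf
  have := hasResidueField_localRing (f := f)
  have h1 : (Ideal.span {f, g} : Ideal (Series K)) = Ideal.span {f} ⊔ Ideal.span {g} := by
    rw [Ideal.span_insert]
  have h2 : (Ideal.span {g}).map (Ideal.Quotient.mkₐ K (Ideal.span {f})) =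
      Ideal.span {(Ideal.Quotient.mk (Ideal.span {f}) g : LocalRing f)} := by
    rw [Ideal.map_span, Set.image_singleton]; rfl
  rw [interNum_eq_length, Ring.ord,
    ← length_eq_length_of_hasResidueField K (A := LocalRing f), h1, ← h2]
  exact (DoubleQuot.quotQuotEquivQuotSupₐ K (Ideal.span {f})
    (Ideal.span {g})).toLinearEquiv.length_eq.symm

theorem interNum_congr {f f' g g' : Series K} (hf : Associated f f') (hg : Associated g g') :
    interNum f g = interNum f' g' := by
  have : (Ideal.span {f, g} : Ideal (Series K)) = Ideal.span {f', g'} := by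
    rw [Ideal.span_insert, Ideal.span_insert f' {g'}, Ideal.span_singleton_eq_span_singleton.mpr hf,
      Ideal.span_singleton_eq_span_singleton.mpr hg]
  rw [interNum, interNum, this]

section Coordinates

open MvPowerSeries

theorem prime_X (i : Fin 2) : Prime (X i : Series K) := by
  have h0 : Prime (X 0 : Series K) := by
    rw [← MulEquiv.prime_iff (finSuccEquiv K 1).toMulEquiv]
    have : (finSuccEquiv K 1).toMulEquiv (X 0) = PowerSeries.X := finSuccEquiv_X_zero
    rw [this]
    exact PowerSeries.X_prime
  fin_cases i
  · exact h0
  · rw [← MulEquiv.prime_iff (renameEquiv K (Equiv.swap (0 : Fin 2) 1)).toMulEquiv]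
    have : (renameEquiv K (Equiv.swap (0 : Fin 2) 1)).toMulEquiv (X 1 : Series K) = X 0 :=
      (rename_X _ _).trans (by simp)
    simpa [this] using h0

theorem not_X_dvd_X {i j : Fin 2} (h : i ≠ j) : ¬ (X i : Series K) ∣ X j := by
  rw [X_dvd_iff]
  push Not
  exact ⟨Finsupp.single j 1, by simp [h.symm], by simp⟩

end Coordinates

section Parameters

variable {x w : Series K} (h : Ideal.span {x, w} = maximalIdeal (Series K))
include h

theorem prime_of_span_pair : Prime x := by
  obtain ⟨φ, rfl, -⟩ := exists_algEquiv h
  exact (MulEquiv.prime_iff φ.toMulEquiv).mpr (prime_X 0)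

theorem not_dvd_of_span_pair : ¬ x ∣ w := by
  obtain ⟨φ, rfl, rfl⟩ := exists_algEquiv h
  rw [map_dvd_iff φ]
  exact not_X_dvd_X (by simp)

/-- Modulo `x` the maximal ideal is generated by the class of `w`, which is nonzero since `x` does
not divide `w`. -/
theorem isDiscreteValuationRing_localRing :
    ∃ _ : IsDomain (LocalRing x), IsDiscreteValuationRing (LocalRing x) ∧
      Irreducible (Ideal.Quotient.mk (Ideal.span {x}) w) := by
  have hx := prime_of_span_pair h
  have hdom : IsDomain (LocalRing x) :=
    (Ideal.Quotient.isDomain_iff_prime _).mpr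
      ((Ideal.span_singleton_prime hx.ne_zero).mpr hx)
  have hloc := isLocalRing_localRing hx.not_isUnit
  have hmax : maximalIdeal (LocalRing x) = Ideal.span {Ideal.Quotient.mk (Ideal.span {x}) w} := by
    rw [maximalIdeal_localRing hx.not_isUnit, ← h, Ideal.map_span, Set.image_pair,
      Ideal.Quotient.eq_zero_iff_mem.mpr (Ideal.mem_span_singleton_self x), Ideal.span_insert]
    simp
  have hw : Ideal.Quotient.mk (Ideal.span {x}) w ≠ 0 := by
    rw [Ne, Ideal.Quotient.eq_zero_iff_mem, Ideal.mem_span_singleton]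
    exact not_dvd_of_span_pair h
  have hnf : ¬ IsField (LocalRing x) := by
    rw [isField_iff_maximalIdeal_eq, hmax, Ideal.span_singleton_eq_bot]
    exact hw
  have hdvr : IsDiscreteValuationRing (LocalRing x) :=
    ((IsDiscreteValuationRing.TFAE (LocalRing x) hnf).out 4 0 :
      (maximalIdeal (LocalRing x)).IsPrincipal ↔ _).mp ⟨⟨_, hmax⟩⟩
  exact ⟨hdom, hdvr, (IsDiscreteValuationRing.irreducible_iff_uniformizer _).mpr hmax⟩

/-- The intersection number with `{x = 0}` is the order of the restriction to `{x = 0}`: modulo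
`x` every series is a unit times a power of `w`. -/
theorem exists_dvd_sub_isUnit_mul_pow {g : Series K} (hg : ¬ x ∣ g) :
    ∃ (k : ℕ) (u : Series K), IsUnit u ∧ x ∣ g - u * w ^ k ∧ interNum x g = k := by
  obtain ⟨_, _, hirr⟩ := isDiscreteValuationRing_localRing h
  have hx := prime_of_span_pair h
  have hg0 : Ideal.Quotient.mk (Ideal.span {x}) g ≠ 0 := by
    rwa [Ne, Ideal.Quotient.eq_zero_iff_mem, Ideal.mem_span_singleton]
  obtain ⟨k, v, hv⟩ := IsDiscreteValuationRing.eq_unit_mul_pow_irreducible hg0 hirr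
  obtain ⟨u, hu⟩ := Ideal.Quotient.mk_surjective (v : LocalRing x)
  have hloc : IsLocalHom (Ideal.Quotient.mk (Ideal.span {x})) :=
    IsLocalHom.of_surjective _ Ideal.Quotient.mk_surjective
  refine ⟨k, u, ?_, ?_, ?_⟩
  · exact isUnit_of_map_unit (Ideal.Quotient.mk (Ideal.span {x})) u (hu ▸ v.isUnit)
  · rw [← Ideal.mem_span_singleton, ← Ideal.Quotient.eq_zero_iff_mem, map_sub, map_mul, map_pow,
      hu, hv, sub_self]
  · rw [interNum_eq_ord hx.not_isUnit, Ring.ord_eq_addVal,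
      IsDiscreteValuationRing.addVal_def _ v hirr k hv]

theorem interNum_left_eq_top_iff {g : Series K} : interNum x g = ⊤ ↔ x ∣ g := by
  obtain ⟨_, _, hirr⟩ := isDiscreteValuationRing_localRing h
  rw [interNum_eq_ord (prime_of_span_pair h).not_isUnit, Ring.ord_eq_addVal,
    IsDiscreteValuationRing.addVal_eq_top_iff, Ideal.Quotient.eq_zero_iff_mem,
    Ideal.mem_span_singleton]

theorem interNum_left_pow (k : ℕ) : interNum x (w ^ k) = k := by
  obtain ⟨_, _, hirr⟩ := isDiscreteValuationRing_localRing h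
  rw [interNum_eq_ord (prime_of_span_pair h).not_isUnit, Ring.ord_eq_addVal, map_pow,
    IsDiscreteValuationRing.addVal_pow, IsDiscreteValuationRing.addVal_uniformizer hirr]
  simp

theorem interNum_left_le_of_dvd_sub_mul {a b c : Series K} (hd : x ∣ a - b * c) :
    interNum x b ≤ interNum x a := by
  obtain ⟨_, _, hirr⟩ := isDiscreteValuationRing_localRing h
  simp only [interNum_eq_ord (prime_of_span_pair h).not_isUnit, Ring.ord_eq_addVal,
    IsDiscreteValuationRing.addVal_le_iff_dvd]
  refine ⟨Ideal.Quotient.mk _ c, ?_⟩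
  rw [← map_mul, ← sub_eq_zero, ← map_sub, Ideal.Quotient.eq_zero_iff_mem,
    Ideal.mem_span_singleton]
  exact hd

end Parameters

end AlgebroidCurve

/-! ### Lengths of quotients and integral birational extensions. -/

namespace AlgebroidCurve
open IsLocalRing

section Length

variable {O M : Type*} [CommRing O] [AddCommGroup M] [Module O M]

/-- The sequence `0 → A/ι⁻¹P → M/P → M/ι(A) → 0` is exact. -/
theorem length_quotient_eq_add {A : Type*} [AddCommGroup A] [Module O A] (ι : A →ₗ[O] M)
    {P : Submodule O M} (hP : P ≤ LinearMap.range ι) :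
    Module.length O (M ⧸ P) =
      Module.length O (A ⧸ P.comap ι) + Module.length O (M ⧸ LinearMap.range ι) := by
  refine Module.length_eq_add_of_exact (Submodule.mapQ (P.comap ι) P ι le_rfl)
    (Submodule.factor hP) ?_ (Submodule.factor_surjective hP) ?_
  · rw [← LinearMap.ker_eq_bot, Submodule.ker_mapQ, Submodule.mkQ_map_self]
  · intro y
    obtain ⟨y, rfl⟩ := Submodule.mkQ_surjective _ y
    have h0 : Submodule.factor hP (P.mkQ y) = (LinearMap.range ι).mkQ y := rfl
    rw [h0, Submodule.mkQ_apply, Submodule.Quotient.mk_eq_zero]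
    constructor
    · rintro ⟨a, rfl⟩
      exact ⟨Submodule.Quotient.mk a, rfl⟩
    · rintro ⟨a, ha⟩
      obtain ⟨a, rfl⟩ := Submodule.mkQ_surjective _ a
      rw [Submodule.mkQ_apply, Submodule.mapQ_apply, Submodule.mkQ_apply,
        Submodule.Quotient.eq] at ha
      simpa using sub_mem (show ι a ∈ LinearMap.range ι from ⟨a, rfl⟩) (hP ha)

/-- The quotient of a module by the multiples of a regular element has the same length as for a
submodule of finite colength isomorphic to the ring. -/
theorem length_quotient_smul_eq_ord {ι : O →ₗ[O] M} (hι : Function.Injective ι) {g : O}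
    (hg : Function.Injective (LinearMap.lsmul O M g))
    (hfin : Module.length O (M ⧸ LinearMap.range ι) ≠ ⊤) :
    Module.length O (M ⧸ LinearMap.range (LinearMap.lsmul O M g)) = Ring.ord O g := by
  set N := LinearMap.range ι with hN
  set gN := N.map (LinearMap.lsmul O M g)
  have hgN : gN ≤ N := by
    rintro _ ⟨n, hn, rfl⟩
    exact N.smul_mem g hn
  -- The length of `M/gN` is computed twice, through `N` and through `gM`. Both sums contain the
  -- finite length of `M/N`, which cancels.
  have h1 := length_quotient_eq_add ι hgN
  have h2 := length_quotient_eq_add (LinearMap.lsmul O M g) (P := gN) LinearMap.map_le_range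
  have h3 : gN.comap ι = Ideal.span {g} := by
    ext a
    rw [Ideal.mem_span_singleton, Submodule.mem_comap]
    constructor
    · rintro ⟨_, ⟨b, rfl⟩, hb⟩
      exact ⟨b, hι (by rw [← hb, LinearMap.lsmul_apply, ← map_smul, smul_eq_mul])⟩
    · rintro ⟨b, rfl⟩
      exact ⟨ι b, ⟨b, rfl⟩, by rw [LinearMap.lsmul_apply, ← map_smul, smul_eq_mul]⟩
  rw [Submodule.comap_map_eq_of_injective hg, h1, h3, ← hN, add_comm] at h2
  exact (ENat.add_right_injective_of_ne_top hfin h2).symm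

/-- A finite module killed by `s` is a quotient of a finite power of `O/s`. -/
theorem length_ne_top_of_smul_eq_zero [Module.Finite O M] {s : O}
    (hs : Ring.ord O s ≠ ⊤) (h : ∀ m : M, s • m = 0) : Module.length O M ≠ ⊤ := by
  obtain ⟨n, v, hv⟩ := Module.Finite.exists_fin (R := O) (M := M)
  let l : Fin n → (O ⧸ Ideal.span {s}) →ₗ[O] M := fun i =>
    Submodule.liftQ _ (LinearMap.toSpanSingleton O M (v i)) (by
      rw [Ideal.span_singleton_le_iff_mem]; simp [h])
  let Φ := LinearMap.lsum O (fun _ : Fin n => O ⧸ Ideal.span {s}) O l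
  have hΦ : Function.Surjective Φ := by
    rw [← LinearMap.range_eq_top, eq_top_iff, ← hv, Submodule.span_le]
    rintro _ ⟨i, rfl⟩
    refine ⟨Pi.single i (Submodule.Quotient.mk 1), ?_⟩
    simp only [Φ, LinearMap.lsum_piSingle]
    exact (Submodule.liftQ_apply _ _ _).trans (by simp)
  refine ne_top_of_le_ne_top ?_ (Module.length_le_of_surjective Φ hΦ)
  rw [Module.length_pi_of_fintype, Finset.sum_const, nsmul_eq_mul]
  exact WithTop.mul_ne_top (ENat.natCast_ne_top _) hs

end Length

/-- `B` is an integral birational extension of the domain `O`. -/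
structure IsBirationalIntegral (O B : Type*) [CommRing O] [CommRing B] [Algebra O B] : Prop where
  isIntegral : Algebra.IsIntegral O B
  injective : Function.Injective (algebraMap O B)
  exists_smul_mem : ∀ b : B, ∃ s : O, s ≠ 0 ∧ ∃ a : O, s • b = algebraMap O B a

namespace IsBirationalIntegral

variable {O B : Type*} [CommRing O] [CommRing B] [IsDomain B] [Algebra O B]
  (hB : IsBirationalIntegral O B)
include hB

theorem lsmul_injective {g : O} (hg : g ≠ 0) : Function.Injective (LinearMap.lsmul O B g) := by
  intro a b hab
  simp only [LinearMap.lsmul_apply, Algebra.smul_def] at hab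
  exact mul_left_cancel₀ (fun h => hg (hB.injective (by rw [h, map_zero]))) hab

theorem exists_mem_of_ne_bot {J : Ideal B} (hJ : J ≠ ⊥) : ∃ g : O, g ≠ 0 ∧ algebraMap O B g ∈ J := by
  obtain ⟨j, hj, hj0⟩ := Submodule.exists_mem_ne_zero_of_ne_bot hJ
  obtain ⟨s, hs, a, ha⟩ := hB.exists_smul_mem j
  refine ⟨a, ?_, ha ▸ J.smul_of_tower_mem s hj⟩
  rintro rfl
  rw [map_zero] at ha
  exact hj0 (hB.lsmul_injective hs (by simpa using ha))

omit [IsDomain B] in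
/-- Finitely many elements of `B` have a common denominator. -/
theorem exists_common_smul [IsDomain O] (t : Finset B) :
    ∃ s : O, s ≠ 0 ∧ ∀ b ∈ Submodule.span O (t : Set B), ∃ a : O, s • b = algebraMap O B a := by
  classical
  induction t using Finset.induction_on with
  | empty =>
    refine ⟨1, one_ne_zero, fun b hb => ⟨0, ?_⟩⟩
    have : b = 0 := by simpa using hb
    simp [this]
  | insert c t _ ih =>
    obtain ⟨s, hs, h⟩ := ih
    obtain ⟨s', hs', a', ha'⟩ := hB.exists_smul_mem c
    refine ⟨s * s', mul_ne_zero hs hs', fun b hb => ?_⟩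
    rw [Finset.coe_insert, Submodule.mem_span_insert] at hb
    obtain ⟨r, z, hz, rfl⟩ := hb
    obtain ⟨a, ha⟩ := h z hz
    refine ⟨s * r * a' + s' * a, ?_⟩
    rw [smul_add, mul_comm s s', mul_smul s' s z, ha, mul_comm s' s, mul_smul, smul_comm s' r, ha']
    simp only [Algebra.smul_def, map_add, map_mul]
    ring

omit [IsDomain B] in
theorem exists_common_smul_subalgebra [IsDomain O] (T : Subalgebra O B) [Module.Finite O T] :
    ∃ s : O, s ≠ 0 ∧ ∀ b ∈ T, ∃ a : O, s • b = algebraMap O B a := by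
  obtain ⟨t, ht⟩ : (Subalgebra.toSubmodule T).FG := Module.Finite.iff_fg.mp ‹_›
  obtain ⟨s, hs, h⟩ := hB.exists_common_smul t
  exact ⟨s, hs, fun b hb => h b (by rw [ht]; exact hb)⟩

end IsBirationalIntegral

end AlgebroidCurve

/-! ### The Krull–Akizuki inequality. -/

namespace AlgebroidCurve
open IsLocalRing

namespace IsBirationalIntegral

variable {O B : Type*} [CommRing O] [CommRing B] [IsDomain B] [Algebra O B]
  (hB : IsBirationalIntegral O B) [IsDomain O] [IsNoetherianRing O] [Ring.KrullDimLE 1 O]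

omit [IsDomain B] [IsDomain O] [IsNoetherianRing O] [Ring.KrullDimLE 1 O] in
theorem finite_adjoin (hB : IsBirationalIntegral O B) (t : Finset B) :
    Module.Finite O (Algebra.adjoin O (t : Set B)) :=
  have := hB.isIntegral
  Module.Finite.iff_fg.mpr (fg_adjoin_of_finite t.finite_toSet
    fun x _ => Algebra.IsIntegral.isIntegral x)

include hB

/-- A common denominator kills `T/O`, which therefore has finite length, so multiplication by `g`
has the same colength on `T` as on `O`. -/
theorem length_subalgebra_quotient_eq_ord (T : Subalgebra O B) [Module.Finite O T] {g : O}
    (hg : g ≠ 0) :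
    Module.length O (T ⧸ LinearMap.range (LinearMap.lsmul O T g)) = Ring.ord O g := by
  obtain ⟨s, hs, h⟩ := hB.exists_common_smul_subalgebra T
  refine length_quotient_smul_eq_ord (ι := Algebra.linearMap O T) ?_ ?_ ?_
  · intro a b hab
    exact hB.injective (congrArg (fun z : T => (z : B)) hab)
  · intro a b hab
    exact Subtype.ext (hB.lsmul_injective hg (congrArg (fun z : T => (z : B)) hab))
  · refine length_ne_top_of_smul_eq_zero (Ring.ord_ne_top (mem_nonZeroDivisors_of_ne_zero hs)) ?_
    intro m
    obtain ⟨m, rfl⟩ := Submodule.mkQ_surjective _ m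
    obtain ⟨a, ha⟩ := h m m.2
    rw [← map_smul, Submodule.mkQ_apply, Submodule.Quotient.mk_eq_zero]
    exact ⟨a, Subtype.ext ha.symm⟩

variable [IsLocalRing O]

/-- The Krull–Akizuki inequality for an integral birational extension. -/
theorem length_quotient_le_ord (K : Type*) [Field K] [Algebra K O] [HasResidueField K O]
    [Module K B] [IsScalarTower K O B] {g : O} (hg : g ≠ 0) :
    Module.length O (B ⧸ LinearMap.range (LinearMap.lsmul O B g)) ≤ Ring.ord O g := by
  classical
  obtain ⟨n, hn⟩ := ENat.ne_top_iff_exists.mp (Ring.ord_ne_top (mem_nonZeroDivisors_of_ne_zero hg))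
  by_contra! hlt
  rw [← hn, ← length_eq_length_of_hasResidueField K, Module.length_eq_rank] at hlt
  have hlt' : ((n + 1 : ℕ) : Cardinal) ≤
      Module.rank K (B ⧸ LinearMap.range (LinearMap.lsmul O B g)) := by
    have h1 := Order.add_one_le_of_lt hlt
    rw [← Cardinal.natCast_le_toENat]
    simpa using h1
  obtain ⟨s, hs, hli⟩ := le_rank_iff_exists_linearIndependent_finset.mp hlt'
  -- Lifts of `n + 1` independent classes of `B/gB` generate a finite subalgebra `T`. They remain
  -- independent in `T/gT`, whose dimension is only `n`.
  choose b hb using fun x : B ⧸ LinearMap.range (LinearMap.lsmul O B g) =>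
    Submodule.mkQ_surjective _ x
  let T := Algebra.adjoin O ((s.image b : Finset B) : Set B)
  have hT : Module.Finite O T := hB.finite_adjoin _
  have hbT : ∀ x : s, b x ∈ T := fun x => Algebra.subset_adjoin (by simpa using ⟨x, x.2, rfl⟩)
  let j : (T ⧸ LinearMap.range (LinearMap.lsmul O T g)) →ₗ[O]
      (B ⧸ LinearMap.range (LinearMap.lsmul O B g)) :=
    Submodule.mapQ _ _ T.val.toLinearMap (by
      rintro _ ⟨y, rfl⟩
      exact ⟨y, rfl⟩)
  have hli' : LinearIndependent K (fun x : s =>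
      (Submodule.Quotient.mk ⟨b x, hbT x⟩ : T ⧸ LinearMap.range (LinearMap.lsmul O T g))) := by
    refine LinearIndependent.of_comp (j.restrictScalars K) ?_
    have : (⇑(j.restrictScalars K) ∘ fun x : s =>
        (Submodule.Quotient.mk ⟨b x, hbT x⟩ : T ⧸ LinearMap.range (LinearMap.lsmul O T g))) =
        fun x : s => (x : B ⧸ LinearMap.range (LinearMap.lsmul O B g)) := funext fun x => hb x
    rw [this]
    exact hli
  have h2 := hli'.cardinal_le_rank
  rw [Cardinal.mk_fintype, Fintype.card_coe, hs, ← Cardinal.natCast_le_toENat,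
    ← Module.length_eq_rank, length_eq_length_of_hasResidueField K (A := O),
    hB.length_subalgebra_quotient_eq_ord T hg, ← hn] at h2
  have : n + 1 ≤ n := by exact_mod_cast h2
  omega

theorem length_quotient_ne_top (K : Type*) [Field K] [Algebra K O] [HasResidueField K O]
    [Module K B] [IsScalarTower K O B] {g : O} (hg : g ≠ 0) :
    Module.length O (B ⧸ LinearMap.range (LinearMap.lsmul O B g)) ≠ ⊤ :=
  ne_top_of_le_ne_top (Ring.ord_ne_top (mem_nonZeroDivisors_of_ne_zero hg))
    (hB.length_quotient_le_ord K hg)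

omit [IsDomain B] [IsDomain O] [IsNoetherianRing O] [Ring.KrullDimLE 1 O] [IsLocalRing O] hB in
theorem restrictScalars_span_algebraMap (g : O) :
    (Ideal.span {algebraMap O B g}).restrictScalars O =
      LinearMap.range (LinearMap.lsmul O B g) := by
  ext x
  rw [Submodule.restrictScalars_mem, Ideal.mem_span_singleton]
  constructor
  · rintro ⟨y, rfl⟩
    exact ⟨y, by simp [Algebra.smul_def]⟩
  · rintro ⟨y, rfl⟩
    exact ⟨y, by simp [Algebra.smul_def]⟩

theorem length_quotient_span_ne_top (K : Type*) [Field K] [Algebra K O] [HasResidueField K O]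
    [Module K B] [IsScalarTower K O B] {g : O} (hg : g ≠ 0) :
    Module.length O (B ⧸ Ideal.span {algebraMap O B g}) ≠ ⊤ := by
  rw [← (Submodule.Quotient.restrictScalarsEquiv O (Ideal.span {algebraMap O B g})).length_eq,
    restrictScalars_span_algebraMap]
  exact hB.length_quotient_ne_top K hg

/-- A nonzero ideal contains the image of some nonzero `g` of `O`, and modulo `g` it sits in a
module of finite length. -/
theorem isNoetherianRing (K : Type*) [Field K] [Algebra K O] [HasResidueField K O]
    [Module K B] [IsScalarTower K O B] : IsNoetherianRing B := by
  rw [isNoetherianRing_iff_ideal_fg]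
  intro J
  by_cases hJ : J = ⊥
  · rw [hJ]; exact Submodule.fg_bot
  obtain ⟨g, hg, hgJ⟩ := hB.exists_mem_of_ne_bot hJ
  have h1 := hB.length_quotient_span_ne_top K hg
  rw [Module.length_ne_top_iff, isFiniteLength_iff_isNoetherian_isArtinian] at h1
  have := h1.1
  have : IsNoetherian B (B ⧸ Ideal.span {algebraMap O B g}) := isNoetherian_of_tower O this
  refine Submodule.fg_of_fg_map_of_fg_inf_ker (Ideal.span {algebraMap O B g}).mkQ
    (IsNoetherian.noetherian _) ?_
  rw [Submodule.ker_mkQ, inf_eq_right.mpr ((Ideal.span_singleton_le_iff_mem _).mpr hgJ)]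
  exact ⟨{algebraMap O B g}, by simp [Ideal.span]⟩

end IsBirationalIntegral

end AlgebroidCurve

/-! ### Integral birational extensions of complete local domains: discrete valuations and conductor.
-/

namespace AlgebroidCurve
open IsLocalRing

/-- Modulo the maximal ideal, `0` is a simple root of `X² - X + c` in every characteristic, the
derivative there being `-1`; Hensel's lemma lifts it. -/
theorem exists_sq_sub_add_eq_zero {O : Type*} [CommRing O] [IsLocalRing O]
    [IsAdicComplete (maximalIdeal O) O] {c : O} (hc : c ∈ maximalIdeal O) :
    ∃ s ∈ maximalIdeal O, s ^ 2 - s + c = 0 := by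
  obtain ⟨s, hs, hs0⟩ := HenselianRing.is_henselian (I := maximalIdeal O)
    (Polynomial.X ^ 2 - Polynomial.X + Polynomial.C c) (by monicity!) 0
    (by simpa using hc) (by simp)
  refine ⟨s, by simpa using hs0, ?_⟩
  simpa [Polynomial.IsRoot] using hs

/-- The powers of `b` generate a stationary chain modulo `I`. The outcome makes `b ^ (n + 1) * y`
idempotent modulo `I`. -/
theorem exists_pow_sub_mem {A : Type*} [CommRing A] (I : Ideal A) [IsArtinianRing (A ⧸ I)] (b : A) :
    ∃ (n : ℕ) (y : A), b ^ (n + 1) - b ^ (2 * (n + 1)) * y ∈ I := by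
  obtain ⟨n, y, hy⟩ := IsArtinian.exists_pow_succ_smul_dvd (Ideal.Quotient.mk I b)
    (1 : A ⧸ I)
  simp only [smul_eq_mul, mul_one] at hy
  set β := Ideal.Quotient.mk I b
  have key : ∀ k, β ^ (n + k) * y ^ k = β ^ n := by
    intro k
    induction k with
    | zero => simp
    | succ k ih =>
      calc β ^ (n + (k + 1)) * y ^ (k + 1) = (β ^ (n + 1) * y) * β ^ k * y ^ k := by ring
        _ = β ^ n := by rw [hy, ← pow_add, ih]
  obtain ⟨z, hz⟩ := Ideal.Quotient.mk_surjective y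
  refine ⟨n, z ^ (n + 1), ?_⟩
  rw [← Ideal.Quotient.eq_zero_iff_mem, map_sub, map_mul, map_pow, map_pow, map_pow, hz,
    sub_eq_zero]
  calc β ^ (n + 1) = β * β ^ n := by ring
    _ = β * (β ^ (n + (n + 1)) * y ^ (n + 1)) := by rw [key]
    _ = _ := by ring

namespace IsBirationalIntegral

variable {O B : Type*} [CommRing O] [CommRing B] [IsDomain B] [Algebra O B]
  (hB : IsBirationalIntegral O B) [IsDomain O] [IsNoetherianRing O] [Ring.KrullDimLE 1 O]
  [IsLocalRing O]

include hB

omit [IsDomain B] [IsDomain O] [IsNoetherianRing O] [Ring.KrullDimLE 1 O] in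
theorem comap_eq_maximalIdeal (M : Ideal B) [M.IsMaximal] :
    M.comap (algebraMap O B) = maximalIdeal O :=
  have := hB.isIntegral
  IsLocalRing.eq_maximalIdeal (Ideal.isMaximal_comap_of_isIntegral_of_isMaximal M)

omit [IsLocalRing O] in
theorem isArtinianRing_subalgebra_quotient (T : Subalgebra O B) [Module.Finite O T] {s : O}
    (hs : s ≠ 0) : IsArtinianRing (T ⧸ Ideal.span {algebraMap O T s}) := by
  have h1 : Module.length O (T ⧸ Ideal.span {algebraMap O T s}) ≠ ⊤ := by
    rw [← (Submodule.Quotient.restrictScalarsEquiv O (Ideal.span {algebraMap O T s})).length_eq,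
      restrictScalars_span_algebraMap, hB.length_subalgebra_quotient_eq_ord T hs]
    exact Ring.ord_ne_top (mem_nonZeroDivisors_of_ne_zero hs)
  rw [Module.length_ne_top_iff, isFiniteLength_iff_isNoetherian_isArtinian] at h1
  exact isArtinian_of_tower O h1.2

/-- An integral birational extension of a complete local domain of dimension one is local. -/
theorem isLocalRing [IsAdicComplete (maximalIdeal O) O] (hO : ¬ IsField O) : IsLocalRing B := by
  classical
  refine IsLocalRing.of_isUnit_or_isUnit_one_sub_self fun b => ?_
  by_contra! hcon
  obtain ⟨M₁, hM₁, hb₁⟩ := exists_max_ideal_of_mem_nonunits hcon.1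
  obtain ⟨M₂, hM₂, hb₂⟩ := exists_max_ideal_of_mem_nonunits hcon.2
  let T := Algebra.adjoin O (({b} : Finset B) : Set B)
  have hT : Module.Finite O T := hB.finite_adjoin _
  have hbT : b ∈ T := Algebra.subset_adjoin (by simp)
  obtain ⟨s₀, hs₀, h₀⟩ := hB.exists_common_smul_subalgebra T
  obtain ⟨g, hg, hg0⟩ : ∃ g ∈ maximalIdeal O, g ≠ 0 :=
    Submodule.exists_mem_ne_zero_of_ne_bot (mt isField_iff_maximalIdeal_eq.mpr hO)
  -- Besides clearing the denominators of `T`, `s` must lie in the maximal ideal, which is why `s₀`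
  -- is multiplied by `g`.
  set s := g * s₀ with hs
  have hs0 : s ≠ 0 := mul_ne_zero hg0 hs₀
  have hsm : s ∈ maximalIdeal O := Ideal.mul_mem_right _ _ hg
  have hsT : ∀ t ∈ T, ∃ a : O, s • t = algebraMap O B a := by
    intro t ht
    obtain ⟨a, ha⟩ := h₀ t ht
    exact ⟨g * a, by rw [hs, mul_smul, ha, Algebra.smul_def, map_mul]⟩
  have hmem : ∀ (M : Ideal B) [M.IsMaximal], ∀ c ∈ maximalIdeal O, algebraMap O B c ∈ M := by
    intro M _ c hc
    rwa [← hB.comap_eq_maximalIdeal M] at hc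
  have := hB.isArtinianRing_subalgebra_quotient T hs0
  obtain ⟨n, y, hy⟩ := exists_pow_sub_mem (Ideal.span {algebraMap O T s}) (⟨b, hbT⟩ : T)
  rw [Ideal.mem_span_singleton] at hy
  obtain ⟨t, ht⟩ := hy
  have ht' : b ^ (n + 1) - b ^ (2 * (n + 1)) * (y : B) = algebraMap O B s * t :=
    congrArg (fun z : T => (z : B)) ht
  -- An approximate idempotent: `e² - e` lies in `sT`, hence equals an element `c` of `O`. It lies
  -- in `M₁` while `1 - e` lies in `M₂`.
  set e : B := b ^ (n + 1) * y with he
  have hesq : e ^ 2 - e = s • (-(t : B) * y) := by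
    rw [Algebra.smul_def, he]
    linear_combination (-(y : B)) * ht'
  obtain ⟨c, hc⟩ := hsT (-(t : B) * y) (T.mul_mem (T.neg_mem t.2) y.2)
  rw [hc] at hesq
  have heM₁ : e ∈ M₁ := M₁.mul_mem_right _ (by rw [pow_succ]; exact M₁.mul_mem_left _ hb₁)
  have heM₂ : 1 - e ∈ M₂ := by
    have h1 : b ^ (n + 1) * (1 - e) ∈ M₂ := by
      have : b ^ (n + 1) * (1 - e) = algebraMap O B s * t := by
        rw [← ht', he]; ring
      rw [this]
      exact M₂.mul_mem_right _ (hmem M₂ s hsm)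
    refine (hM₂.isPrime.mem_or_mem h1).resolve_left fun h2 => ?_
    refine hM₂.ne_top ((Ideal.eq_top_iff_one _).mpr ?_)
    have := add_mem (hM₂.isPrime.mem_of_pow_mem _ h2) hb₂
    simpa using this
  have hcm : c ∈ maximalIdeal O := by
    rw [← hB.comap_eq_maximalIdeal M₁, Ideal.mem_comap, ← hesq]
    exact sub_mem (by rw [pow_two]; exact M₁.mul_mem_left _ heM₁) heM₁
  -- Since `(1 - 2e)² = 1 + 4c`, the element `e' = e + (1 - 2e)τ` satisfies `e'² - e' = (1 + 4c)(τ²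
  -- - τ) + c`. Hensel's lemma gives a `τ` from the maximal ideal of `O` making this zero; in a
  -- domain `e'` is then `0` or `1`, against `M₂` or `M₁`.
  have hu : IsUnit (1 + 4 * c) := by
    rw [← IsLocalRing.notMem_maximalIdeal]
    intro h
    have := sub_mem h (Ideal.mul_mem_left _ 4 hcm)
    rw [add_sub_cancel_right] at this
    exact (maximalIdeal.isMaximal O).ne_top ((Ideal.eq_top_iff_one _).mpr this)
  obtain ⟨u, hu⟩ := hu
  obtain ⟨σ, hσm, hσ⟩ := exists_sq_sub_add_eq_zero (c := ↑u⁻¹ * c) (Ideal.mul_mem_left _ _ hcm)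
  have hσ' : (1 + 4 * c) * (σ ^ 2 - σ) + c = 0 := by
    rw [← hu]
    linear_combination (u : O) * hσ - c * (u.mul_inv : (u : O) * ↑u⁻¹ = 1)
  have hσB : (1 + 4 * algebraMap O B c) * (algebraMap O B σ ^ 2 - algebraMap O B σ) +
      algebraMap O B c = 0 := by
    have := congrArg (algebraMap O B) hσ'
    simpa [map_ofNat (algebraMap O B) 4] using this
  set τ := algebraMap O B σ
  set e' := e + (1 - 2 * e) * τ with he'
  have hidem : e' * (e' - 1) = 0 := by
    rw [he']
    linear_combination hσB + (1 + 4 * (τ ^ 2 - τ)) * hesq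
  rcases mul_eq_zero.mp hidem with h0 | h1
  · refine hM₂.ne_top ((Ideal.eq_top_iff_one _).mpr ?_)
    have : (1 : B) = (1 - e) - (1 - 2 * e) * τ := by linear_combination h0
    rw [this]
    exact sub_mem heM₂ (M₂.mul_mem_left _ (hmem M₂ σ hσm))
  · refine hM₁.ne_top ((Ideal.eq_top_iff_one _).mpr ?_)
    have : (1 : B) = e + (1 - 2 * e) * τ := by linear_combination -h1
    rw [this]
    exact add_mem heM₁ (M₁.mul_mem_left _ (hmem M₁ σ hσm))

variable [IsAdicComplete (maximalIdeal O) O] (K : Type*) [Field K] [Algebra K O]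
  [HasResidueField K O] [Algebra K B] [IsScalarTower K O B]

include K in
-- For a nonzero prime `P`, the domain `B/P` is a quotient of an artinian ring `B/gB`, hence a
-- field; so `B` is a local Dedekind domain that is not a field.
theorem isDiscreteValuationRing [IsIntegrallyClosed B] (hO : ¬ IsField O) :
    IsDiscreteValuationRing B := by
  have := hB.isLocalRing hO
  have := hB.isNoetherianRing K
  have := hB.isIntegral
  have hnf : ¬ IsField B := fun h => hO (isField_of_isIntegral_of_isField hB.injective h)
  refine ((IsDiscreteValuationRing.TFAE B hnf).out 2 0 : IsDedekindDomain B ↔ _).mp ?_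
  have : Ring.DimensionLEOne B := by
    refine ⟨fun {P} hP hPp => ?_⟩
    obtain ⟨g, hg, hgP⟩ := hB.exists_mem_of_ne_bot hP
    have h1 := hB.length_quotient_span_ne_top K hg
    rw [Module.length_ne_top_iff, isFiniteLength_iff_isNoetherian_isArtinian] at h1
    have h2 : IsArtinianRing (B ⧸ Ideal.span {algebraMap O B g}) := isArtinian_of_tower O h1.2
    have h3 : IsArtinianRing (B ⧸ P) :=
      (Ideal.Quotient.factor_surjective ((Ideal.span_singleton_le_iff_mem P).mpr
        hgP)).isArtinianRing
    have : IsDomain (B ⧸ P) := Ideal.Quotient.isDomain P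
    exact Ideal.Quotient.maximal_of_isField P
      ((IsArtinianRing.isField_of_isDomain (B ⧸ P)))
  exact { }

omit [IsAdicComplete (maximalIdeal O) O] in
-- The residue field is a quotient of the finite-dimensional space `B/gB`, so it is algebraic over
-- the algebraically closed field `K`.
theorem hasResidueField [IsAlgClosed K] [IsLocalRing B] (hO : ¬ IsField O) :
    HasResidueField K B := by
  obtain ⟨g, hg, hg0⟩ : ∃ g ∈ maximalIdeal O, g ≠ 0 :=
    Submodule.exists_mem_ne_zero_of_ne_bot (mt isField_iff_maximalIdeal_eq.mpr hO)
  have hgB : algebraMap O B g ∈ maximalIdeal B := by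
    rwa [← hB.comap_eq_maximalIdeal (maximalIdeal B)] at hg
  have h1 := hB.length_quotient_span_ne_top K hg0
  rw [← length_eq_length_of_hasResidueField K, Module.length_ne_top_iff,
    isFiniteLength_iff_isNoetherian_isArtinian] at h1
  have hle : Ideal.span {algebraMap O B g} ≤ maximalIdeal B :=
    (Ideal.span_singleton_le_iff_mem _).mpr hgB
  have h2 : Module.Finite K (B ⧸ Ideal.span {algebraMap O B g}) :=
    have := h1.1
    inferInstance
  have h3 : Module.Finite K (B ⧸ maximalIdeal B) :=
    Module.Finite.of_surjective (Ideal.Quotient.factorₐ K hle).toLinearMap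
      (Ideal.Quotient.factor_surjective hle)
  have : IsDomain (B ⧸ maximalIdeal B) := Ideal.Quotient.isDomain _
  have : Algebra.IsIntegral K (B ⧸ maximalIdeal B) := Algebra.IsIntegral.of_finite _ _
  refine ⟨fun b => ?_⟩
  obtain ⟨c, hc⟩ := (IsAlgClosed.algebraMap_bijective_of_isIntegral (k := K)
    (K := B ⧸ maximalIdeal B)).2 (Ideal.Quotient.mk _ b)
  refine ⟨c, ?_⟩
  rw [← Ideal.Quotient.eq_zero_iff_mem, map_sub, ← hc, sub_eq_zero]
  rfl

include K in
/-- The conductor of `B` in `O` is nonzero. -/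
theorem exists_smul_mem_range [IsLocalRing B] (hO : ¬ IsField O) :
    ∃ s : O, s ≠ 0 ∧ ∀ b : B, ∃ a : O, s • b = algebraMap O B a := by
  have := hB.isNoetherianRing K
  obtain ⟨g, hg, hg0⟩ : ∃ g ∈ maximalIdeal O, g ≠ 0 :=
    Submodule.exists_mem_ne_zero_of_ne_bot (mt isField_iff_maximalIdeal_eq.mpr hO)
  have hmB : ∀ n, ∀ c ∈ maximalIdeal O ^ n, algebraMap O B c ∈ maximalIdeal B ^ n := by
    intro n c hc
    rw [← hB.comap_eq_maximalIdeal (maximalIdeal B)] at hc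
    exact Ideal.le_comap_pow (algebraMap O B) n hc
  have h1 := hB.length_quotient_ne_top K hg0
  rw [Module.length_ne_top_iff, isFiniteLength_iff_isNoetherian_isArtinian] at h1
  obtain ⟨t, ht⟩ := h1.1.noetherian ⊤
  choose lift hlift using
    Submodule.mkQ_surjective (LinearMap.range (LinearMap.lsmul O B g))
  classical
  obtain ⟨s, hs, hspan⟩ := hB.exists_common_smul (t.image lift)
  refine ⟨s, hs, fun b => ?_⟩
  -- Finitely many lifts span `B` over `O` modulo `gB`, and `s` clears their denominators. Iteration
  -- expands `s b` as a series in powers of `g` with coefficients in `O`.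
  have hstep : ∀ b : B, ∃ (a : O) (b' : B), s • b = algebraMap O B a + (g * s) • b' := by
    intro b
    have hb : (LinearMap.range (LinearMap.lsmul O B g)).mkQ b ∈
        (Submodule.span O ((t.image lift : Finset B) : Set B)).map
          (LinearMap.range (LinearMap.lsmul O B g)).mkQ := by
      rw [Submodule.map_span, Finset.coe_image, ← Set.image_comp]
      have : (⇑(LinearMap.range (LinearMap.lsmul O B g)).mkQ ∘ lift) = id := funext hlift
      rw [this, Set.image_id, ht]
      trivial
    obtain ⟨c, hc, hcb⟩ := hb
    rw [← sub_eq_zero, ← map_sub, Submodule.mkQ_apply, Submodule.Quotient.mk_eq_zero] at hcb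
    obtain ⟨b', hb'⟩ := hcb
    rw [LinearMap.lsmul_apply] at hb'
    obtain ⟨a, ha⟩ := hspan c hc
    refine ⟨a, -b', ?_⟩
    have : b = c - g • b' := by rw [hb']; ring
    rw [this, smul_sub, ha, mul_comm g s, mul_smul, smul_neg, smul_neg, sub_eq_add_neg]
  choose α β hαβ using hstep
  let z : ℕ → B := fun n => β^[n] b
  have hz : ∀ n, s • z n = algebraMap O B (α (z n)) + (g * s) • z (n + 1) := by
    intro n
    have : z (n + 1) = β (z n) := Function.iterate_succ_apply' β n b
    rw [this]
    exact hαβ _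
  let p : ℕ → O := fun n => ∑ i ∈ Finset.range n, g ^ i * α (z i)
  have hp : ∀ n, s • b = algebraMap O B (p n) + (g ^ n * s) • z n := by
    intro n
    induction n with
    | zero => simp [p, z]
    | succ n ih =>
      rw [ih, mul_smul, hz, show p (n + 1) = p n + g ^ n * α (z n) from
        Finset.sum_range_succ _ _]
      simp only [Algebra.smul_def, map_add, map_mul, map_pow]
      ring
  -- The partial sums converge in the complete ring `O`; the remainders `g^n s z_n` tend to zero in
  -- the separated ring `B`.
  obtain ⟨P, hP⟩ := IsPrecomplete.prec (I := maximalIdeal O) (M := O) inferInstance (f := p) (by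
    intro m n hmn
    rw [SModEq.comm, SModEq.sub_mem, smul_eq_mul, Ideal.mul_top]
    obtain ⟨k, rfl⟩ := Nat.exists_eq_add_of_le hmn
    have : p (m + k) - p m = g ^ m * ∑ i ∈ Finset.range k, g ^ i * α (z (m + i)) := by
      simp only [p, Finset.sum_range_add, add_sub_cancel_left, Finset.mul_sum]
      refine Finset.sum_congr rfl fun i _ => by ring
    rw [this]
    exact Ideal.mul_mem_right _ _ (Ideal.pow_mem_pow hg m))
  refine ⟨P, ?_⟩
  have hH : IsHausdorff (maximalIdeal B) B := inferInstance
  rw [← sub_eq_zero]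
  refine hH.haus _ fun n => ?_
  rw [SModEq.zero, smul_eq_mul, Ideal.mul_top]
  have h2 : s • b - algebraMap O B P =
      algebraMap O B (p n - P) + algebraMap O B (g ^ n) * (s • z n) := by
    rw [hp n]
    simp only [Algebra.smul_def, map_sub, map_mul]
    ring
  rw [h2]
  refine add_mem (hmB n _ ?_) (Ideal.mul_mem_right _ _ (hmB n _ (Ideal.pow_mem_pow hg n)))
  have := hP n
  rwa [SModEq.sub_mem, smul_eq_mul, Ideal.mul_top] at this

include K in
/-- The order of vanishing on `O` is the restriction of the valuation of `B`. -/
theorem ord_eq_addVal [IsAlgClosed K] [IsDiscreteValuationRing B] (hO : ¬ IsField O) {g : O}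
    (hg : g ≠ 0) :
    Ring.ord O g = IsDiscreteValuationRing.addVal B (algebraMap O B g) := by
  have := hB.hasResidueField K hO
  obtain ⟨s, hs, h⟩ := hB.exists_smul_mem_range K hO
  have h1 : LinearMap.range (LinearMap.lsmul O B s) ≤ LinearMap.range (Algebra.linearMap O B) := by
    rintro _ ⟨b, rfl⟩
    obtain ⟨a, ha⟩ := h b
    exact ⟨a, ha.symm⟩
  have h2 := length_quotient_smul_eq_ord (ι := Algebra.linearMap O B) hB.injective
    (hB.lsmul_injective hg) (ne_top_of_le_ne_top (hB.length_quotient_ne_top K hs)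
      (Module.length_le_of_surjective _ (Submodule.factor_surjective h1)))
  rw [← h2, ← Ring.ord_eq_addVal, Ring.ord, ← length_eq_length_of_hasResidueField K (A := B),
    ← restrictScalars_span_algebraMap,
    (Submodule.Quotient.restrictScalarsEquiv O (Ideal.span {algebraMap O B g})).length_eq,
    length_eq_length_of_hasResidueField K (A := O)]

end IsBirationalIntegral

end AlgebroidCurve

/-! ### The normalization of a branch and its valuation. -/

namespace AlgebroidCurve
open IsLocalRing IsDiscreteValuationRing

/-- Take for `c` the residue of the quotient `a/b`. -/
theorem exists_addVal_lt_sub {K V : Type*} [Field K] [CommRing V] [IsDomain V]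
    [IsDiscreteValuationRing V] [Algebra K V] [HasResidueField K V] {a b : V} (hb : b ≠ 0)
    (h : addVal V b ≤ addVal V a) :
    ∃ c : K, addVal V b < addVal V (a - algebraMap K V c * b) := by
  obtain ⟨d, rfl⟩ := addVal_le_iff_dvd.mp h
  obtain ⟨c, hc⟩ := HasResidueField.exists_sub_mem K d
  refine ⟨c, ?_⟩
  have h1 : b * d - algebraMap K V c * b = b * (d - algebraMap K V c) := by ring
  rw [h1, addVal_mul]
  have h2 : addVal V (d - algebraMap K V c) ≠ 0 := by
    rw [Ne, addVal_eq_zero_iff]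
    exact (mem_maximalIdeal _).mp hc
  have h3 : addVal V b ≠ ⊤ := by rwa [Ne, addVal_eq_top_iff]
  obtain ⟨n, hn⟩ := ENat.ne_top_iff_exists.mp h3
  rw [← hn]
  exact ENat.add_one_le_iff (ENat.natCast_ne_top n) |>.mp
    (add_le_add le_rfl (Order.one_le_iff_pos.mpr (pos_iff_ne_zero.mpr h2)))

variable {K : Type*} [Field K] {f : Series K} [hf : Fact (Irreducible f)]

instance : IsDomain (LocalRing f) :=
  (Ideal.Quotient.isDomain_iff_prime _).mpr
    ((Ideal.span_singleton_prime hf.out.ne_zero).mpr hf.out.prime)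

instance : IsLocalRing (LocalRing f) := isLocalRing_localRing hf.out.not_isUnit

instance : HasResidueField K (LocalRing f) := hasResidueField_localRing

instance : IsAdicComplete (maximalIdeal (LocalRing f)) (LocalRing f) :=
  isAdicComplete_localRing hf.out.not_isUnit

instance : Ring.KrullDimLE 1 (LocalRing f) := krullDimLE_localRing hf.out.ne_zero

theorem not_isField_localRing : ¬ IsField (LocalRing f) := by
  rw [isField_iff_maximalIdeal_eq, maximalIdeal_localRing hf.out.not_isUnit, maximalIdeal_series,
    Ideal.map_span, Ideal.span_eq_bot]
  intro h
  have h1 : ∀ i, Associated f (MvPowerSeries.X i) := fun i => by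
    refine hf.out.prime.associated_of_dvd (prime_X i) ?_
    rw [← Ideal.mem_span_singleton, ← Ideal.Quotient.eq_zero_iff_mem]
    exact h _ ⟨MvPowerSeries.X i, by fin_cases i <;> simp, rfl⟩
  exact not_X_dvd_X (K := K) (i := 0) (j := 1) (by simp) ((h1 0).symm.trans (h1 1)).dvd

theorem isBirationalIntegral_normalization :
    IsBirationalIntegral (LocalRing f) (Normalization f) where
  isIntegral := inferInstance
  injective := FaithfulSMul.algebraMap_injective _ _
  exists_smul_mem b := by
    obtain ⟨a, s, hs, h⟩ := IsFractionRing.div_surjective (A := LocalRing f)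
      (b : FractionRing (LocalRing f))
    refine ⟨s, nonZeroDivisors.ne_zero hs, a, Subtype.ext ?_⟩
    have hs0 : algebraMap (LocalRing f) (FractionRing (LocalRing f)) s ≠ 0 :=
      IsFractionRing.to_map_ne_zero_of_mem_nonZeroDivisors hs
    refine (Algebra.smul_def s (b : FractionRing (LocalRing f))).trans ?_
    rw [← h, mul_div_cancel₀ _ hs0]
    rfl

instance : IsIntegrallyClosed (Normalization f) := by
  have : Algebra.IsAlgebraic (LocalRing f) (FractionRing (LocalRing f)) :=
    IsLocalization.isAlgebraic _ (nonZeroDivisors (LocalRing f))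
  have : IsFractionRing (Normalization f) (FractionRing (LocalRing f)) :=
    integralClosure.isFractionRing_of_algebraic (fun x hx => by simpa using hx)
  exact (isIntegrallyClosed_iff_isIntegrallyClosedIn (FractionRing (LocalRing f))).mpr inferInstance

instance : IsDiscreteValuationRing (Normalization f) :=
  isBirationalIntegral_normalization.isDiscreteValuationRing K not_isField_localRing

variable [IsAlgClosed K]

instance : HasResidueField K (Normalization f) :=
  isBirationalIntegral_normalization.hasResidueField K not_isField_localRing

variable (f) in
/-- The map from `K[[x, y]]` to the normalization of the branch `{f = 0}`. -/
noncomputable def toNormalization : Series K →ₐ[K] Normalization f :=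
  (IsScalarTower.toAlgHom K (LocalRing f) (Normalization f)).comp
    (Ideal.Quotient.mkₐ K (Ideal.span {f}))

omit [IsAlgClosed K] in
theorem toNormalization_eq_zero_iff {g : Series K} : toNormalization f g = 0 ↔ f ∣ g := by
  rw [← Ideal.mem_span_singleton, ← Ideal.Quotient.eq_zero_iff_mem,
    ← (isBirationalIntegral_normalization (f := f)).injective.eq_iff, map_zero]
  rfl

/-- The substitute for a parametrization: intersection with a branch is a valuation, so it is
additive on products and ultrametric on sums. -/
theorem interNum_eq_addVal (g : Series K) :
    interNum f g = addVal (Normalization f) (toNormalization f g) := by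
  rw [interNum_eq_ord hf.out.not_isUnit]
  by_cases hg : f ∣ g
  · rw [toNormalization_eq_zero_iff.mpr hg, addVal_zero, Ideal.Quotient.eq_zero_iff_mem.mpr
      (Ideal.mem_span_singleton.mpr hg)]
    -- Both sides are infinite: a domain of finite length over itself would be a field.
    rw [Ring.ord_zero]
    by_contra h
    rw [← Ne, Module.length_ne_top_iff, isFiniteLength_iff_isNoetherian_isArtinian] at h
    have : IsArtinianRing (LocalRing f) := h.2
    exact not_isField_localRing (IsArtinianRing.isField_of_isDomain (LocalRing f))
  · rw [(isBirationalIntegral_normalization (f := f)).ord_eq_addVal K not_isField_localRing]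
    · rfl
    · rwa [Ne, Ideal.Quotient.eq_zero_iff_mem (I := Ideal.span {f}), Ideal.mem_span_singleton]

end AlgebroidCurve

/-! ### The semigroup of a branch and its conductor. -/

namespace AlgebroidCurve
open IsLocalRing IsDiscreteValuationRing

/-- The conductor exponent of the branch `{f = 0}`: the least `c` such that the semigroup contains
every natural number `j ≥ c`. -/
noncomputable def condExp {K : Type*} [Field K] (f : Series K) : ℕ :=
  sInf {c | ∀ j, c ≤ j → j ∈ semigroup f}

section NumericalSemigroup

/-- The symmetry of `⟨q, p⟩`. Write `s = a q + b p` with `0 ≤ b < q`; a gap has `a < 0`, and `t =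
(-1 - a) q + (q - 1 - b) p` is its mirror image. -/
theorem exists_add_mem_closure_pair {q p s : ℕ} (h : Nat.Coprime q p)
    (hs : s ∉ AddSubmonoid.closure ({q, p} : Set ℕ)) :
    ∃ t ∈ AddSubmonoid.closure ({q, p} : Set ℕ), s + t + 1 = (q - 1) * (p - 1) := by
  rw [AddSubmonoid.mem_closure_pair] at hs
  push Not at hs
  have hq : 0 < q := by
    rcases Nat.eq_zero_or_pos q with rfl | h'
    · have hp : p = 1 := by simpa using h
      exact absurd (by simp [hp]) (hs 0 s)
    · exact h'
  have hp : 0 < p := by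
    rcases Nat.eq_zero_or_pos p with rfl | h'
    · have hp : q = 1 := by simpa using h
      exact absurd (by simp [hp]) (hs s 0)
    · exact h'
  have hbez := Nat.gcd_eq_gcd_ab q p
  rw [Nat.Coprime.gcd_eq_one h, Nat.cast_one] at hbez
  set u := Nat.gcdA q p
  set v := Nat.gcdB q p
  have hb0 : 0 ≤ (v * s) % q := Int.emod_nonneg _ (by omega)
  have hbq : (v * s) % q < q := Int.emod_lt_of_pos _ (by omega)
  have hdiv := Int.emod_add_mul_ediv (v * s) q
  have hs' : (s : ℤ) = (u * s + p * (v * s / q)) * q + (v * s) % q * p := by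
    linear_combination (s : ℤ) * hbez - (p : ℤ) * hdiv
  generalize u * s + p * (v * s / q) = a at hs'
  generalize (v * s) % q = b at hs' hb0 hbq
  have ha : a < 0 := by
    by_contra! ha
    lift a to ℕ using ha
    lift b to ℕ using hb0
    refine hs a b ?_
    simp only [smul_eq_mul]
    exact_mod_cast hs'.symm
  obtain ⟨a', rfl⟩ : ∃ a' : ℕ, a = -(a' + 1) := ⟨(-a - 1).toNat, by omega⟩
  obtain ⟨b', rfl⟩ : ∃ b' : ℕ, b = q - 1 - b' := ⟨(q - 1 - b).toNat, by omega⟩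
  refine ⟨a' • q + b' • p, (AddSubmonoid.mem_closure_pair _ _ _).2 ⟨a', b', rfl⟩, ?_⟩
  simp only [smul_eq_mul]
  zify [hq, hp]
  rw [hs']
  ring

end NumericalSemigroup

variable {K : Type*} [Field K] [IsAlgClosed K] {f : Series K} [hf : Fact (Irreducible f)]

theorem interNum_mul (g h : Series K) : interNum f (g * h) = interNum f g + interNum f h := by
  simp only [interNum_eq_addVal, map_mul, addVal_mul]

theorem interNum_pow (g : Series K) (n : ℕ) : interNum f (g ^ n) = n * interNum f g := by
  simp only [interNum_eq_addVal, map_pow, addVal_pow, nsmul_eq_mul]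

theorem min_interNum_le_add (g h : Series K) :
    min (interNum f g) (interNum f h) ≤ interNum f (g + h) := by
  simp only [interNum_eq_addVal, map_add, addVal_add]

theorem interNum_eq_top_iff {g : Series K} : interNum f g = ⊤ ↔ f ∣ g := by
  rw [interNum_eq_addVal, addVal_eq_top_iff, toNormalization_eq_zero_iff]

theorem interNum_eq_zero_of_isUnit {g : Series K} (hg : IsUnit g) : interNum f g = 0 := by
  rw [interNum_eq_addVal, addVal_eq_zero_iff]
  exact hg.map _

theorem interNum_le_of_dvd {g h : Series K} (hgh : g ∣ h) : interNum f g ≤ interNum f h := by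
  obtain ⟨k, rfl⟩ := hgh
  rw [interNum_mul]
  exact le_self_add

/-- The series `g` with `k ≤ (f, g)₀` form an ideal. -/
def interIdeal (f : Series K) [Fact (Irreducible f)] (k : ℕ∞) : Ideal (Series K) where
  carrier := {g | k ≤ interNum f g}
  zero_mem' := by
    change k ≤ _
    rw [interNum_eq_top_iff.mpr (dvd_zero f)]
    exact le_top
  add_mem' {a b} ha hb := (le_min ha hb).trans (min_interNum_le_add a b)
  smul_mem' c a (ha : k ≤ _) := ha.trans (interNum_le_of_dvd (Dvd.intro_left c rfl))

omit [IsAlgClosed K] in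
theorem exists_forall_mem_range :
    ∃ c : ℕ, ∀ b : Normalization f, c ≤ addVal _ b → b ∈ Set.range (toNormalization f) := by
  obtain ⟨s, hs, h⟩ := (isBirationalIntegral_normalization (f := f)).exists_smul_mem_range K
    not_isField_localRing
  have hs0 : addVal (Normalization f) (algebraMap _ _ s) ≠ ⊤ := by
    rw [Ne, addVal_eq_top_iff]
    intro h0
    exact hs (isBirationalIntegral_normalization.injective (h0.trans (map_zero _).symm))
  obtain ⟨c, hc⟩ := ENat.ne_top_iff_exists.mp hs0
  refine ⟨c, fun b hb => ?_⟩
  rw [hc, addVal_le_iff_dvd] at hb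
  obtain ⟨b, rfl⟩ := hb
  obtain ⟨a, ha⟩ := h b
  obtain ⟨g, rfl⟩ := Ideal.Quotient.mk_surjective a
  exact ⟨g, ha.symm.trans (Algebra.smul_def _ _)⟩

theorem mem_semigroup_iff_exists_addVal {n : ℕ} :
    n ∈ semigroup f ↔ ∃ g, addVal (Normalization f) (toNormalization f g) = n := by
  constructor
  · rintro ⟨g, -, hg⟩
    exact ⟨g, by rw [← interNum_eq_addVal, hg]⟩
  · rintro ⟨g, hg⟩
    rw [← interNum_eq_addVal] at hg
    refine ⟨g, fun h => ?_, hg⟩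
    rw [interNum_eq_top_iff.mpr h] at hg
    exact ENat.natCast_ne_top n hg.symm

theorem mem_semigroup_of_interNum {g : Series K} {n : ℕ} (hg : interNum f g = n) :
    n ∈ semigroup f :=
  mem_semigroup_iff_exists_addVal.mpr ⟨g, by rw [← interNum_eq_addVal, hg]⟩

theorem condExp_spec : ∀ j, condExp f ≤ j → j ∈ semigroup f := by
  obtain ⟨c, hc⟩ := exists_forall_mem_range (f := f)
  refine Nat.sInf_mem (s := {c | ∀ j, c ≤ j → j ∈ semigroup f}) ⟨c, fun j hj => ?_⟩
  obtain ⟨ϖ, hϖ⟩ := IsDiscreteValuationRing.exists_irreducible (Normalization f)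
  have h : addVal (Normalization f) (ϖ ^ j) = j := by
    rw [addVal_pow, addVal_uniformizer hϖ]; simp
  obtain ⟨g, hg⟩ := hc (ϖ ^ j) (by rw [h]; exact_mod_cast hj)
  exact mem_semigroup_iff_exists_addVal.mpr ⟨g, by rw [hg, h]⟩

omit [IsAlgClosed K] hf in
theorem condExp_le {c : ℕ} (h : ∀ j, c ≤ j → j ∈ semigroup f) : condExp f ≤ c := Nat.sInf_le h

/-- From the conductor of the semigroup on, each value is taken by a series, so multiples of such
series can be subtracted to raise the value of `b` until it reaches the conductor of the ring. Hence
the two conductors agree. -/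
theorem mem_range_of_condExp_le {b : Normalization f} (hb : condExp f ≤ addVal _ b) :
    b ∈ Set.range (toNormalization f) := by
  obtain ⟨c, hc⟩ := exists_forall_mem_range (f := f)
  -- `k` bounds how far the value of `b` still is from the range where every element is known to
  -- come from a series.
  suffices H : ∀ (k : ℕ) (b : Normalization f), condExp f ≤ addVal _ b → c ≤ addVal _ b + k →
      b ∈ Set.range (toNormalization f) from H c b hb le_add_self
  intro k
  induction k with
  | zero => intro b _ h; exact hc b (by simpa using h)
  | succ k ih =>
    intro b hb h
    by_cases hb0 : addVal _ b = ⊤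
    · exact ⟨0, by rw [map_zero, addVal_eq_top_iff.mp hb0]⟩
    obtain ⟨j, hj⟩ := ENat.ne_top_iff_exists.mp hb0
    rw [← hj] at hb h
    obtain ⟨g, hg⟩ := mem_semigroup_iff_exists_addVal.mp (condExp_spec (f := f) j (by exact_mod_cast hb))
    have hg0 : toNormalization f g ≠ 0 := by
      intro h0
      rw [h0, addVal_zero] at hg
      exact ENat.natCast_ne_top j hg.symm
    obtain ⟨t, ht⟩ := exists_addVal_lt_sub (K := K) hg0 (by rw [hg, hj] : _ ≤ addVal _ b)
    rw [hg] at ht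
    have ht' := Order.add_one_le_of_lt ht
    obtain ⟨r, hr⟩ := ih _ (hb.trans ht.le) (h.trans (by
      push_cast
      rw [add_comm (k : ℕ∞) 1, ← add_assoc]
      gcongr))
    refine ⟨r + algebraMap K _ t * g, ?_⟩
    rw [map_add, hr, map_mul, AlgHom.commutes, sub_add_cancel]

theorem condExp_le_of_forall_mem_range {c : ℕ}
    (hc : ∀ b : Normalization f, c ≤ addVal _ b → b ∈ Set.range (toNormalization f)) :
    condExp f ≤ c := by
  refine condExp_le fun j hj => ?_
  obtain ⟨ϖ, hϖ⟩ := IsDiscreteValuationRing.exists_irreducible (Normalization f)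
  have h : addVal (Normalization f) (ϖ ^ j) = j := by
    rw [addVal_pow, addVal_uniformizer hϖ]; simp
  obtain ⟨g, hg⟩ := hc (ϖ ^ j) (by rw [h]; exact_mod_cast hj)
  exact mem_semigroup_iff_exists_addVal.mpr ⟨g, by rw [hg, h]⟩

theorem exists_interNum_lt_sub {a b : Series K} (hb : ¬ f ∣ b) (h : interNum f b ≤ interNum f a) :
    ∃ c : K, interNum f b < interNum f (a - algebraMap K _ c * b) := by
  rw [interNum_eq_addVal, interNum_eq_addVal] at h
  rw [← toNormalization_eq_zero_iff] at hb
  obtain ⟨c, hc⟩ := exists_addVal_lt_sub (K := K) hb h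
  refine ⟨c, ?_⟩
  rw [interNum_eq_addVal, interNum_eq_addVal, map_sub, map_mul, AlgHom.commutes]
  exact hc

section Parameters

variable {x w : Series K} (h : Ideal.span {x, w} = maximalIdeal (Series K)) {n N : ℕ}
  (hx : interNum f x = n)
include h hx

/-- Otherwise `g/x` has value at least the conductor and comes from a series `r`, so `f` divides `g
- x r`. Modulo `x` this makes `w ^ (n - 1)` a multiple of `f`, although `(x, f)₀ = n > n - 1`. -/
theorem interNum_lt_condExp_add (hn : n ≠ 0) {g : Series K} (hg : x ∣ g - w ^ (n - 1)) :
    interNum f g < condExp f + n := by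
  by_contra! hlt
  have h1 : interNum f x ≤ interNum f g := by
    rw [hx]; exact le_add_self.trans hlt
  rw [interNum_eq_addVal, interNum_eq_addVal, addVal_le_iff_dvd] at h1
  obtain ⟨b, hb⟩ := h1
  have h2 : condExp f ≤ addVal _ b := by
    rw [interNum_eq_addVal, hb, addVal_mul, ← interNum_eq_addVal, hx, add_comm (n : ℕ∞)] at hlt
    exact (ENat.add_le_add_iff_right (ENat.natCast_ne_top n)).mp hlt
  obtain ⟨r, rfl⟩ := mem_range_of_condExp_le h2
  rw [← map_mul, ← sub_eq_zero, ← map_sub, toNormalization_eq_zero_iff] at hb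
  obtain ⟨a, ha⟩ := hb
  obtain ⟨s, hs⟩ := hg
  have h3 : x ∣ w ^ (n - 1) - f * a := ⟨r - s, by rw [← ha, mul_sub, ← hs]; ring⟩
  have h4 := interNum_left_le_of_dvd_sub_mul h h3
  rw [interNum_left_pow h, interNum_comm, hx] at h4
  have : n ≤ n - 1 := by exact_mod_cast h4
  omega

variable (hw : N ≤ interNum f w)
include hw

/-- The previous bound for `g = w ^ (n - 1)` reads `(n - 1) N < c + n`. -/
theorem mul_le_condExp : (n - 1) * (N - 1) ≤ condExp f := by
  rcases Nat.eq_zero_or_pos n with rfl | hn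
  · simp
  have h1 := interNum_lt_condExp_add h hx hn.ne' (g := w ^ (n - 1)) (by simp)
  rw [interNum_pow] at h1
  have h2 : ((n - 1 : ℕ) : ℕ∞) * N < condExp f + n := lt_of_le_of_lt (by gcongr) h1
  have h3 : (n - 1) * N < condExp f + n := by exact_mod_cast h2
  obtain ⟨n, rfl⟩ := Nat.exists_eq_add_of_lt hn
  rcases N with _ | N
  · simp
  simp only [zero_add, Nat.add_sub_cancel] at h3 ⊢
  nlinarith

variable (hn : 2 ≤ n) (hN : 1 ≤ N) (hc : condExp f = (n - 1) * (N - 1))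
include hn hN hc

theorem interNum_eq_of_condExp_eq : interNum f w = N := by
  refine le_antisymm ?_ hw
  by_contra! hlt
  have h1 := mul_le_condExp h hx (N := N + 1) (by push_cast; exact Order.add_one_le_of_lt hlt)
  rw [hc, Nat.add_sub_cancel] at h1
  have := Nat.le_of_mul_le_mul_left h1 (by omega)
  omega

/-- If `d = gcd(n, N) ≥ 2`, then `w ^ (n/d)` and `x ^ (N/d)` have equal values, and some combination
`w ^ (n/d) - c x ^ (N/d)` has larger value. Times `w ^ (n - 1 - n/d)` it is congruent to `w ^ (n -
1)` modulo `x` and has value at least `(n - 1) N + 1`, one more than `interNum_lt_condExp_add`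
allows. -/
theorem coprime_of_condExp_eq : Nat.Coprime n N := by
  have hwN := interNum_eq_of_condExp_eq h hx hw hn hN hc
  by_contra hcop
  obtain ⟨n1, hn1⟩ := Nat.gcd_dvd_left n N
  obtain ⟨N1, hN1⟩ := Nat.gcd_dvd_right n N
  set d := Nat.gcd n N with hd
  have hd2 : 2 ≤ d := by
    have : d ≠ 0 := fun h0 => by rw [h0] at hn1; omega
    have : d ≠ 1 := hcop
    omega
  have hn1' : n1 ≠ 0 := by rintro rfl; omega
  have hN1' : N1 ≠ 0 := by rintro rfl; omega
  have hle : n1 ≤ n - 1 := by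
    have : 2 * n1 ≤ d * n1 := Nat.mul_le_mul_right _ hd2
    omega
  have e1 : interNum f (x ^ N1) = (n1 * N : ℕ) := by
    rw [interNum_pow, hx]
    have : N1 * n = n1 * N := by
      calc N1 * n = N1 * (d * n1) := by rw [← hn1]
        _ = n1 * (d * N1) := by ring
        _ = n1 * N := by rw [← hN1]
    exact_mod_cast this
  have e2 : interNum f (w ^ n1) = (n1 * N : ℕ) := by
    rw [interNum_pow, hwN]; push_cast; rfl
  obtain ⟨c, hlt⟩ := exists_interNum_lt_sub (f := f) (a := w ^ n1) (b := x ^ N1)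
    (fun hdvd => by
      rw [interNum_eq_top_iff.mpr hdvd] at e1; exact ENat.natCast_ne_top _ e1.symm)
    (by rw [e1, e2])
  rw [e1] at hlt
  have hL := interNum_lt_condExp_add h hx (by omega)
    (g := (w ^ n1 - algebraMap K _ c * x ^ N1) * w ^ (n - 1 - n1)) (by
      have e : n - 1 = n1 + (n - 1 - n1) := by omega
      have e3 : w ^ (n - 1) = w ^ n1 * w ^ (n - 1 - n1) := by rw [← pow_add, ← e]
      rw [e3, ← sub_mul, sub_sub_cancel_left]
      exact Dvd.dvd.mul_right ((Dvd.dvd.mul_left (dvd_pow_self x hN1') _).neg_right) _)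
  rw [interNum_mul, interNum_pow, hwN] at hL
  have h5 : ((n1 * N : ℕ) : ℕ∞) + 1 + (n - 1 - n1 : ℕ) * N < condExp f + n :=
    lt_of_le_of_lt (add_le_add (Order.add_one_le_of_lt hlt) le_rfl) hL
  have h6 : n1 * N + 1 + (n - 1 - n1) * N < condExp f + n := by exact_mod_cast h5
  have h7 : n1 * N + (n - 1 - n1) * N = (n - 1) * N := by
    rw [← add_mul]; congr 1; omega
  have h8 : (n - 1) * N = (n - 1) * (N - 1) + (n - 1) := by
    obtain ⟨N, rfl⟩ := Nat.exists_eq_add_of_le' hN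
    simp only [Nat.add_sub_cancel]; ring
  rw [hc] at h6
  omega

/-- An extra element `s` of the semigroup, added to its mirror image in `⟨n, N⟩`, would put `(n -
1)(N - 1) - 1` in the semigroup and lower the conductor. -/
theorem semigroup_eq_of_condExp_eq :
    semigroup f = (AddSubmonoid.closure {n, N} : AddSubmonoid ℕ) := by
  have hwN := interNum_eq_of_condExp_eq h hx hw hn hN hc
  have hcop := coprime_of_condExp_eq h hx hw hn hN hc
  have hsub : ∀ t ∈ AddSubmonoid.closure ({n, N} : Set ℕ), ∃ g, interNum f g = t := by
    intro t ht
    rw [AddSubmonoid.mem_closure_pair] at ht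
    obtain ⟨a, b, rfl⟩ := ht
    refine ⟨x ^ a * w ^ b, ?_⟩
    rw [interNum_mul, interNum_pow, interNum_pow, hx, hwN]
    simp
  ext s
  constructor
  · rintro ⟨g, -, hg⟩
    by_contra hs
    obtain ⟨t, ht, hst⟩ := exists_add_mem_closure_pair hcop hs
    obtain ⟨g', hg'⟩ := hsub t ht
    have h1 : s + t ∈ semigroup f :=
      mem_semigroup_of_interNum (g := g * g') (by rw [interNum_mul, hg, hg']; simp)
    have h2 : condExp f ≤ s + t := by
      refine condExp_le fun j hj => ?_
      rcases hj.eq_or_lt with rfl | hj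
      · exact h1
      · exact condExp_spec j (by omega)
    omega
  · intro hs
    obtain ⟨g, hg⟩ := hsub s hs
    exact mem_semigroup_of_interNum hg

end Parameters

/-- The semigroup contains two consecutive integers. -/
theorem coprime_of_semigroup_eq {q p : ℕ}
    (hs : semigroup f = (AddSubmonoid.closure {q, p} : AddSubmonoid ℕ)) : Nat.Coprime q p := by
  have hd : ∀ t ∈ semigroup f, Nat.gcd q p ∣ t := by
    intro t ht
    rw [hs, SetLike.mem_coe, AddSubmonoid.mem_closure_pair] at ht
    obtain ⟨a, b, rfl⟩ := ht
    exact dvd_add (Dvd.dvd.mul_left (Nat.gcd_dvd_left _ _) _)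
      (Dvd.dvd.mul_left (Nat.gcd_dvd_right _ _) _)
  have h1 := hd _ (condExp_spec (f := f) _ le_rfl)
  have h2 := hd _ (condExp_spec (f := f) (condExp f + 1) (Nat.le_succ _))
  exact Nat.dvd_one.mp ((Nat.dvd_add_right h1).mp h2)

/-- Mirror images bound the gaps above by `(q - 1)(p - 1) - 1`, and this Frobenius number `q p - q -
p` is itself a gap when `q, p > 1`. -/
theorem condExp_eq_of_semigroup_eq {q p : ℕ}
    (hs : semigroup f = (AddSubmonoid.closure {q, p} : AddSubmonoid ℕ)) :
    condExp f = (q - 1) * (p - 1) := by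
  have hcop := coprime_of_semigroup_eq hs
  refine le_antisymm (condExp_le fun j hj => ?_) ?_
  · rw [hs]
    by_contra hj'
    obtain ⟨t, -, ht⟩ := exists_add_mem_closure_pair hcop hj'
    omega
  · rcases le_or_gt q 1 with hq | hq
    · rw [Nat.sub_eq_zero_of_le hq]; simp
    rcases le_or_gt p 1 with hp | hp
    · rw [Nat.sub_eq_zero_of_le hp]; simp
    have hF := (frobeniusNumber_pair hcop hq hp).1
    by_contra! hlt
    refine hF ?_
    have h1 := condExp_spec (f := f) (q * p - q - p) (by
      obtain ⟨q, rfl⟩ := Nat.exists_eq_add_of_lt hq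
      obtain ⟨p, rfl⟩ := Nat.exists_eq_add_of_lt hp
      have : (1 + q + 1) * (1 + p + 1) - (1 + q + 1) - (1 + p + 1) + 1 = (1 + q) * (1 + p) := by
        have : (1 + q + 1) * (1 + p + 1) = (1 + q) * (1 + p) - 1 + (1 + p + 1) + (1 + q + 1) := by
          have : (1 + q) * (1 + p) = q + p + q * p + 1 := by ring
          rw [this]; simp; ring
        have h2 : (1 + q) * (1 + p) = q + p + q * p + 1 := by ring
        omega
      simp only [Nat.add_sub_cancel] at hlt
      omega)
    rw [hs] at h1
    exact h1

end AlgebroidCurve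

/-! ### Multiplicity and transversal smooth branches. -/

namespace AlgebroidCurve
open IsLocalRing IsDiscreteValuationRing MvPowerSeries

section Branch

variable {K : Type*} [Field K] [IsAlgClosed K] {f : Series K} [hf : Fact (Irreducible f)]

theorem interNum_add_eq_of_lt {g h : Series K} (hgh : interNum f g < interNum f h) :
    interNum f (g + h) = interNum f g := by
  refine le_antisymm ?_ ?_
  · by_contra! hlt
    have h1 := min_interNum_le_add (f := f) (g + h) (-h)
    have h2 : interNum f (-h) = interNum f h := interNum_congr (Associated.refl f) (Associated.neg_left (Associated.refl h))
    rw [add_neg_cancel_right, h2] at h1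
    exact absurd h1 (not_le.mpr (lt_min hlt hgh))
  · exact (le_min le_rfl hgh.le).trans (min_interNum_le_add g h)

theorem mul_le_interNum_of_mem_pow {k : ℕ∞} (hk : ∀ a ∈ maximalIdeal (Series K), k ≤ interNum f a)
    {n : ℕ} {g : Series K} (hg : g ∈ maximalIdeal (Series K) ^ n) : n * k ≤ interNum f g := by
  induction n generalizing g with
  | zero => simp
  | succ n ih =>
    rw [pow_succ] at hg
    induction hg using Submodule.mul_induction_on' with
    | mem_mul_mem a ha b hb =>
      rw [interNum_mul]
      push_cast
      rw [add_mul, one_mul]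
      exact add_le_add (ih ha) (hk b hb)
    | add a _ b _ ha hb => exact (le_min ha hb).trans (min_interNum_le_add a b)

omit [IsAlgClosed K] in
theorem one_le_interNum {a : Series K} (ha : a ∈ maximalIdeal (Series K)) : 1 ≤ interNum f a := by
  have hfm : f ∈ maximalIdeal (Series K) := hf.out.not_isUnit
  rw [Order.one_le_iff_pos, pos_iff_ne_zero, interNum_eq_length, Ne, Module.length_eq_zero_iff,
    Ideal.Quotient.subsingleton_iff]
  intro h
  refine (maximalIdeal.isMaximal (Series K)).ne_top (top_le_iff.mp (h ▸ Ideal.span_le.mpr ?_))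
  rintro g (rfl | rfl)
  · exact hfm
  · exact ha

theorem order_le_interNum (g : Series K) : g.order ≤ interNum f g := by
  by_cases hg : g = 0
  · rw [hg, interNum_eq_top_iff.mpr (dvd_zero f)]; exact le_top
  · rw [← ne_zero_iff_order_finite.mp hg]
    have := mul_le_interNum_of_mem_pow (f := f) (k := 1) (fun a ha => one_le_interNum ha)
      (mem_maximalIdeal_pow_iff.mpr (ne_zero_iff_order_finite.mp hg).le)
    simpa using this

end Branch

variable {K : Type*} [Field K]

theorem order_eq_mult {f : Series K} (hf : f ≠ 0) : f.order = mult f :=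
  (ne_zero_iff_order_finite.mp hf).symm

theorem monomial_single_add_single (i j : ℕ) (a : K) :
    (monomial (Finsupp.single 0 i + Finsupp.single 1 j) a : Series K) =
      algebraMap K _ a * (X 0 ^ i * X 1 ^ j) := by
  rw [X_pow_eq, X_pow_eq, monomial_mul_monomial, MvPowerSeries.algebraMap_apply,
    Algebra.algebraMap_self_apply, ← monomial_zero_eq_C_apply,
    monomial_mul_monomial, zero_add, one_mul, mul_one]

theorem span_X_one_sub (b : K) :
    Ideal.span {X 1 - algebraMap K _ b * X 0, X 0} = maximalIdeal (Series K) := by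
  rw [maximalIdeal_series, Set.pair_comm (X 0 : Series K)]
  apply le_antisymm <;> rw [Ideal.span_le]
  · rintro f (rfl | rfl)
    · exact Ideal.mem_span_pair.mpr ⟨1, -algebraMap K _ b, by ring⟩
    · exact Ideal.subset_span (by simp)
  · rintro f (rfl | rfl)
    · exact Ideal.mem_span_pair.mpr ⟨1, algebraMap K _ b, by ring⟩
    · exact Ideal.subset_span (by simp)

/-- Modulo higher order terms and the line `y = b x`, a series of order `n` is a multiple of `x ^ n`
depending polynomially on `b`. -/
theorem exists_polynomial_sub_mem {g : Series K} (hg : g ≠ 0) :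
    ∃ P : Polynomial K, P ≠ 0 ∧ ∀ b : K, ∃ r s : Series K, s ∈ maximalIdeal (Series K) ^ (mult g + 1) ∧
      g = algebraMap K _ (P.eval b) * X 0 ^ mult g + (X 1 - algebraMap K _ b * X 0) * r + s := by
  classical
  set n := mult g with hn
  -- `E j` is the exponent of `x ^ (n - j) y ^ j`, and the polynomial chosen below is the leading
  -- form of `g` evaluated at `(1, b)`.
  let E : ℕ → (Fin 2 →₀ ℕ) := fun j => Finsupp.single 0 (n - j) + Finsupp.single 1 j
  have hE : ∀ d : Fin 2 →₀ ℕ, d.degree = n → E (d 1) = d := by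
    intro d hd
    have : d 0 + d 1 = n := by
      rw [← hd, Finsupp.degree_eq_sum, Fin.sum_univ_two]
    ext i
    fin_cases i <;> simp [E]
    all_goals omega
  have hE1 : ∀ j, E j 1 = j := fun j => by simp [E]
  have hEd : ∀ j ∈ Finset.range (n + 1), (E j).degree = n := by
    intro j hj
    rw [Finset.mem_range] at hj
    simp only [E, map_add, Finsupp.degree_single]
    omega
  refine ⟨∑ j ∈ Finset.range (n + 1), Polynomial.monomial j (coeff (E j) g), ?_, fun b => ?_⟩
  · intro h0
    obtain ⟨d, hd, hdn⟩ := exists_coeff_ne_zero_and_order (ne_zero_iff_order_finite.mp hg)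
    have hd' : d.degree = n := by
      rw [order_eq_mult hg] at hdn
      exact ENat.natCast_inj.mp hdn
    have hd1 : d 1 ∈ Finset.range (n + 1) := by
      rw [Finset.mem_range, ← hd', Finsupp.degree_eq_sum, Fin.sum_univ_two]
      omega
    have := congrArg (Polynomial.coeff · (d 1)) h0
    simp only [Polynomial.finsetSum_coeff, Polynomial.coeff_monomial, Finset.sum_ite_eq', hd1,
      if_true, Polynomial.coeff_zero, hE d hd'] at this
    exact hd this
  · have hdvd : X 1 - algebraMap K (Series K) b * X 0 ∣
        (∑ j ∈ Finset.range (n + 1), monomial (E j) (coeff (E j) g)) -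
        algebraMap K _ ((∑ j ∈ Finset.range (n + 1),
          Polynomial.monomial j (coeff (E j) g)).eval b) * X 0 ^ n := by
      rw [Polynomial.eval_finsetSum, map_sum, Finset.sum_mul, ← Finset.sum_sub_distrib]
      refine Finset.dvd_sum fun j hj => ?_
      have hj' : n = n - j + j := by rw [Finset.mem_range] at hj; omega
      have e : (X 0 : Series K) ^ n = X 0 ^ (n - j) * X 0 ^ j := by rw [← pow_add, ← hj']
      rw [monomial_single_add_single, Polynomial.eval_monomial, map_mul, map_pow, e]
      obtain ⟨k, hk⟩ := sub_dvd_pow_sub_pow (X 1 : Series K) (algebraMap K _ b * X 0) j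
      exact ⟨algebraMap K _ (coeff (E j) g) * X 0 ^ (n - j) * k, by
        rw [mul_pow] at hk
        linear_combination (algebraMap K _ (coeff (E j) g) * X 0 ^ (n - j)) * hk⟩
    obtain ⟨r, hr⟩ := hdvd
    refine ⟨r, g - ∑ j ∈ Finset.range (n + 1), monomial (E j) (coeff (E j) g), ?_, ?_⟩
    · rw [mem_maximalIdeal_pow_iff]
      refine le_order fun d hd => ?_
      have hd' : d.degree ≤ n := by
        have : d.degree < n + 1 := by exact_mod_cast hd
        omega
      rw [map_sub, map_sum]
      simp only [coeff_monomial]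
      rcases hd'.eq_or_lt with h | h
      · have hd1 : d 1 ∈ Finset.range (n + 1) := by
          rw [Finset.mem_range, ← h, Finsupp.degree_eq_sum, Fin.sum_univ_two]
          omega
        rw [Finset.sum_eq_single_of_mem (d 1) hd1, hE d h, if_pos rfl, sub_self]
        intro j hj hjd
        rw [if_neg]
        rintro rfl
        exact hjd (hE1 j).symm
      · rw [coeff_of_lt_order (by rw [order_eq_mult hg]; exact_mod_cast h), Finset.sum_eq_zero,
          sub_zero]
        intro j hj
        rw [if_neg]
        rintro rfl
        exact h.ne (hEd j hj)
    · linear_combination hr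

variable [IsAlgClosed K]

/-- The roots of `P` are the slopes of the tangents of `g`; along any other line the leading form
survives and determines the order. -/
theorem exists_polynomial_interNum_eq {g : Series K} (hg : g ≠ 0) :
    ∃ P : Polynomial K, P ≠ 0 ∧ ∀ b : K, P.eval b ≠ 0 →
      interNum (X 1 - algebraMap K _ b * X 0) g = mult g := by
  obtain ⟨P, hP, h⟩ := exists_polynomial_sub_mem hg
  refine ⟨P, hP, fun b hb => ?_⟩
  obtain ⟨r, s, hs, hg'⟩ := h b
  have hspan := span_X_one_sub b
  have : Fact (Irreducible (X 1 - algebraMap K (Series K) b * X 0)) :=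
    ⟨(prime_of_span_pair hspan).irreducible⟩
  generalize X 1 - algebraMap K (Series K) b * X 0 = x at *
  have h1 : interNum x (algebraMap K _ (P.eval b) * X 0 ^ mult g) = mult g := by
    rw [interNum_mul, interNum_left_pow hspan, interNum_eq_zero_of_isUnit, zero_add]
    exact (IsUnit.mk0 _ hb).map _
  have h2 : ((mult g : ℕ) : ℕ∞) < interNum x (x * r + s) := by
    have h3 := min_interNum_le_add (f := x) (x * r) s
    rw [interNum_eq_top_iff.mpr (dvd_mul_right x r), min_eq_right le_top] at h3
    refine lt_of_lt_of_le ?_ h3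
    refine lt_of_lt_of_le ?_ (order_le_interNum s)
    refine lt_of_lt_of_le ?_ (mem_maximalIdeal_pow_iff.mp hs)
    exact_mod_cast Nat.lt_succ_self _
  calc interNum x g = _ := by conv_lhs => rw [hg', add_assoc]
    _ = mult g := by rw [interNum_add_eq_of_lt (by rwa [h1]), h1]

theorem exists_interNum_eq_mult {g : Series K} (hg : g ≠ 0) (b₀ : K) :
    ∃ b : K, b ≠ b₀ ∧ interNum (X 1 - algebraMap K _ b * X 0) g = mult g := by
  obtain ⟨P, hP, h⟩ := exists_polynomial_interNum_eq hg
  have hQ : P * (Polynomial.X - Polynomial.C b₀) ≠ 0 :=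
    mul_ne_zero hP (Polynomial.X_sub_C_ne_zero b₀)
  obtain ⟨b, hb⟩ : ∃ b, (P * (Polynomial.X - Polynomial.C b₀)).eval b ≠ 0 := by
    by_contra! hall
    exact hQ (Polynomial.funext fun b => by rw [hall b, Polynomial.eval_zero])
  rw [Polynomial.eval_mul] at hb
  refine ⟨b, ?_, h b (left_ne_zero_of_mul hb)⟩
  rintro rfl
  simp at hb

/-- Both sides are additive in `F`, and the inequality `order ≤ (x, ·)₀` holds for each factor, so
equality for the product forces it for the factors. -/
theorem interNum_eq_mult_of_dvd {x g F : Series K} (hx : Irreducible x) (hF : F ≠ 0) (hg : g ∣ F)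
    (h : interNum x F = mult F) : interNum x g = mult g := by
  have : Fact (Irreducible x) := ⟨hx⟩
  obtain ⟨k, rfl⟩ := hg
  have hg0 := left_ne_zero_of_mul hF
  have hk0 := right_ne_zero_of_mul hF
  rw [interNum_mul, ← order_eq_mult hF, order_mul] at h
  refine le_antisymm ?_ (order_eq_mult hg0 ▸ order_le_interNum g)
  rw [← order_eq_mult hg0]
  have h2 := order_le_interNum (f := x) k
  by_contra! hlt
  have h3 : g.order + k.order < interNum x g + interNum x k :=
    ENat.add_lt_add_of_lt_of_le (by rw [order_eq_mult hk0]; exact ENat.natCast_ne_top _) hlt h2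
  exact h3.ne' h

/-- Take a line transversal to both `F` and `w`. From `(x, w)₀ = 1` it follows that `w` is a unit
times `X 0` modulo `x`, so `x, w` are parameters. -/
theorem exists_transversal {F w : Series K} (hF : F ≠ 0) (hw : mult w = 1) :
    ∃ x, Ideal.span {x, w} = maximalIdeal (Series K) ∧ interNum x F = mult F := by
  have hw0 : w ≠ 0 := by
    rintro rfl
    simp [mult] at hw
  obtain ⟨b, -, hb⟩ := exists_interNum_eq_mult (mul_ne_zero hF hw0) 0
  have hspan := span_X_one_sub b
  generalize X 1 - algebraMap K (Series K) b * X 0 = x at *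
  have hx := (prime_of_span_pair hspan).irreducible
  refine ⟨x, ?_, interNum_eq_mult_of_dvd hx (mul_ne_zero hF hw0) (dvd_mul_right _ _) hb⟩
  have h1 := interNum_eq_mult_of_dvd hx (mul_ne_zero hF hw0) (dvd_mul_left _ _) hb
  have hxw : ¬ x ∣ w := fun h => by
    rw [(interNum_left_eq_top_iff hspan).mpr h] at h1; exact ENat.natCast_ne_top _ h1.symm
  obtain ⟨k, u, hu, ⟨r, hr⟩, hk⟩ := exists_dvd_sub_isUnit_mul_pow hspan hxw
  have hk1 : k = 1 := by
    rw [h1, hw] at hk; exact_mod_cast hk.symm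
  rw [hk1, pow_one] at hr
  obtain ⟨v, hv⟩ := hu.exists_left_inv
  rw [← hspan]
  apply le_antisymm <;> rw [Ideal.span_le]
  · rintro f (rfl | rfl)
    · exact Ideal.subset_span (by simp)
    · exact Ideal.mem_span_pair.mpr ⟨r, u, by linear_combination -hr⟩
  · rintro f (rfl | rfl)
    · exact Ideal.subset_span (by simp)
    · exact Ideal.mem_span_pair.mpr ⟨-v * r, v, by linear_combination v * hr + X 0 * hv⟩

/-- Two distinct lines transversal to `f` have intersection number `m(f)` with it and generate the
maximal ideal. -/
theorem mult_le_interNum {f a : Series K} (hf : Irreducible f) (ha : a ∈ maximalIdeal (Series K)) :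
    mult f ≤ interNum f a := by
  have : Fact (Irreducible f) := ⟨hf⟩
  obtain ⟨b, -, hb⟩ := exists_interNum_eq_mult hf.ne_zero 0
  obtain ⟨c, hc, hc'⟩ := exists_interNum_eq_mult hf.ne_zero b
  suffices h : maximalIdeal (Series K) ≤ interIdeal f (mult f) from h ha
  rw [interNum_comm] at hb hc'
  have h1 : X 1 - algebraMap K _ b * X 0 ∈ interIdeal f (mult f) := hb.ge
  have h2 : X 1 - algebraMap K _ c * X 0 ∈ interIdeal f (mult f) := hc'.ge
  have h3 : X 0 ∈ interIdeal f (mult f) := by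
    have : (X 0 : Series K) = algebraMap K _ (c - b)⁻¹ *
        ((X 1 - algebraMap K _ b * X 0) - (X 1 - algebraMap K _ c * X 0)) := by
      have : algebraMap K (Series K) (c - b)⁻¹ * algebraMap K _ (c - b) = 1 := by
        rw [← map_mul, inv_mul_cancel₀ (sub_ne_zero.mpr hc), map_one]
      rw [map_sub] at this
      linear_combination -X 0 * this
    rw [this]
    exact Ideal.mul_mem_left _ _ (sub_mem h1 h2)
  rw [← span_X_one_sub b, Ideal.span_le]
  rintro f (rfl | rfl)
  · exact h1
  · exact h3

end AlgebroidCurve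

/-! ### The Newton polygon of a branch and a lower bound for intersection numbers. -/

namespace AlgebroidCurve
open IsLocalRing IsDiscreteValuationRing MvPowerSeries

section Weighted

variable {K : Type*} [Field K]

theorem weightedOrder_X_pow_mul_X_pow (w : Fin 2 → ℕ) (i j : ℕ) :
    (X 0 ^ i * X 1 ^ j : Series K).weightedOrder w = (i * w 0 + j * w 1 : ℕ) := by
  have h := monomial_single_add_single (K := K) i j 1
  rw [map_one (algebraMap K (Series K)), one_mul] at h
  rw [← h, weightedOrder_monomial_of_ne_zero w one_ne_zero, map_add, Finsupp.weight_single,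
    Finsupp.weight_single]
  simp

theorem coeff_single_one_ne_zero {H u : Series K} {k : ℕ} (hu : IsUnit u)
    (h : X 0 ∣ H - u * X 1 ^ k) : coeff (Finsupp.single 1 k) H ≠ 0 := by
  rw [X_dvd_iff] at h
  have h1 := h (Finsupp.single 1 k) (by simp)
  have h2 : coeff (Finsupp.single 1 k) (u * X 1 ^ k) = constantCoeff u := by
    have := coeff_add_mul_monomial (0 : Fin 2 →₀ ℕ) (Finsupp.single 1 k) u (1 : K)
    rw [zero_add, ← X_pow_eq] at this
    rw [this, mul_one, coeff_zero_eq_constantCoeff_apply]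
  rw [map_sub, h2, sub_eq_zero] at h1
  rw [h1]
  exact (isUnit_iff_constantCoeff.mp hu).ne_zero

end Weighted

variable {K : Type*} [Field K] [IsAlgClosed K] {f : Series K} [hf : Fact (Irreducible f)]

section Parameters

variable {x w : Series K} (h : Ideal.span {x, w} = maximalIdeal (Series K)) {n N : ℕ}
  (hx : interNum f x = n) (hw : N ≤ interNum f w)
include h hx hw

omit h in
-- The element `w ^ n / x ^ N` has nonnegative value, hence is integral over the local ring; this is
-- its integral equation, of degree `e`, with denominators cleared.
theorem exists_mul_eq_pow_add_sum :
    ∃ (e : ℕ) (C : ℕ → Series K) (H : Series K), f * H =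
      w ^ (n * e) + ∑ k ∈ Finset.range e, C k * (x ^ (N * (e - k)) * w ^ (n * k)) := by
  have h1 : interNum f (x ^ N) ≤ interNum f (w ^ n) := by
    rw [interNum_pow, interNum_pow, hx, mul_comm]; gcongr
  rw [interNum_eq_addVal, interNum_eq_addVal, addVal_le_iff_dvd] at h1
  obtain ⟨b, hb⟩ := h1
  obtain ⟨p, hp, hpb⟩ := (isBirationalIntegral_normalization (f := f)).isIntegral.isIntegral b
  choose C hC using fun k => Ideal.Quotient.mk_surjective (p.coeff k)
  have hC' : ∀ k, algebraMap (LocalRing f) (Normalization f) (p.coeff k) = toNormalization f (C k) :=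
    fun k => by rw [← hC]; rfl
  set e := p.natDegree
  have hzero : toNormalization f
      (w ^ (n * e) + ∑ k ∈ Finset.range e, C k * (x ^ (N * (e - k)) * w ^ (n * k))) = 0 := by
    rw [Polynomial.eval₂_eq_sum_range, Finset.sum_range_succ, hp.coeff_natDegree, map_one,
      one_mul, add_comm] at hpb
    have h2 := congrArg (toNormalization f (x ^ N) ^ e * ·) hpb
    simp only [mul_add, mul_zero, Finset.mul_sum] at h2
    rw [← mul_pow, ← hb] at h2
    rw [← h2, map_add, map_sum]
    congr 1
    · rw [map_pow, map_pow, pow_mul]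
    · refine Finset.sum_congr rfl fun k hk => ?_
      have hke : e = (e - k) + k := by rw [Finset.mem_range] at hk; omega
      have e1 : toNormalization f (x ^ N) ^ e =
          toNormalization f (x ^ N) ^ (e - k) * toNormalization f (x ^ N) ^ k := by
        rw [← pow_add, ← hke]
      rw [map_mul, map_mul, pow_mul w, map_pow _ (w ^ n), hb, pow_mul x, map_pow _ (x ^ N), hC', e1]
      ring
  obtain ⟨H, hH⟩ := toNormalization_eq_zero_iff.mp hzero
  exact ⟨e, C, H, hH.symm⟩

/-- Give `x` weight `n` and `w` weight `N`. The right side of the integral equation has weighted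
order at least `n e N`. The cofactor `H` contains a pure power `w ^ (n e - n)`, so its weighted
order is at most `(n e - n) N`; by multiplicativity at least `n N` remains for `f`. -/
theorem mul_le_weightedOrder (hN : N ≠ 0) {φ : Series K ≃ₐ[K] Series K}
    (h0 : φ (X 0) = x) (h1 : φ (X 1) = w) :
    ((n * N : ℕ) : ℕ∞) ≤ (φ.symm f).weightedOrder ![n, N] := by
  obtain ⟨e, C, H, hH⟩ := exists_mul_eq_pow_add_sum hx hw
  have hxirr : Fact (Irreducible x) := ⟨(prime_of_span_pair h).irreducible⟩
  have hdvd : x ∣ ∑ k ∈ Finset.range e, C k * (x ^ (N * (e - k)) * w ^ (n * k)) := by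
    refine Finset.dvd_sum fun k hk => Dvd.dvd.mul_left (Dvd.dvd.mul_right (dvd_pow_self x ?_) _) _
    rw [Finset.mem_range] at hk
    exact mul_ne_zero hN (by omega)
  -- Only the pure power of `w` survives modulo `x`, since `N ≠ 0`; this fixes `(x, H)₀`.
  have hxH : (n : ℕ∞) + interNum x H = (n * e : ℕ) := by
    rw [← hx, interNum_comm f x, ← interNum_mul, hH, interNum_add_eq_of_lt, interNum_left_pow h]
    rw [interNum_left_pow h, interNum_eq_top_iff.mpr hdvd]
    exact ENat.natCast_lt_top _
  have hxH' : ¬ x ∣ H := by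
    intro hd
    rw [interNum_eq_top_iff.mpr hd, add_top] at hxH
    exact ENat.natCast_ne_top _ hxH.symm
  obtain ⟨k, u, hu, hk, hkx⟩ := exists_dvd_sub_isUnit_mul_pow h hxH'
  have hnk : n + k = n * e := by rw [hkx] at hxH; exact_mod_cast hxH
  have h0' : φ.symm x = X 0 := by rw [← h0, φ.symm_apply_apply]
  have h1' : φ.symm w = X 1 := by rw [← h1, φ.symm_apply_apply]
  have hHo : (φ.symm H).weightedOrder ![n, N] ≤ (k * N : ℕ) := by
    have hk' := map_dvd φ.symm hk
    rw [map_sub, map_mul, map_pow, h0', h1'] at hk'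
    refine (weightedOrder_le _ (coeff_single_one_ne_zero (hu.map φ.symm) hk')).trans ?_
    rw [Finsupp.weight_single]
    simp
  have hGo : ((n * e * N : ℕ) : ℕ∞) ≤ (φ.symm f * φ.symm H).weightedOrder ![n, N] := by
    rw [← map_mul, hH, map_add, map_sum]
    refine le_trans (le_min ?_ ?_) (min_weightedOrder_le_add _)
    · have := weightedOrder_X_pow_mul_X_pow (K := K) ![n, N] 0 (n * e)
      rw [pow_zero, one_mul] at this
      rw [map_pow, h1', this]
      simp
    · refine Finset.sum_induction _
        (fun s : Series K => ((n * e * N : ℕ) : ℕ∞) ≤ s.weightedOrder ![n, N])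
        (fun a b ha hb => (le_min ha hb).trans (min_weightedOrder_le_add _)) (by simp) ?_
      intro j hj
      rw [map_mul, map_mul, map_pow, map_pow, h0', h1']
      refine le_trans ?_ (le_weightedOrder_mul _)
      rw [weightedOrder_X_pow_mul_X_pow]
      refine le_add_left ?_
      rw [Finset.mem_range] at hj
      obtain ⟨i, rfl⟩ := Nat.exists_eq_add_of_lt hj
      have : j + i + 1 - j = i + 1 := by omega
      rw [this]
      simp only [Matrix.cons_val_zero, Matrix.cons_val_one]
      apply le_of_eq
      congr 1
      ring
  rw [weightedOrder_mul] at hGo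
  by_contra! hlt
  have h2 := hGo.trans_lt (ENat.add_lt_add_of_lt_of_le
    (ne_top_of_le_ne_top (ENat.natCast_ne_top _) hHo) hlt hHo)
  have h3 : n * e * N < n * N + k * N := by exact_mod_cast h2
  rw [← hnk] at h3
  linarith [add_mul n k N]

/-- Each monomial `x ^ a w ^ b` of `f` has `a n + b N ≥ n N`, hence value at least `a n' + b N' ≥
min (N n') (N' n)` on `g`. -/
theorem min_mul_le_interNum {g : Series K} [hg : Fact (Irreducible g)] {n' N' : ℕ}
    (hx' : n' ≤ interNum g x) (hw' : N' ≤ interNum g w) :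
    ((min (N * n') (N' * n) : ℕ) : ℕ∞) ≤ interNum f g := by
  have hxm : x ∈ maximalIdeal (Series K) := h ▸ Ideal.subset_span (by simp)
  have hn : n ≠ 0 := by
    rintro rfl
    have := one_le_interNum (f := f) hxm
    rw [hx] at this
    exact absurd this (by simp)
  rcases eq_or_ne N 0 with rfl | hN
  · simp
  obtain ⟨φ, h0, h1⟩ := exists_algEquiv h
  have hwo := mul_le_weightedOrder h hx hw hN h0 h1
  set k := min (N * n') (N' * n) with hk
  rw [interNum_comm]
  suffices hmem : φ.symm f ∈ (interIdeal g k).comap φ by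
    have : (k : ℕ∞) ≤ interNum g (φ (φ.symm f)) := hmem
    rwa [φ.apply_symm_apply] at this
  -- Testing monomials suffices even for infinitely many of them, because series of order at least
  -- `k` already have value at least `k` on `g`.
  refine mem_of_forall_monomial_mem (n := k) ?_ fun e he => ?_
  · rw [← Ideal.map_le_iff_le_comap, Ideal.map_pow]
    have hm : (maximalIdeal (Series K)).map φ ≤ maximalIdeal (Series K) := by
      rw [Ideal.map_le_iff_le_comap]
      intro s hs
      have hs' : ¬ IsUnit s := hs
      change ¬ IsUnit (φ s)
      rwa [MulEquiv.isUnit_map φ]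
    exact (Ideal.pow_right_mono hm k).trans fun s hs =>
      (mem_maximalIdeal_pow_iff.mp hs).trans (order_le_interNum s)
  · change (k : ℕ∞) ≤ interNum g (φ (X 0 ^ e 0 * X 1 ^ e 1))
    rw [map_mul, map_pow, map_pow, h0, h1, interNum_mul, interNum_pow, interNum_pow]
    have h2 := hwo.trans (weightedOrder_le _ he)
    have h3 : Finsupp.weight ![n, N] e = e 0 * n + e 1 * N := by
      rw [Finsupp.weight_apply, Finsupp.sum_fintype _ _ (by simp), Fin.sum_univ_two]
      simp
    rw [h3] at h2
    have h4 : n * N ≤ e 0 * n + e 1 * N := by exact_mod_cast h2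
    have h5 : k ≤ e 0 * n' + e 1 * N' := by
      have hk1 : k ≤ N * n' := min_le_left _ _
      have hk2 : k ≤ N' * n := min_le_right _ _
      refine Nat.le_of_mul_le_mul_left (c := n * N) ?_ (by positivity)
      calc n * N * k ≤ (e 0 * n + e 1 * N) * k := Nat.mul_le_mul_right _ h4
        _ = e 0 * n * k + e 1 * N * k := by ring
        _ ≤ e 0 * n * (N * n') + e 1 * N * (N' * n) := by gcongr
        _ = n * N * (e 0 * n' + e 1 * N') := by ring
    refine le_trans (?_ : (k : ℕ∞) ≤ (e 0 * n' + e 1 * N' : ℕ)) ?_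
    · exact_mod_cast h5
    · push_cast
      gcongr

end Parameters

end AlgebroidCurve

/-! ### The total ring of fractions of a reduced curve. -/

namespace AlgebroidCurve
open IsLocalRing IsDiscreteValuationRing

section Factors

variable {K : Type*} [Field K] {ι : Type*} [Fintype ι] [DecidableEq ι] {F : ι → Series K}
  (hF : ∀ i, Irreducible (F i)) (hne : Pairwise fun i j => ¬ Associated (F i) (F j))

include hF hne

omit [Fintype ι] [DecidableEq ι] in
theorem prod_dvd_of_forall_dvd {s : Finset ι} {g : Series K} (h : ∀ i ∈ s, F i ∣ g) :
    ∏ i ∈ s, F i ∣ g :=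
  Finset.prod_dvd_of_isRelPrime (fun i _ j _ hij => (hF i).isRelPrime_iff_not_dvd.mpr fun hd =>
    hne hij ((hF i).associated_of_dvd (hF j) hd)) h

theorem not_dvd_prod_erase (i : ι) : ¬ F i ∣ ∏ j ∈ Finset.univ.erase i, F j := by
  rw [(hF i).prime.dvd_finsetProd_iff]
  rintro ⟨j, hj, hd⟩
  exact hne (Finset.ne_of_mem_erase hj).symm ((hF i).associated_of_dvd (hF j) hd)

omit [DecidableEq ι] in
theorem dvd_iff_forall_dvd {f : Series K} (hf : Associated (∏ i, F i) f) {g : Series K} :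
    f ∣ g ↔ ∀ i, F i ∣ g := by
  rw [← hf.dvd_iff_dvd_left]
  exact ⟨fun h i => (Finset.dvd_prod_of_mem F (Finset.mem_univ i)).trans h,
    fun h => prod_dvd_of_forall_dvd hF hne fun i _ => h i⟩

theorem mk_mem_nonZeroDivisors_iff {f : Series K} (hf : Associated (∏ i, F i) f) {g : Series K} :
    (Ideal.Quotient.mk _ g : LocalRing f) ∈ nonZeroDivisors (LocalRing f) ↔ ∀ i, ¬ F i ∣ g := by
  have hmk : ∀ a, (Ideal.Quotient.mk _ a : LocalRing f) = 0 ↔ ∀ i, F i ∣ a := fun a => by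
    rw [Ideal.Quotient.eq_zero_iff_mem, Ideal.mem_span_singleton, dvd_iff_forall_dvd hF hne hf]
  rw [mem_nonZeroDivisors_iff_right]
  constructor
  · intro h i hi
    refine not_dvd_prod_erase hF hne i ((hmk _).mp (h _ ?_) i)
    rw [← map_mul, hmk]
    intro j
    rcases eq_or_ne j i with rfl | hj
    · exact hi.mul_left _
    · exact (Finset.dvd_prod_of_mem F (Finset.mem_erase.mpr ⟨hj, Finset.mem_univ j⟩)).mul_right _
  · intro h a ha
    obtain ⟨a, rfl⟩ := Ideal.Quotient.mk_surjective a
    rw [← map_mul, hmk] at ha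
    rw [hmk]
    exact fun i => ((hF i).prime.dvd_or_dvd (ha i)).resolve_right (h i)

theorem prod_erase_dvd_iff {i : ι} {g : Series K} :
    ∏ j ∈ Finset.univ.erase i, F j ∣ g ↔ ∀ j, j ≠ i → F j ∣ g :=
  ⟨fun h j hj => (Finset.dvd_prod_of_mem F (Finset.mem_erase.mpr ⟨hj, Finset.mem_univ j⟩)).trans h,
    fun h => prod_dvd_of_forall_dvd hF hne fun j hj => h j (Finset.ne_of_mem_erase hj)⟩

end Factors

variable {K : Type*} [Field K]

/-- The restriction map from a curve to a curve that it contains. -/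
noncomputable def factorMap {f g : Series K} (h : g ∣ f) : LocalRing f →ₐ[K] LocalRing g :=
  Ideal.Quotient.factorₐ K (Ideal.span_singleton_le_span_singleton.mpr h)

theorem factorMap_surjective {f g : Series K} (h : g ∣ f) : Function.Surjective (factorMap h) :=
  Ideal.Quotient.factor_surjective (Ideal.span_singleton_le_span_singleton.mpr h)

section Normalization

variable {ι : Type*} [Fintype ι] [DecidableEq ι] {F : ι → Series K}
  [hF : ∀ i, Fact (Irreducible (F i))] (hne : Pairwise fun i j => ¬ Associated (F i) (F j))
  {f : Series K} (hf : Associated (∏ i, F i) f)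
include hne hf

theorem isLocalization_pi (h : ∀ i, F i ∣ f) [∀ i, Algebra (LocalRing f) (FractionRing (LocalRing (F i)))]
    (halg : ∀ i g, algebraMap (LocalRing f) (FractionRing (LocalRing (F i))) g =
      algebraMap (LocalRing (F i)) _ (factorMap (h i) g)) :
    IsLocalization (nonZeroDivisors (LocalRing f)) (∀ i, FractionRing (LocalRing (F i))) := by
  have hirr := fun i => (hF i).out
  have hinj : ∀ i g, algebraMap (LocalRing f) (FractionRing (LocalRing (F i)))
      (Ideal.Quotient.mk _ g) = 0 ↔ F i ∣ g := by
    intro i g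
    rw [halg, FaithfulSMul.algebraMap_eq_zero_iff, ← Ideal.mem_span_singleton,
      ← Ideal.Quotient.eq_zero_iff_mem]
    rfl
  have hinj' : Function.Injective
      (algebraMap (LocalRing f) (∀ i, FractionRing (LocalRing (F i)))) := by
    rw [injective_iff_map_eq_zero]
    intro g hg
    obtain ⟨g, rfl⟩ := Ideal.Quotient.mk_surjective g
    rw [Ideal.Quotient.eq_zero_iff_mem, Ideal.mem_span_singleton,
      dvd_iff_forall_dvd hirr hne hf]
    exact fun i => (hinj i g).mp (congrFun hg i)
  rw [isLocalization_iff]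
  refine ⟨fun s => ?_, fun z => ?_, fun {a b} hab => ⟨1, by rw [hinj' hab]⟩⟩
  · rw [Pi.isUnit_iff]
    intro i
    rw [isUnit_iff_ne_zero]
    obtain ⟨s, hs⟩ := s
    obtain ⟨g, rfl⟩ := Ideal.Quotient.mk_surjective s
    exact (hinj i g).not.mpr ((mk_mem_nonZeroDivisors_iff hirr hne hf).mp hs i)
  · choose a s hs has using fun i =>
      IsFractionRing.div_surjective (A := LocalRing (F i)) (z i)
    choose a' ha' using fun i => Ideal.Quotient.mk_surjective (a i)
    choose s' hs' using fun i => Ideal.Quotient.mk_surjective (s i)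
    -- `e i` vanishes on every branch except the `i`-th, so `∑ e j * t j` restricts to `e i * t i`
    -- on it. This gives a tuple of fractions a common numerator and denominator.
    let e : ι → Series K := fun i => ∏ j ∈ Finset.univ.erase i, F j
    have he : ∀ (t : ι → Series K) i, algebraMap (LocalRing f) (FractionRing (LocalRing (F i)))
        (Ideal.Quotient.mk _ (∑ j, e j * t j)) =
        algebraMap (LocalRing f) _ (Ideal.Quotient.mk _ (e i)) *
          algebraMap (LocalRing (F i)) _ (Ideal.Quotient.mk _ (t i)) := by
      intro t i
      rw [map_sum, map_sum, Finset.sum_eq_single i, map_mul, map_mul, halg i (Ideal.Quotient.mk _ (t i))]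
      · rfl
      · intro j _ hj
        rw [hinj]
        exact ((prod_erase_dvd_iff hirr hne).mp dvd_rfl i hj.symm).mul_right _
      · simp
    have hs0 : ∀ i, algebraMap (LocalRing (F i)) (FractionRing (LocalRing (F i))) (s i) ≠ 0 :=
      fun i => IsFractionRing.to_map_ne_zero_of_mem_nonZeroDivisors (hs i)
    have he0 : ∀ i, algebraMap (LocalRing f) (FractionRing (LocalRing (F i)))
        (Ideal.Quotient.mk _ (e i)) ≠ 0 := fun i => (hinj i _).not.mpr (not_dvd_prod_erase hirr hne i)
    refine ⟨⟨Ideal.Quotient.mk _ (∑ j, e j * a' j), Ideal.Quotient.mk _ (∑ j, e j * s' j), ?_⟩, ?_⟩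
    · rw [mk_mem_nonZeroDivisors_iff hirr hne hf]
      intro i
      rw [← hinj, he, hs']
      exact mul_ne_zero (he0 i) (hs0 i)
    · funext i
      change z i * algebraMap (LocalRing f) _ _ = algebraMap (LocalRing f) _ _
      rw [he, he, hs', ha', ← has i]
      field_simp [hs0 i]

omit [DecidableEq ι] hne hf in
-- Monic equations of the components lift to monic polynomials over the curve, and the product of
-- the lifts annihilates the tuple.
theorem isIntegral_pi_iff (h : ∀ i, F i ∣ f)
    [∀ i, Algebra (LocalRing f) (FractionRing (LocalRing (F i)))]
    (halg : ∀ i g, algebraMap (LocalRing f) (FractionRing (LocalRing (F i))) g =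
      algebraMap (LocalRing (F i)) _ (factorMap (h i) g)) (a : ∀ i, FractionRing (LocalRing (F i))) :
    IsIntegral (LocalRing f) a ↔ ∀ i, IsIntegral (LocalRing (F i)) (a i) := by
  have hcomp : ∀ i, algebraMap (LocalRing f) (FractionRing (LocalRing (F i))) =
      (algebraMap (LocalRing (F i)) _).comp (factorMap (h i)).toRingHom :=
    fun i => RingHom.ext (halg i)
  constructor
  · rintro ⟨p, hp, hpa⟩ i
    refine ⟨p.map (factorMap (h i)).toRingHom, hp.map _, ?_⟩
    rw [Polynomial.eval₂_map, ← hcomp]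
    have := congrArg (Pi.evalRingHom _ i) hpa
    rw [Polynomial.hom_eval₂, map_zero] at this
    exact this
  · intro ha
    choose p hp hpa using ha
    have hlift : ∀ i, ∃ q : Polynomial (LocalRing f),
        q.map (factorMap (h i)).toRingHom = p i ∧ q.Monic := fun i => by
      obtain ⟨q, hq, -, hq'⟩ := Polynomial.lifts_and_natDegree_eq_and_monic
        (f := (factorMap (h i)).toRingHom) (p := p i)
        ((Polynomial.mem_lifts _).mpr (Polynomial.map_surjective _ (factorMap_surjective (h i)) _))
        (hp i)
      exact ⟨q, hq, hq'⟩
    choose q hq hqm using hlift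
    refine ⟨∏ i, q i, Polynomial.monic_prod_of_monic _ _ fun i _ => hqm i, ?_⟩
    rw [Polynomial.eval₂_finsetProd]
    funext i
    rw [Finset.prod_apply, Pi.zero_apply, Finset.prod_eq_zero (Finset.mem_univ i)]
    have h1 : Polynomial.eval₂ (algebraMap (LocalRing f) (∀ i, FractionRing (LocalRing (F i)))) a
        (q i) i = Pi.evalRingHom _ i (Polynomial.eval₂ (algebraMap (LocalRing f)
          (∀ i, FractionRing (LocalRing (F i)))) a (q i)) := rfl
    rw [h1, Polynomial.hom_eval₂]
    have h2 := hpa i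
    rw [← hq i, Polynomial.eval₂_map, ← hcomp] at h2
    exact h2

end Normalization

end AlgebroidCurve

/-! ### The conductor of a reduced curve. -/

namespace AlgebroidCurve
open IsLocalRing IsDiscreteValuationRing

theorem length_quotient_span_pow {K V : Type*} [Field K] [CommRing V] [IsDomain V]
    [IsDiscreteValuationRing V] [Algebra K V] [HasResidueField K V] {ϖ : V}
    (hϖ : Irreducible ϖ) (k : ℕ) : Module.length K (V ⧸ Ideal.span {ϖ ^ k}) = k := by
  rw [length_eq_length_of_hasResidueField K (A := V)]
  change Ring.ord _ _ = _
  rw [Ring.ord_eq_addVal, addVal_pow, addVal_uniformizer hϖ]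
  simp

theorem length_quotient_eq_sum {K B ι : Type*} [Field K] [CommRing B] [Algebra K B] [Fintype ι]
    {V : ι → Type*} [∀ i, CommRing (V i)] [∀ i, IsDomain (V i)]
    [∀ i, IsDiscreteValuationRing (V i)] [∀ i, Algebra K (V i)] [∀ i, HasResidueField K (V i)]
    (e : B ≃ₐ[K] ∀ i, V i) (k : ι → ℕ) (I : Ideal B)
    (hI : ∀ t, t ∈ I ↔ ∀ i, (k i : ℕ∞) ≤ addVal (V i) (e t i)) :
    Module.length K (B ⧸ I) = ∑ i, (k i : ℕ∞) := by
  choose ϖ hϖ using fun i => IsDiscreteValuationRing.exists_irreducible (V i)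
  let θ : B →ₗ[K] ∀ i, V i ⧸ Ideal.span {ϖ i ^ k i} :=
    LinearMap.pi fun i => (Ideal.Quotient.mkₐ K (Ideal.span {ϖ i ^ k i})).toLinearMap ∘ₗ
      LinearMap.proj i ∘ₗ e.toLinearMap
  have hθ : Function.Surjective θ := by
    intro z
    choose b hb using fun i => Ideal.Quotient.mk_surjective (z i)
    refine ⟨e.symm b, funext fun i => ?_⟩
    rw [← hb]
    exact congrArg _ (congrFun (e.apply_symm_apply b) i)
  have hker : LinearMap.ker θ = I.restrictScalars K := by
    ext t
    rw [LinearMap.mem_ker, Submodule.restrictScalars_mem, hI, funext_iff]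
    refine forall_congr' fun i => ?_
    have : θ t i = Ideal.Quotient.mk (Ideal.span {ϖ i ^ k i}) (e t i) := rfl
    rw [this, Pi.zero_apply, Ideal.Quotient.eq_zero_iff_mem, Ideal.mem_span_singleton,
      ← addVal_le_iff_dvd, addVal_pow, addVal_uniformizer (hϖ i)]
    simp
  rw [← (Submodule.Quotient.restrictScalarsEquiv K I).length_eq, ← hker,
    (θ.quotKerEquivOfSurjective hθ).length_eq, Module.length_pi_of_fintype]
  exact Finset.sum_congr rfl fun i _ => length_quotient_span_pow (hϖ i) _

section Normalization

variable {K : Type*} [Field K] {ι : Type*} [Fintype ι] [DecidableEq ι] {F : ι → Series K}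
  [hF : ∀ i, Fact (Irreducible (F i))] (hne : Pairwise fun i j => ¬ Associated (F i) (F j))
  {f : Series K} (hf : Associated (∏ i, F i) f)
include hne hf

/-- The normalization of a reduced curve is the product of the normalizations of its branches. -/
theorem exists_normalization_algEquiv :
    ∃ e : Normalization f ≃ₐ[K] (∀ i, Normalization (F i)), ∀ (g : Series K) i,
      e (algebraMap (LocalRing f) _ (Ideal.Quotient.mk _ g)) i = toNormalization (F i) g := by
  have h : ∀ i, F i ∣ f := fun i =>
    (Finset.dvd_prod_of_mem F (Finset.mem_univ i)).trans hf.dvd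
  let _ : ∀ i, Algebra (LocalRing f) (FractionRing (LocalRing (F i))) := fun i =>
    ((algebraMap (LocalRing (F i)) (FractionRing (LocalRing (F i)))).comp
      (factorMap (h i)).toRingHom).toAlgebra
  have halg : ∀ i g, algebraMap (LocalRing f) (FractionRing (LocalRing (F i))) g =
      algebraMap (LocalRing (F i)) _ (factorMap (h i) g) := fun _ _ => rfl
  have hloc := isLocalization_pi hne hf h halg
  let E := IsLocalization.algEquiv (nonZeroDivisors (LocalRing f))
    (FractionRing (LocalRing f)) (∀ i, FractionRing (LocalRing (F i)))
  have hE : ∀ a, IsIntegral (LocalRing f) a ↔ ∀ i, IsIntegral (LocalRing (F i)) (E a i) := fun a => by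
    rw [← isIntegral_pi_iff h halg, isIntegral_algEquiv]
  let σ : Normalization f →+* ∀ i, Normalization (F i) := RingHom.pi fun i =>
    RingHom.codRestrict (((Pi.evalRingHom _ i).comp E.toRingHom).comp
      (algebraMap (Normalization f) (FractionRing (LocalRing f))))
      (integralClosure (LocalRing (F i)) (FractionRing (LocalRing (F i))))
      fun b => (hE b).mp b.2 i
  have hσ : ∀ b i, (σ b i : FractionRing (LocalRing (F i))) = E b i := fun _ _ => rfl
  have hσ' : ∀ (g : Series K) i,
      σ (algebraMap (LocalRing f) _ (Ideal.Quotient.mk _ g)) i = toNormalization (F i) g := by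
    intro g i
    refine Subtype.ext ((hσ _ i).trans ?_)
    exact congrFun (E.commutes (Ideal.Quotient.mk _ g)) i
  let σ' : Normalization f →ₐ[K] ∀ i, Normalization (F i) :=
    { σ with
      commutes' := fun c => by
        funext i
        refine (hσ' (algebraMap K _ c) i).trans ?_
        exact AlgHom.commutes _ c }
  have hbij : Function.Bijective σ' := by
    constructor
    · intro a b hab
      refine Subtype.ext (E.injective (funext fun i => ?_))
      rw [← hσ, ← hσ]
      exact congrArg Subtype.val (congrFun hab i)
    · intro t
      refine ⟨⟨E.symm fun i => t i, (hE _).mpr fun i => ?_⟩, funext fun i => Subtype.ext ?_⟩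
      · rw [E.apply_symm_apply]; exact (t i).2
      · refine (hσ _ i).trans ?_
        exact congrFun (E.apply_symm_apply _) i
  exact ⟨AlgEquiv.ofBijective σ' hbij, hσ'⟩

omit hf in
-- A series vanishing on all branches but the `i`-th is a multiple of the cofactor `∏_{j ≠ i} F j`.
-- Dividing by it turns the conductor of the curve, on the `i`-th component, into the conductor of
-- that branch shifted by the value of the cofactor.
theorem mem_conductorIdeal_iff [IsAlgClosed K]
    {e : Normalization f ≃ₐ[K] (∀ i, Normalization (F i))}
    (he : ∀ (g : Series K) i,
      e (algebraMap (LocalRing f) _ (Ideal.Quotient.mk _ g)) i = toNormalization (F i) g)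
    (t : Normalization f) : t ∈ conductorIdeal f ↔
      ∀ i, condExp (F i) + interNum (F i) (∏ j ∈ Finset.univ.erase i, F j) ≤ addVal _ (e t i) := by
  have hirr := fun i => (hF i).out
  have hrange : ∀ b : Normalization f, b ∈ (algebraMap (LocalRing f) (Normalization f)).range ↔
      ∃ g : Series K, ∀ i, e b i = toNormalization (F i) g := by
    intro b
    constructor
    · rintro ⟨a, rfl⟩
      obtain ⟨g, rfl⟩ := Ideal.Quotient.mk_surjective a
      exact ⟨g, he g⟩
    · rintro ⟨g, hg⟩
      exact ⟨Ideal.Quotient.mk _ g, e.injective (funext fun i => by rw [he, hg])⟩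
  have hcof : ∀ i, toNormalization (F i) (∏ j ∈ Finset.univ.erase i, F j) ≠ 0 := fun i => by
    rw [Ne, toNormalization_eq_zero_iff]
    exact not_dvd_prod_erase hirr hne i
  change (∀ b, t * b ∈ _) ↔ _
  simp only [hrange, map_mul, Pi.mul_apply, interNum_eq_addVal]
  constructor
  · intro ht i
    have h1 : ∀ b : Normalization (F i), ∃ g,
        e t i * b = toNormalization (F i) (∏ j ∈ Finset.univ.erase i, F j) * toNormalization (F i) g := by
      intro b
      -- Testing against elements supported on one branch isolates the `i`-th component.
      obtain ⟨g, hg⟩ := ht (e.symm (Pi.single i b))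
      rw [e.apply_symm_apply] at hg
      obtain ⟨k, rfl⟩ : ∏ j ∈ Finset.univ.erase i, F j ∣ g := by
        rw [prod_erase_dvd_iff hirr hne]
        intro j hj
        rw [← toNormalization_eq_zero_iff, ← hg, Pi.single_eq_of_ne hj, mul_zero]
      exact ⟨k, by rw [← map_mul, ← hg, Pi.single_eq_same]⟩
    obtain ⟨t', ht'⟩ := h1 1
    rw [mul_one] at ht'
    rw [ht', addVal_mul, add_comm]
    refine add_le_add le_rfl ?_
    by_cases htop : addVal _ (toNormalization (F i) t') = ⊤
    · rw [htop]; exact le_top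
    obtain ⟨c, hc⟩ := ENat.ne_top_iff_exists.mp htop
    rw [← hc]
    refine Nat.cast_le.mpr (condExp_le_of_forall_mem_range fun b hb => ?_)
    rw [hc, addVal_le_iff_dvd] at hb
    obtain ⟨b, rfl⟩ := hb
    obtain ⟨g, hg⟩ := h1 b
    rw [ht', mul_assoc] at hg
    exact ⟨g, (mul_left_cancel₀ (hcof i) hg).symm⟩
  · intro ht b
    have h1 : ∀ i, ∃ g, e t i * e b i =
        toNormalization (F i) (∏ j ∈ Finset.univ.erase i, F j) * toNormalization (F i) g := by
      intro i
      have h2 : addVal _ (toNormalization (F i) (∏ j ∈ Finset.univ.erase i, F j)) ≤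
          addVal _ (e t i) := le_add_self.trans (ht i)
      obtain ⟨u, hu⟩ := addVal_le_iff_dvd.mp h2
      have h3 := ht i
      rw [hu, addVal_mul, add_comm] at h3
      have h4 : condExp (F i) ≤ addVal _ u :=
        (ENat.add_le_add_iff_left (by rw [Ne, addVal_eq_top_iff]; exact hcof i)).mp h3
      obtain ⟨g, hg⟩ := mem_range_of_condExp_le (f := F i) (b := u * e b i) (by
        rw [addVal_mul]; exact h4.trans le_self_add)
      exact ⟨g, by rw [hu, hg, mul_assoc]⟩
    choose g hg using h1
    -- The local solutions glue: on branch `i` every summand with `j ≠ i` vanishes.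
    refine ⟨∑ j, (∏ k ∈ Finset.univ.erase j, F k) * g j, fun i => ?_⟩
    rw [hg, ← map_mul, map_sum, Finset.sum_eq_single i]
    · intro j _ hj
      rw [toNormalization_eq_zero_iff]
      exact ((prod_erase_dvd_iff hirr hne).mp dvd_rfl i hj.symm).mul_right _
    · simp

theorem conductorDegree_eq [IsAlgClosed K] :
    conductorDegree f =
      ∑ i, (condExp (F i) + interNum (F i) (∏ j ∈ Finset.univ.erase i, F j)) := by
  obtain ⟨e, he⟩ := exists_normalization_algEquiv hne hf
  have hnat : ∀ i, ∃ k : ℕ, (k : ℕ∞) =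
      condExp (F i) + interNum (F i) (∏ j ∈ Finset.univ.erase i, F j) := fun i => by
    refine ENat.ne_top_iff_exists.mp ?_
    rw [Ne, ENat.add_eq_top, not_or]
    exact ⟨ENat.natCast_ne_top _, by
      rw [interNum_eq_top_iff]; exact not_dvd_prod_erase (fun i => (hF i).out) hne i⟩
  choose k hk using hnat
  have hlen : conductorDegree f = Module.length K (Normalization f ⧸ conductorIdeal f) :=
    (Module.length_eq_rank _ _).symm
  rw [hlen, length_quotient_eq_sum e k (conductorIdeal f) fun t => by
    simp only [hk]; exact mem_conductorIdeal_iff hne he t]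
  exact Finset.sum_congr rfl fun i _ => hk i

end Normalization

end AlgebroidCurve

/-! ### Decomposition of a reduced curve into branches. -/

namespace AlgebroidCurve
open IsLocalRing

variable {K : Type*} [Field K]

/-- The family `F` consists of the equations of the branches of the reduced curve `{f = 0}`. -/
structure IsFactorization {ι : Type*} [Fintype ι] (F : ι → Series K) (f : Series K) : Prop where
  irreducible : ∀ i, Irreducible (F i)
  not_associated : Pairwise fun i j => ¬ Associated (F i) (F j)
  associated : Associated (∏ i, F i) f

theorem isBranch_iff_irreducible {g : Series K} : IsBranch g ↔ Irreducible g :=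
  ⟨fun h => h.2, fun h => ⟨⟨h.ne_zero, mem_maximalIdeal_series.mp h.not_isUnit⟩, h⟩⟩

theorem exists_isFactorization {f : Series K} (hf : IsReducedCurve f) :
    ∃ (r : ℕ) (F : Fin r → Series K), IsFactorization F f := by
  obtain ⟨s, hs, hsf⟩ := WfDvdMonoid.exists_factors f hf.1.1
  obtain ⟨l, rfl⟩ : ∃ l : List (Series K), ↑l = s := ⟨s.toList, s.coe_toList⟩
  have hprod : ∏ i, l.get i = Multiset.prod (↑l) := by
    rw [Multiset.prod_coe, ← List.prod_ofFn, List.ofFn_get]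
  have hirr : ∀ i, Irreducible (l.get i) := fun i => hs _ (l.get_mem i)
  refine ⟨l.length, l.get, hirr, fun i j hij hass => ?_, by rw [hprod]; exact hsf⟩
  have h1 : l.get i * l.get j ∣ f := by
    rw [← hsf.dvd_iff_dvd_right, ← hprod, ← Finset.prod_pair hij]
    exact Finset.prod_dvd_prod_of_subset _ _ _ (Finset.subset_univ _)
  exact (hirr i).not_isUnit (hf.2 _ ((mul_dvd_mul_left _ hass.dvd).trans h1))

theorem IsSmoothBranch.irreducible {w : Series K} (hw : IsSmoothBranch w) : Irreducible w := hw.1.2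

theorem IsSmoothBranch.mem_maximalIdeal {w : Series K} (hw : IsSmoothBranch w) :
    w ∈ maximalIdeal (Series K) := hw.1.2.not_isUnit

theorem isSmoothBranch_X : IsSmoothBranch (MvPowerSeries.X 0 : Series K) := by
  refine ⟨isBranch_iff_irreducible.mpr (prime_X 0).irreducible, ?_⟩
  rw [mult, MvPowerSeries.X, MvPowerSeries.order_monomial_of_ne_zero one_ne_zero]
  simp

theorem mult_mul {f g : Series K} (hf : f ≠ 0) (hg : g ≠ 0) : mult (f * g) = mult f + mult g := by
  have := MvPowerSeries.order_mul (f := f) (g := g)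
  rw [order_eq_mult hf, order_eq_mult hg, order_eq_mult (mul_ne_zero hf hg)] at this
  exact_mod_cast this

theorem mult_of_isUnit {u : Series K} (hu : IsUnit u) : mult u = 0 := by
  have h : ¬ ((1 : ℕ) : ℕ∞) ≤ u.order := by
    rw [← mem_maximalIdeal_pow_iff, pow_one]
    exact fun h => h hu
  rw [order_eq_mult hu.ne_zero] at h
  have : ¬ 1 ≤ mult u := by exact_mod_cast h
  omega

theorem mult_pos {f : Series K} (hf : Irreducible f) : 0 < mult f := by
  have h : ((1 : ℕ) : ℕ∞) ≤ f.order := by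
    rw [← mem_maximalIdeal_pow_iff, pow_one]
    exact hf.not_isUnit
  rw [order_eq_mult hf.ne_zero] at h
  exact_mod_cast h

theorem mult_congr {f g : Series K} (h : Associated f g) : mult f = mult g := by
  by_cases hf : f = 0
  · subst hf
    rw [(associated_zero_iff_eq_zero g).mp h.symm]
  obtain ⟨u, rfl⟩ := h
  rw [mult_mul hf u.ne_zero, mult_of_isUnit u.isUnit, add_zero]

theorem mult_prod {ι : Type*} (s : Finset ι) {F : ι → Series K} (hF : ∀ i, F i ≠ 0) :
    mult (∏ i ∈ s, F i) = ∑ i ∈ s, mult (F i) := by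
  classical
  induction s using Finset.induction_on with
  | empty => exact mult_of_isUnit isUnit_one
  | insert a s ha ih =>
    rw [Finset.prod_insert ha, Finset.sum_insert ha,
      mult_mul (hF a) (Finset.prod_ne_zero_iff.mpr fun i _ => hF i), ih]

theorem semigroup_congr {f g : Series K} (h : Associated f g) : semigroup f = semigroup g := by
  ext n
  refine exists_congr fun a => ?_
  rw [h.dvd_iff_dvd_left, interNum_congr h (Associated.refl a)]

theorem branchContact_congr {f f' g g' : Series K} (h : Associated f f') (h' : Associated g g') :
    branchContact f g = branchContact f' g' := by
  rw [branchContact, branchContact, interNum_congr h h', mult_congr h, mult_congr h']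

theorem isFactorization_unit {g : Series K} (hg : Irreducible g) :
    IsFactorization (fun _ : Unit => g) g where
  irreducible _ := hg
  not_associated i j h := absurd (Subsingleton.elim i j) h
  associated := by simp

namespace IsFactorization

variable {ι : Type*} [Fintype ι] {F : ι → Series K} {f : Series K} (h : IsFactorization F f)
include h

theorem ne_zero : f ≠ 0 :=
  h.associated.ne_zero_iff.mp (Finset.prod_ne_zero_iff.mpr fun i _ => (h.irreducible i).ne_zero)

theorem dvd (i : ι) : F i ∣ f := (Finset.dvd_prod_of_mem F (Finset.mem_univ i)).trans h.associated.dvd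

theorem isBranchOf_iff {g : Series K} : IsBranchOf g f ↔ ∃ i, Associated g (F i) := by
  rw [IsBranchOf, isBranch_iff_irreducible]
  constructor
  · rintro ⟨hg, hd⟩
    rw [← h.associated.dvd_iff_dvd_right, hg.prime.dvd_finsetProd_iff] at hd
    obtain ⟨i, -, hi⟩ := hd
    exact ⟨i, hg.associated_of_dvd (h.irreducible i) hi⟩
  · rintro ⟨i, hi⟩
    exact ⟨hi.irreducible_iff.mpr (h.irreducible i), hi.dvd.trans (h.dvd i)⟩

theorem isBranchOf (i : ι) : IsBranchOf (F i) f := h.isBranchOf_iff.mpr ⟨i, Associated.refl _⟩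

theorem numBranches_eq : numBranches f = Fintype.card ι := by
  have : {P : Ideal (Series K) | ∃ g, IsBranchOf g f ∧ P = Ideal.span {g}} =
      Set.range fun i => Ideal.span {F i} := by
    ext P
    constructor
    · rintro ⟨g, hg, rfl⟩
      obtain ⟨i, hi⟩ := h.isBranchOf_iff.mp hg
      exact ⟨i, (Ideal.span_singleton_eq_span_singleton.mpr hi).symm⟩
    · rintro ⟨i, rfl⟩
      exact ⟨F i, h.isBranchOf i, rfl⟩
  rw [numBranches, this, ← Set.image_univ, Set.ncard_image_of_injective, Set.ncard_univ,
    Nat.card_eq_fintype_card]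
  intro i j hij
  by_contra hne
  exact h.not_associated hne (Ideal.span_singleton_eq_span_singleton.mp hij)

theorem mult_eq : mult f = ∑ i, mult (F i) := by
  rw [← mult_congr h.associated, mult_prod _ fun i => (h.irreducible i).ne_zero]

theorem contact_eq {w : Series K} (hw : IsSmoothBranch w) :
    contact f w = ⨅ i, (interNum (F i) w : ℝ≥0∞) / mult (F i) := by
  have hbc : ∀ i, branchContact (F i) w = (interNum (F i) w : ℝ≥0∞) / mult (F i) := fun i => by
    rw [branchContact, hw.2, Nat.cast_one, mul_one]
  have hself : IsBranchOf w w := ⟨hw.1, dvd_rfl⟩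
  apply le_antisymm
  · refine le_iInf fun i => ?_
    rw [← hbc]
    refine iInf₂_le_of_le (F i) (h.isBranchOf i) ?_
    exact iInf₂_le (f := fun q (_ : IsBranchOf q w) => branchContact (F i) q) w hself
  · refine le_iInf₂ fun p hp => le_iInf₂ fun q hq => ?_
    obtain ⟨i, hi⟩ := h.isBranchOf_iff.mp hp
    have hqw : Associated q w := hq.1.2.associated_of_dvd hw.irreducible hq.2
    rw [branchContact_congr hi hqw, hbc]
    exact iInf_le _ i

theorem conductorDegree_eq [IsAlgClosed K] [DecidableEq ι] : conductorDegree f =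
    ∑ i, ((condExp (F i) : ℕ∞) + ∑ j ∈ Finset.univ.erase i, interNum (F i) (F j)) := by
  have : ∀ i, Fact (Irreducible (F i)) := fun i => ⟨h.irreducible i⟩
  rw [AlgebroidCurve.conductorDegree_eq h.not_associated h.associated]
  refine Finset.sum_congr rfl fun i _ => congrArg _ ?_
  generalize Finset.univ.erase i = s
  induction s using Finset.induction_on with
  | empty => exact interNum_eq_zero_of_isUnit isUnit_one
  | insert a s ha ih => rw [Finset.prod_insert ha, Finset.sum_insert ha, interNum_mul, ih]

theorem interNum_ne_top [IsAlgClosed K] {i j : ι} (hij : i ≠ j) : interNum (F i) (F j) ≠ ⊤ := by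
  have : Fact (Irreducible (F i)) := ⟨h.irreducible i⟩
  rw [Ne, interNum_eq_top_iff]
  exact fun hd => h.not_associated hij ((h.irreducible i).associated_of_dvd (h.irreducible j) hd)

theorem exists_transversal [IsAlgClosed K] {w : Series K} (hw : IsSmoothBranch w) :
    ∃ x, Ideal.span {x, w} = maximalIdeal (Series K) ∧ ∀ i, interNum (F i) x = mult (F i) := by
  obtain ⟨x, hx, hxf⟩ := AlgebroidCurve.exists_transversal h.ne_zero hw.2
  refine ⟨x, hx, fun i => ?_⟩
  rw [interNum_comm]
  exact interNum_eq_mult_of_dvd (prime_of_span_pair hx).irreducible h.ne_zero (h.dvd i) hxf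

end IsFactorization

end AlgebroidCurve

/-! ### Inequalities for branches with prescribed contact with a smooth branch. -/

namespace AlgebroidCurve
open IsLocalRing

/-- An intersection number with `W` is infinite when `W` is the branch itself; a finite lower bound
that is still large enough replaces it. -/
theorem exists_natCast_le_of_le_mul {a q : ℕ} {v : ℕ∞} (hq : 0 < q) (h : (a : ℕ∞) ≤ q * v) :
    ∃ N : ℕ, (N : ℕ∞) ≤ v ∧ a ≤ q * N := by
  cases v using ENat.recTopCoe with
  | top => exact ⟨a, le_top, Nat.le_mul_of_pos_left a hq⟩
  | coe v => exact ⟨v, le_rfl, by exact_mod_cast h⟩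

variable {K : Type*} [Field K] [IsAlgClosed K] {f g w : Series K} {p q : ℕ}

theorem exists_transversal_branch (hf : Irreducible f) (hw : IsSmoothBranch w) :
    ∃ x, Ideal.span {x, w} = maximalIdeal (Series K) ∧ interNum f x = mult f := by
  obtain ⟨x, hx, h⟩ := exists_transversal hf.ne_zero hw.2
  exact ⟨x, hx, by rw [interNum_comm, h]⟩

theorem mult_le_of_mem_semigroup (hf : Irreducible f) {n : ℕ} (hn : n ≠ 0)
    (h : n ∈ semigroup f) : mult f ≤ n := by
  have : Fact (Irreducible f) := ⟨hf⟩
  obtain ⟨g, -, hg⟩ := h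
  have hgm : g ∈ maximalIdeal (Series K) := fun hu => by
    rw [interNum_eq_zero_of_isUnit hu] at hg
    exact hn (by exact_mod_cast hg.symm)
  have := mult_le_interNum hf hgm
  rw [hg] at this
  exact_mod_cast this

theorem condExp_eq_zero_of_mult_eq_one (hf : Irreducible f) (h : mult f = 1) : condExp f = 0 := by
  have : Fact (Irreducible f) := ⟨hf⟩
  obtain ⟨x, -, hx⟩ := exists_transversal_branch hf isSmoothBranch_X
  refine Nat.le_zero.mp (condExp_le fun j _ => mem_semigroup_of_interNum (g := x ^ j) ?_)
  rw [interNum_pow, hx, h]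
  simp

theorem mult_sub_one_mul_le_condExp (hf : Irreducible f) (hw : IsSmoothBranch w) {N : ℕ}
    (hN : N ≤ interNum f w) : (mult f - 1) * (N - 1) ≤ condExp f := by
  have : Fact (Irreducible f) := ⟨hf⟩
  obtain ⟨x, hxw, hx⟩ := exists_transversal_branch hf hw
  exact mul_le_condExp hxw hx hN

/-- This is `q` times `(m - 1)(N - 1) ≤ c` with `q N ≥ p m`. It is stated over `ℤ` so that no
subtraction truncates when the defects are summed. -/
theorem mul_sub_le_mul_condExp (hf : Irreducible f) (hw : IsSmoothBranch w) (hq : 0 < q)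
    (h : ((p * mult f : ℕ) : ℕ∞) ≤ q * interNum f w) :
    ((mult f : ℤ) - 1) * (p * mult f - q) ≤ q * condExp f := by
  obtain ⟨N, hN, hpN⟩ := exists_natCast_le_of_le_mul hq h
  have h1 := mult_sub_one_mul_le_condExp hf hw hN
  obtain ⟨m, hm⟩ := Nat.exists_eq_add_of_lt (mult_pos hf)
  rw [zero_add] at hm
  rw [hm] at h1 hpN ⊢
  rw [Nat.add_sub_cancel] at h1
  have h2 : (m : ℤ) * (N - 1) ≤ condExp f := by
    rcases N with _ | N
    · push_cast
      have : (0 : ℤ) ≤ m := by positivity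
      have : (0 : ℤ) ≤ condExp f := by positivity
      linarith
    · rw [Nat.add_sub_cancel] at h1
      push_cast
      rw [add_sub_cancel_right]
      exact_mod_cast h1
  have h3 : (p : ℤ) * (m + 1) ≤ q * N := by exact_mod_cast hpN
  push_cast
  rw [add_sub_cancel_right]
  have hm0 : (0 : ℤ) ≤ m := by positivity
  have hq0 : (0 : ℤ) ≤ q := by positivity
  calc (m : ℤ) * (p * (m + 1) - q) ≤ m * (q * N - q) := by gcongr
    _ = q * (m * (N - 1)) := by ring
    _ ≤ q * condExp f := by gcongr

/-- Equality forces `q N = p m` and `c = (m - 1)(N - 1)`, and the latter makes `m` and `N` coprime.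
Then `N/m` and `p/q` are the same reduced fraction. -/
theorem mult_eq_of_mul_condExp_eq (hf : Irreducible f) (hw : IsSmoothBranch w) (hq : 0 < q)
    (hp : 0 < p) (hpq : Nat.Coprime p q) (h : ((p * mult f : ℕ) : ℕ∞) ≤ q * interNum f w)
    (hm : mult f ≠ 1) (hc : ((mult f : ℤ) - 1) * (p * mult f - q) = q * condExp f) :
    mult f = q ∧ semigroup f = (AddSubmonoid.closure {q, p} : AddSubmonoid ℕ) := by
  have : Fact (Irreducible f) := ⟨hf⟩
  obtain ⟨x, hxw, hx⟩ := exists_transversal_branch hf hw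
  obtain ⟨N, hN, hpN⟩ := exists_natCast_le_of_le_mul hq h
  have h1 := mult_sub_one_mul_le_condExp hf hw hN
  have hm2 : 2 ≤ mult f := by have := mult_pos hf; omega
  have hN1 : 1 ≤ N := by
    by_contra hN0
    have : N = 0 := by omega
    subst this
    have : 0 < p * mult f := by positivity
    omega
  generalize mult f = n at *
  have h2 : ((n : ℤ) - 1) * (N - 1) ≤ condExp f := by
    have : (((n - 1) * (N - 1) : ℕ) : ℤ) ≤ condExp f := by exact_mod_cast h1
    rwa [Nat.cast_mul, Nat.cast_pred (by omega), Nat.cast_pred (by omega)] at this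
  have hn1 : (0 : ℤ) < (n : ℤ) - 1 := by omega
  have hpN' : (p : ℤ) * n ≤ q * N := by exact_mod_cast hpN
  have hq' : (0 : ℤ) < q := by exact_mod_cast hq
  have heq : (p : ℤ) * n = q * N := by
    refine le_antisymm hpN' ?_
    have h3 : ((n : ℤ) - 1) * (q * N - q) ≤ (n - 1) * (p * n - q) := by
      rw [hc]
      calc ((n : ℤ) - 1) * (q * N - q) = q * ((n - 1) * (N - 1)) := by ring
        _ ≤ _ := by gcongr
    have := le_of_mul_le_mul_left h3 hn1
    linarith
  have heq' : p * n = q * N := by exact_mod_cast heq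
  have hc' : condExp f = (n - 1) * (N - 1) := by
    zify
    rw [Nat.cast_pred (by omega), Nat.cast_pred (by omega)]
    rw [heq] at hc
    refine (mul_left_cancel₀ hq'.ne' ?_ : (condExp f : ℤ) = _)
    linarith
  have hcop := coprime_of_condExp_eq hxw hx hN hm2 hN1 hc'
  have hqn : q ∣ n := hpq.symm.dvd_of_dvd_mul_left ⟨N, heq'⟩
  have hnq : n ∣ q := hcop.dvd_of_dvd_mul_right ⟨p, by rw [← heq', mul_comm]⟩
  have hnq' : n = q := Nat.dvd_antisymm hnq hqn
  subst hnq'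
  have hNp : N = p := by
    rw [mul_comm] at heq'
    exact (Nat.eq_of_mul_eq_mul_left hq heq').symm
  subst hNp
  exact ⟨rfl, semigroup_eq_of_condExp_eq hxw hx hN hm2 hN1 hc'⟩

/-- A value of `p + 1` or more would give conductor at least `(q - 1) p`, above `(q - 1)(p - 1)`. -/
theorem interNum_le_of_semigroup_eq (hf : Irreducible f) (hw : IsSmoothBranch w)
    (hs : semigroup f = (AddSubmonoid.closure {q, p} : AddSubmonoid ℕ)) (hm : mult f = q)
    (hq : 2 ≤ q) (hp : 0 < p) : interNum f w ≤ p := by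
  have : Fact (Irreducible f) := ⟨hf⟩
  by_contra! hlt
  have h1 := mult_sub_one_mul_le_condExp hf hw (N := p + 1)
    (by push_cast; exact Order.add_one_le_of_lt hlt)
  rw [condExp_eq_of_semigroup_eq hs, hm, Nat.add_sub_cancel] at h1
  have := Nat.le_of_mul_le_mul_left h1 (by omega)
  omega

/-- One line transversal to `f`, `g` and `w` serves both branches in the Newton polygon bound. -/
theorem mul_mul_le_mul_interNum (hfg : Irreducible f) (hg : Irreducible g) (hw : IsSmoothBranch w)
    (hq : 0 < q) (hf' : ((p * mult f : ℕ) : ℕ∞) ≤ q * interNum f w)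
    (hg' : ((p * mult g : ℕ) : ℕ∞) ≤ q * interNum g w) :
    ((p * mult f * mult g : ℕ) : ℕ∞) ≤ q * interNum f g := by
  have : Fact (Irreducible f) := ⟨hfg⟩
  have : Fact (Irreducible g) := ⟨hg⟩
  obtain ⟨x, hxw, hx⟩ := exists_transversal (mul_ne_zero hfg.ne_zero hg.ne_zero) hw.2
  have hxirr := (prime_of_span_pair hxw).irreducible
  have h1 := interNum_eq_mult_of_dvd hxirr (mul_ne_zero hfg.ne_zero hg.ne_zero) (dvd_mul_right _ _) hx
  have h2 := interNum_eq_mult_of_dvd hxirr (mul_ne_zero hfg.ne_zero hg.ne_zero) (dvd_mul_left _ _) hx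
  rw [interNum_comm] at h1 h2
  obtain ⟨N, hN, hpN⟩ := exists_natCast_le_of_le_mul hq hf'
  obtain ⟨N', hN', hpN'⟩ := exists_natCast_le_of_le_mul hq hg'
  have h3 := min_mul_le_interNum hxw h1 hN h2.ge hN'
  refine le_trans ?_ (mul_le_mul_right h3 (q : ℕ∞))
  have h4 : p * mult f * mult g ≤ q * min (N * mult g) (N' * mult f) := by
    rcases min_choice (N * mult g) (N' * mult f) with h | h <;> rw [h]
    · rw [← mul_assoc]; gcongr
    · rw [← mul_assoc, mul_right_comm]; gcongr
  exact_mod_cast h4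

end AlgebroidCurve

/-! ### The contact exponent is rational and attained. -/

namespace AlgebroidCurve
open IsLocalRing

theorem div_le_natCast_div_iff {x : ℝ≥0∞} {m p q : ℕ} (hm : 0 < m) (hq : 0 < q) :
    x / m ≤ (p : ℝ≥0∞) / q ↔ q * x ≤ p * m := by
  have hm0 : (m : ℝ≥0∞) ≠ 0 := by exact_mod_cast hm.ne'
  have hq0 : (q : ℝ≥0∞) ≠ 0 := by exact_mod_cast hq.ne'
  rw [ENNReal.div_le_iff hm0 (ENNReal.natCast_ne_top m), ← ENNReal.mul_div_right_comm,
    ENNReal.le_div_iff_mul_le (Or.inl hq0) (Or.inl (ENNReal.natCast_ne_top q)), mul_comm x]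

theorem natCast_div_le_div_iff {x : ℝ≥0∞} {m p q : ℕ} (hm : 0 < m) (hq : 0 < q) :
    (p : ℝ≥0∞) / q ≤ x / m ↔ (p * m : ℝ≥0∞) ≤ q * x := by
  have hm0 : (m : ℝ≥0∞) ≠ 0 := by exact_mod_cast hm.ne'
  have hq0 : (q : ℝ≥0∞) ≠ 0 := by exact_mod_cast hq.ne'
  rw [ENNReal.div_le_iff hq0 (ENNReal.natCast_ne_top q), ← ENNReal.mul_div_right_comm,
    ENNReal.le_div_iff_mul_le (Or.inl hm0) (Or.inl (ENNReal.natCast_ne_top m)), mul_comm x]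

theorem natCast_mul_le_natCast_mul_iff {g a b : ℕ} {v : ℕ∞} (hg : 0 < g) (hb : 0 < b) :
    ((g * a : ℕ) : ℕ∞) ≤ (g * b : ℕ) * v ↔ (a : ℕ∞) ≤ b * v := by
  cases v using ENat.recTopCoe with
  | top =>
    rw [ENat.mul_top (by exact_mod_cast (mul_pos hg hb).ne'),
      ENat.mul_top (by exact_mod_cast hb.ne')]
    simp
  | coe v =>
    norm_cast
    rw [mul_assoc]
    exact Nat.mul_le_mul_left_iff hg

theorem natCast_mul_le_natCast_iff {g a b : ℕ} {v : ℕ∞} (hg : 0 < g) (hb : 0 < b) :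
    ((g * b : ℕ) : ℕ∞) * v ≤ (g * a : ℕ) ↔ (b : ℕ∞) * v ≤ a := by
  cases v using ENat.recTopCoe with
  | top =>
    rw [ENat.mul_top (by exact_mod_cast (mul_pos hg hb).ne'),
      ENat.mul_top (by exact_mod_cast hb.ne'),
      top_le_iff, top_le_iff]
    exact iff_of_false (ENat.natCast_ne_top _) (ENat.natCast_ne_top _)
  | coe v =>
    norm_cast
    rw [mul_assoc]
    exact Nat.mul_le_mul_left_iff hg

variable {K : Type*} [Field K]

namespace IsFactorization

variable {ι : Type*} [Fintype ι] {F : ι → Series K} {f : Series K} (h : IsFactorization F f)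
  {p q : ℕ}
include h

theorem contactExponent_eq (hq : 0 < q)
    (hlow : ∃ w, IsSmoothBranch w ∧ ∀ i, ((p * mult (F i) : ℕ) : ℕ∞) ≤ q * interNum (F i) w)
    (hup : ∀ w, IsSmoothBranch w → ∃ i, q * interNum (F i) w ≤ (p * mult (F i) : ℕ)) :
    contactExponent f = (p : ℝ≥0∞) / q := by
  apply le_antisymm
  · refine iSup₂_le fun w hw => ?_
    rw [h.contact_eq hw]
    obtain ⟨i, hi⟩ := hup w hw
    refine (iInf_le _ i).trans ?_
    rw [div_le_natCast_div_iff (mult_pos (h.irreducible i)) hq]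
    exact_mod_cast ENat.toENNReal_le.mpr hi
  · obtain ⟨w, hw, hi⟩ := hlow
    refine le_trans ?_ (le_iSup₂_of_le w hw le_rfl)
    rw [h.contact_eq hw]
    refine le_iInf fun i => ?_
    rw [natCast_div_le_div_iff (mult_pos (h.irreducible i)) hq]
    exact_mod_cast ENat.toENNReal_le.mpr (hi i)

/-- All finite ratios `(F i, w)₀ / m(F i)` have the common denominator `M`, so the supremum becomes
the maximum of a bounded set of integers. -/
theorem exists_contactExponent_eq [IsAlgClosed K] (hm : 2 ≤ mult f) :
    ∃ p q : ℕ, 0 < p ∧ 0 < q ∧ Nat.Coprime p q ∧ contactExponent f = (p : ℝ≥0∞) / q ∧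
      ∃ w, IsSmoothBranch w ∧ ∀ i, ((p * mult (F i) : ℕ) : ℕ∞) ≤ q * interNum (F i) w := by
  classical
  set M := ∏ i, mult (F i) with hM
  have hmi : ∀ i, 0 < mult (F i) := fun i => mult_pos (h.irreducible i)
  have hM0 : 0 < M := Finset.prod_pos fun i _ => hmi i
  let S : Set ℕ := {n | ∃ w, IsSmoothBranch w ∧
    ∀ i, ((n * mult (F i) : ℕ) : ℕ∞) ≤ M * interNum (F i) w}
  have hMS : M ∈ S := ⟨_, isSmoothBranch_X, fun i => by
    push_cast
    gcongr
    exact mult_le_interNum (h.irreducible i) isSmoothBranch_X.mem_maximalIdeal⟩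
  -- A singular branch bounds the contact through its conductor. If all branches are smooth there
  -- are at least two, and their intersection number bounds it.
  have hbdd : BddAbove S := by
    by_cases hex : ∃ i, 2 ≤ mult (F i)
    · obtain ⟨i, hi⟩ := hex
      refine ⟨M * (condExp (F i) + 1), ?_⟩
      rintro n ⟨w, hw, hn⟩
      have h1 := mul_sub_le_mul_condExp (h.irreducible i) hw hM0 (hn i)
      generalize condExp (F i) = c at *
      generalize mult (F i) = m at *
      by_contra! hlt
      have hlt' : (M : ℤ) * (c + 1) < n := by exact_mod_cast hlt
      have hm2 : (2 : ℤ) ≤ m := by exact_mod_cast hi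
      have hM0' : (0 : ℤ) < M := by exact_mod_cast hM0
      have hc0 : (0 : ℤ) ≤ M * c := by positivity
      have h2 : (M : ℤ) * c < n * m - M := by nlinarith
      nlinarith
    · push Not at hex
      have hone : ∀ i, mult (F i) = 1 := fun i => by have := hex i; have := hmi i; omega
      have hcard : 1 < Fintype.card ι := by
        rw [h.mult_eq] at hm
        simp only [hone, Finset.sum_const, Finset.card_univ] at hm
        simpa [Nat.lt_iff_add_one_le] using hm
      obtain ⟨i, j, hij⟩ := Fintype.exists_pair_of_one_lt_card hcard
      obtain ⟨I, hI⟩ := ENat.ne_top_iff_exists.mp (h.interNum_ne_top hij)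
      refine ⟨M * I, ?_⟩
      rintro n ⟨w, hw, hn⟩
      have h1 := mul_mul_le_mul_interNum (h.irreducible i) (h.irreducible j) hw hM0 (hn i) (hn j)
      rw [hone, hone, ← hI] at h1
      simpa using (show n * 1 * 1 ≤ M * I by exact_mod_cast h1)
  obtain ⟨w, hw, hn⟩ := Nat.sSup_mem ⟨M, hMS⟩ hbdd
  have hnM := le_csSup hbdd hMS
  have hsucc : sSup S + 1 ∉ S := fun hs => by have := le_csSup hbdd hs; omega
  generalize sSup S = n at *
  -- As `m(F i)` divides `M`, a strict inequality at level `n` is the inequality at level `n + 1`;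
  -- holding for all `i` it would contradict maximality.
  have hup : ∀ w, IsSmoothBranch w → ∃ i, M * interNum (F i) w ≤ (n * mult (F i) : ℕ) := by
    intro w hw
    by_contra! hlt
    refine hsucc ⟨w, hw, fun i => ?_⟩
    obtain ⟨Mi, hMi⟩ : mult (F i) ∣ M := Finset.dvd_prod_of_mem _ (Finset.mem_univ i)
    have h1 := hlt i
    have hMi0 : 0 < Mi := Nat.pos_of_ne_zero fun h0 => by rw [h0, mul_zero] at hMi; omega
    rw [hMi, mul_comm n, ← not_le, natCast_mul_le_natCast_iff (hmi i) hMi0, not_le] at h1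
    rw [hMi, mul_comm, natCast_mul_le_natCast_mul_iff (hmi i) hMi0]
    push_cast
    exact Order.add_one_le_of_lt h1
  obtain ⟨p, q, hpq, hp, hq⟩ := Nat.exists_coprime n M
  set d := Nat.gcd n M
  have hd : 0 < d := Nat.gcd_pos_of_pos_right _ hM0
  have hq0 : 0 < q := Nat.pos_of_ne_zero fun h0 => by rw [h0, zero_mul] at hq; omega
  have hp0 : 0 < p := Nat.pos_of_ne_zero fun h0 => by rw [h0, zero_mul] at hp; omega
  rw [mul_comm] at hp hq
  have hlow' : ∀ i, ((p * mult (F i) : ℕ) : ℕ∞) ≤ q * interNum (F i) w := fun i => by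
    have := hn i
    rwa [hp, hq, mul_assoc, natCast_mul_le_natCast_mul_iff hd hq0] at this
  refine ⟨p, q, hp0, hq0, hpq, h.contactExponent_eq hq0 ⟨w, hw, hlow'⟩ fun w hw => ?_, w, hw, hlow'⟩
  obtain ⟨i, hi⟩ := hup w hw
  refine ⟨i, ?_⟩
  rwa [hp, hq, mul_assoc, natCast_mul_le_natCast_iff hd hq0] at hi

end IsFactorization

end AlgebroidCurve

/-! ### The Milnor formula as a sum of nonnegative defects. -/

namespace AlgebroidCurve
open IsLocalRing

theorem coe_natCast_div_natCast (p : ℕ) {q : ℕ} (hq : 0 < q) :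
    (((p : ℝ≥0∞) / q : ℝ≥0∞) : EReal) = ((p / q : ℝ) : EReal) := by
  have h : (p : ℝ≥0∞) / q = ENNReal.ofReal (p / q) := by
    rw [ENNReal.ofReal_div_of_pos (by exact_mod_cast hq), ENNReal.ofReal_natCast,
      ENNReal.ofReal_natCast]
  rw [h, EReal.coe_ennreal_ofReal, max_eq_left (by positivity)]

variable {K : Type*} [Field K]

theorem milnor_eq_iff_int {f : Series K} {D p q : ℕ} (hD : conductorDegree f = D) (hq : 0 < q)
    (hd : contactExponent f = (p : ℝ≥0∞) / q) :
    milnor f = ((contactExponent f : EReal) * (mult f : EReal) - 1) * ((mult f : EReal) - 1) ↔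
      (q : ℤ) * (D - numBranches f + 1) = (p * mult f - q) * (mult f - 1) := by
  have h1 : milnor f = (((D : ℝ) - numBranches f + 1 : ℝ) : EReal) := by
    have hDD : ((D : ℝ≥0∞) : EReal) = ((D : ℝ) : EReal) := by
      rw [← ENNReal.ofReal_natCast, EReal.coe_ennreal_ofReal, max_eq_left (by positivity)]
    rw [milnor, hD, ENat.toENNReal_coe, hDD]
    simp
  have h2 : ((contactExponent f : EReal) * (mult f : EReal) - 1) * ((mult f : EReal) - 1) =
      (((p / q * mult f - 1) * (mult f - 1) : ℝ) : EReal) := by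
    rw [hd, coe_natCast_div_natCast p hq]
    simp
  have hq0 : (q : ℝ) ≠ 0 := by exact_mod_cast hq.ne'
  rw [h1, h2, EReal.coe_eq_coe_iff, ← mul_right_inj' hq0]
  have h3 : (q : ℝ) * ((p / q * mult f - 1) * (mult f - 1)) =
      (p * mult f - q) * (mult f - 1) := by
    field_simp
  rw [h3]
  exact_mod_cast Iff.rfl

namespace IsFactorization

variable [IsAlgClosed K] {ι : Type*} [Fintype ι] {F : ι → Series K} {f : Series K}
  (h : IsFactorization F f) {p q : ℕ}
include h

theorem milnor_eq_iff (hq : 0 < q) (hd : contactExponent f = (p : ℝ≥0∞) / q)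
    (hlow : ∃ w, IsSmoothBranch w ∧ ∀ i, ((p * mult (F i) : ℕ) : ℕ∞) ≤ q * interNum (F i) w) :
    milnor f = ((contactExponent f : EReal) * (mult f : EReal) - 1) * ((mult f : EReal) - 1) ↔
      (∀ i, ((mult (F i) : ℤ) - 1) * (p * mult (F i) - q) = q * condExp (F i)) ∧
        ∀ i j, i ≠ j → q * interNum (F i) (F j) = (p * mult (F i) * mult (F j) : ℕ) := by
  classical
  obtain ⟨w, hw, hlow⟩ := hlow
  let I : ι → ι → ℕ := fun i j => (interNum (F i) (F j)).toNat
  have hI : ∀ i j, i ≠ j → interNum (F i) (F j) = I i j := fun i j hij =>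
    (ENat.natCast_toNat (h.interNum_ne_top hij)).symm
  have hD : conductorDegree f =
      (∑ i, (condExp (F i) + ∑ j ∈ Finset.univ.erase i, I i j) : ℕ) := by
    rw [h.conductorDegree_eq]
    push_cast
    refine Finset.sum_congr rfl fun i _ => congrArg _ (Finset.sum_congr rfl fun j hj => ?_)
    exact hI i j (Finset.ne_of_mem_erase hj).symm
  rw [milnor_eq_iff_int hD hq hd, h.numBranches_eq]
  -- The defects of the single branches, and below those of ordered pairs of branches.
  let A : ι → ℤ := fun i => q * condExp (F i) - ((mult (F i) : ℤ) - 1) * (p * mult (F i) - q)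
  let B : ι → ι → ℤ := fun i j => q * I i j - p * mult (F i) * mult (F j)
  have hA : ∀ i, 0 ≤ A i := fun i =>
    sub_nonneg.mpr (mul_sub_le_mul_condExp (h.irreducible i) hw hq (hlow i))
  have hB : ∀ i j, i ≠ j → 0 ≤ B i j := fun i j hij => by
    have := mul_mul_le_mul_interNum (h.irreducible i) (h.irreducible j) hw hq (hlow i) (hlow j)
    rw [hI i j hij] at this
    have : p * mult (F i) * mult (F j) ≤ q * I i j := by exact_mod_cast this
    exact sub_nonneg.mpr (by exact_mod_cast this)
  -- The quadratic terms `p m_i²` and `p m_i (m - m_i)` combine to `p m m_i`, linear in `m_i`, so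
  -- that summing over `i` involves only `∑ m_i = m`.
  have hT : ∀ i, A i + ∑ j ∈ Finset.univ.erase i, B i j =
      q * (condExp (F i) + ∑ j ∈ Finset.univ.erase i, (I i j : ℤ)) +
        (p + q - p * mult f) * mult (F i) - q := by
    intro i
    have h1 : ∑ j ∈ Finset.univ.erase i, (mult (F j) : ℤ) = mult f - mult (F i) := by
      rw [h.mult_eq]
      push_cast
      rw [← Finset.add_sum_erase _ _ (Finset.mem_univ i)]
      ring
    have h2 : ∑ j ∈ Finset.univ.erase i, B i j =
        q * ∑ j ∈ Finset.univ.erase i, (I i j : ℤ) - p * mult (F i) * (mult f - mult (F i)) := by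
      rw [← h1, Finset.mul_sum, Finset.mul_sum, ← Finset.sum_sub_distrib]
    rw [h2]
    simp only [A]
    ring
  have hsum : ∑ i, (A i + ∑ j ∈ Finset.univ.erase i, B i j) =
      q * (((∑ i, (condExp (F i) + ∑ j ∈ Finset.univ.erase i, I i j) : ℕ) : ℤ) -
        Fintype.card ι + 1) - (p * mult f - q) * (mult f - 1) := by
    rw [Finset.sum_congr rfl fun i _ => hT i, Finset.sum_sub_distrib, Finset.sum_add_distrib,
      ← Finset.mul_sum, ← Finset.mul_sum]
    have h1 : ∑ i, (mult (F i) : ℤ) = mult f := by rw [h.mult_eq]; push_cast; rfl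
    rw [h1, Finset.sum_const, Finset.card_univ]
    push_cast
    ring
  have hTn : ∀ i ∈ Finset.univ, 0 ≤ A i + ∑ j ∈ Finset.univ.erase i, B i j := fun i _ =>
    add_nonneg (hA i) (Finset.sum_nonneg fun j hj => hB i j (Finset.ne_of_mem_erase hj).symm)
  rw [← sub_eq_zero, ← hsum, Finset.sum_eq_zero_iff_of_nonneg hTn]
  have hBn : ∀ i, ∀ j ∈ Finset.univ.erase i, 0 ≤ B i j := fun i j hj =>
    hB i j (Finset.ne_of_mem_erase hj).symm
  simp only [Finset.mem_univ, forall_true_left,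
    add_eq_zero_iff_of_nonneg (hA _) (Finset.sum_nonneg (hBn _)),
    Finset.sum_eq_zero_iff_of_nonneg (hBn _), Finset.mem_erase, and_true, forall_and]
  refine and_congr (forall_congr' fun i => ?_) (forall_congr' fun i => forall_congr' fun j => ?_)
  · rw [sub_eq_zero, eq_comm]
  · refine ⟨fun H hij => ?_, fun H hij => ?_⟩
    · rw [hI i j hij]
      have := sub_eq_zero.mp (H hij.symm)
      exact_mod_cast this
    · have := H hij.symm
      rw [hI i j hij.symm] at this
      exact sub_eq_zero.mpr (by exact_mod_cast this)

end IsFactorization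

end AlgebroidCurve

/-! ### The three types in terms of the branches and of `p/q`. -/

namespace AlgebroidCurve
open IsLocalRing

theorem isNat_natCast_mul_div_iff {m p q : ℕ} (hq : 0 < q) :
    IsNat ((m : ℝ≥0∞) * ((p : ℝ≥0∞) / q)) ↔ q ∣ m * p := by
  have hq0 : (q : ℝ≥0∞) ≠ 0 := by exact_mod_cast hq.ne'
  have h : ∀ n : ℕ, (m : ℝ≥0∞) * ((p : ℝ≥0∞) / q) = n ↔ m * p = q * n := fun n => by
    rw [← mul_div_assoc, eq_comm, ENNReal.eq_div_iff hq0 (ENNReal.natCast_ne_top q), eq_comm]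
    exact_mod_cast Iff.rfl
  exact exists_congr h

theorem isNat_div_iff {p q : ℕ} (hq : 0 < q) (hpq : Nat.Coprime p q) :
    IsNat ((p : ℝ≥0∞) / q) ↔ q = 1 := by
  have := isNat_natCast_mul_div_iff (m := 1) (p := p) hq
  rw [Nat.cast_one, one_mul, one_mul] at this
  rw [this]
  exact ⟨fun h => Nat.eq_one_of_dvd_coprimes hpq h dvd_rfl, fun h => h ▸ one_dvd p⟩

variable {K : Type*} [Field K] [IsAlgClosed K] {p q : ℕ}

theorem contactExponent_eq_of_semigroup_eq {g : Series K} (hg : Irreducible g) (hm : mult g = q)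
    (hs : semigroup g = (AddSubmonoid.closure {q, p} : AddSubmonoid ℕ)) (hq : 2 ≤ q) (hp : 0 < p)
    (hlow : ∃ w, IsSmoothBranch w ∧ ((p * mult g : ℕ) : ℕ∞) ≤ q * interNum g w) :
    contactExponent g = (p : ℝ≥0∞) / q := by
  obtain ⟨w, hw, hlow⟩ := hlow
  refine (isFactorization_unit hg).contactExponent_eq (by omega) ⟨w, hw, fun _ => hlow⟩
    fun w hw => ⟨(), ?_⟩
  rw [hm, mul_comm p]
  push_cast
  gcongr
  exact interNum_le_of_semigroup_eq hg hw hs hm hq hp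

omit [IsAlgClosed K] in
theorem contact_eq_div {g w : Series K} (hg : Irreducible g) (hw : IsSmoothBranch w) :
    contact g w = (interNum g w : ℝ≥0∞) / mult g := by
  rw [(isFactorization_unit hg).contact_eq hw, iInf_const]

theorem natCast_mul_eq_natCast_mul_iff {c a : ℕ} {v : ℕ∞} (hc : 0 < c) :
    (c : ℕ∞) * v = (c * a : ℕ) ↔ v = a := by
  cases v using ENat.recTopCoe with
  | top =>
    rw [ENat.mul_top (by exact_mod_cast hc.ne')]
    exact iff_of_false (ENat.natCast_ne_top _).symm (ENat.natCast_ne_top _).symm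
  | coe v =>
    norm_cast
    exact Nat.mul_right_inj hc.ne'

namespace IsFactorization

variable {ι : Type*} [Fintype ι] {F : ι → Series K} {f : Series K} (h : IsFactorization F f)
include h

omit [IsAlgClosed K] in
theorem erase [DecidableEq ι] {i₀ : ι} {l f' : Series K} (hl : Associated l (F i₀))
    (hf : f = l * f') : IsFactorization (fun i : {i // i ≠ i₀} => F i) f' where
  irreducible i := h.irreducible i
  not_associated i j hij := h.not_associated fun h' => hij (Subtype.ext h')
  associated := by
    have h1 := h.associated
    rw [Fintype.prod_eq_mul_prod_subtype_ne F i₀, hf] at h1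
    exact h1.of_mul_left hl.symm (h.irreducible i₀).ne_zero

omit [IsAlgClosed K] in
theorem isSmoothBranch_iff {g : Series K} {i : ι} (hg : Associated g (F i)) :
    IsSmoothBranch g ↔ mult (F i) = 1 := by
  rw [IsSmoothBranch, isBranch_iff_irreducible, hg.irreducible_iff, mult_congr hg]
  exact and_iff_right (h.irreducible i)

omit [IsAlgClosed K] in
theorem forall_isBranchOf_iff {P : Series K → Prop} (hP : ∀ g g', Associated g g' → (P g ↔ P g')) :
    (∀ g, IsBranchOf g f → P g) ↔ ∀ i, P (F i) := by
  refine ⟨fun H i => H _ (h.isBranchOf i), fun H g hg => ?_⟩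
  obtain ⟨i, hi⟩ := h.isBranchOf_iff.mp hg
  exact (hP _ _ hi).mpr (H i)

omit [IsAlgClosed K] in
theorem forall_interNum_iff {P : ℕ∞ → Prop} :
    (∀ g g', IsBranchOf g f → IsBranchOf g' f → ¬ Associated g g' → P (interNum g g')) ↔
      ∀ i j, i ≠ j → P (interNum (F i) (F j)) := by
  constructor
  · exact fun H i j hij => H _ _ (h.isBranchOf i) (h.isBranchOf j) (h.not_associated hij)
  · intro H g g' hg hg' hgg'
    obtain ⟨i, hi⟩ := h.isBranchOf_iff.mp hg
    obtain ⟨j, hj⟩ := h.isBranchOf_iff.mp hg'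
    rw [interNum_congr hi hj]
    exact H i j fun hij => hgg' (hi.trans (hij ▸ hj.symm))

variable (hp : 0 < p) (hq : 0 < q) (hpq : Nat.Coprime p q)
  (hd : contactExponent f = (p : ℝ≥0∞) / q)
include hq hpq hd

omit [IsAlgClosed K] in
theorem typeOne_iff : TypeOne f ↔ q = 1 ∧ (∀ i, mult (F i) = 1) ∧
    ∀ i j, i ≠ j → q * interNum (F i) (F j) = (p * mult (F i) * mult (F j) : ℕ) := by
  rw [TypeOne, hd, isNat_div_iff hq hpq, h.forall_isBranchOf_iff (P := IsSmoothBranch),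
    h.forall_interNum_iff (P := fun v => (v : ℝ≥0∞) = (p : ℝ≥0∞) / q)]
  · refine and_congr_right fun hq1 => ?_
    subst hq1
    simp only [h.isSmoothBranch_iff (Associated.refl _)]
    refine and_congr_right fun hm => ?_
    refine forall_congr' fun i => forall_congr' fun j => imp_congr_right fun _ => ?_
    rw [hm, hm, Nat.cast_one, div_one, mul_one, mul_one, Nat.cast_one, one_mul]
    exact_mod_cast Iff.rfl
  · intro g g' hgg'
    rw [IsSmoothBranch, IsSmoothBranch, isBranch_iff_irreducible, isBranch_iff_irreducible,
      hgg'.irreducible_iff, mult_congr hgg']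

/-- With `r` branches of multiplicity `q` one has `m = r q` and `N = r p`, so the exact divisions in
the definition return `q` and `p`. -/
theorem typeTwo_iff [Nonempty ι] : TypeTwo f ↔ 2 ≤ q ∧
    (∀ i, mult (F i) = q ∧ semigroup (F i) = (AddSubmonoid.closure {q, p} : AddSubmonoid ℕ)) ∧
    ∀ i j, i ≠ j → q * interNum (F i) (F j) = (p * mult (F i) * mult (F j) : ℕ) := by
  set r := Fintype.card ι with hr
  have hr0 : 0 < r := Fintype.card_pos
  have hq0 : (q : ℝ≥0∞) ≠ 0 := by exact_mod_cast hq.ne'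
  have hr0' : (r : ℝ≥0∞) ≠ 0 := by exact_mod_cast hr0.ne'
  have hgcd : Nat.gcd (r * q) (r * p) = r := by
    rw [Nat.gcd_mul_left, hpq.symm.gcd_eq_one, mul_one]
  have hcontact : ((r * q : ℕ) : ℝ≥0∞) * ((p : ℝ≥0∞) / q) = (r * p : ℕ) := by
    rw [Nat.cast_mul, mul_assoc, ENNReal.mul_div_cancel hq0 (ENNReal.natCast_ne_top q), Nat.cast_mul]
  have hint : ((r * q : ℕ) : ℝ≥0∞) ^ 2 * ((p : ℝ≥0∞) / q) / (r : ℝ≥0∞) ^ 2 = (p * q : ℕ) := by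
    rw [pow_two, mul_assoc, hcontact, eq_comm, ENNReal.eq_div_iff (pow_ne_zero 2 hr0')
      (ENNReal.pow_ne_top (ENNReal.natCast_ne_top r))]
    push_cast
    ring
  have hI : (∀ i, mult (F i) = q) →
      ((∀ i j, i ≠ j → q * interNum (F i) (F j) = (p * mult (F i) * mult (F j) : ℕ)) ↔
      ∀ i j, i ≠ j → (interNum (F i) (F j) : ℝ≥0∞) = (p * q : ℕ)) := fun hm => by
    refine forall_congr' fun i => forall_congr' fun j => imp_congr_right fun _ => ?_
    rw [hm, hm, mul_comm (p * q) q, natCast_mul_eq_natCast_mul_iff hq]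
    exact_mod_cast Iff.rfl
  rw [TypeTwo, hd, isNat_div_iff hq hpq]
  constructor
  · rintro ⟨hq1, N, r', hN, hr', hcard, hsemi, hinter⟩
    have hq2 : 2 ≤ q := by omega
    rw [h.numBranches_eq, ← hr] at hcard
    subst hcard
    have hN' : mult f * p = q * N := by
      rw [← mul_div_assoc, eq_comm, ENNReal.eq_div_iff hq0 (ENNReal.natCast_ne_top q)] at hN
      exact_mod_cast hN.symm
    obtain ⟨m', N', hcop, hm', hNN'⟩ := Nat.exists_coprime (mult f) N
    rw [← hr', mul_comm] at hm' hNN'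
    rw [hm', hNN', mul_assoc, mul_left_comm q] at hN'
    have hN'' := Nat.eq_of_mul_eq_mul_left hr0 hN'
    have hmq : m' = q := Nat.dvd_antisymm (hcop.dvd_of_dvd_mul_right ⟨p, hN''.symm⟩)
      (hpq.symm.dvd_of_dvd_mul_right ⟨N', hN''⟩)
    subst hmq
    have hNp : N' = p := (Nat.eq_of_mul_eq_mul_left hq hN'').symm
    subst hNp
    rw [hm', hNN', Nat.mul_div_cancel_left _ hr0, Nat.mul_div_cancel_left _ hr0] at hsemi
    rw [hm', hint] at hinter
    have hsemi' := fun i => hsemi _ (h.isBranchOf i)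
    -- A priori the semigroup only bounds each multiplicity by its element `q`; the sum `m = r q`
    -- then forces equality for every branch.
    have hle : ∀ i ∈ Finset.univ, mult (F i) ≤ m' := fun i _ =>
      mult_le_of_mem_semigroup (h.irreducible i) (by omega) (by
        rw [hsemi' i]; exact AddSubmonoid.subset_closure (by simp))
    have hm : ∀ i, mult (F i) = m' := by
      have := (Finset.sum_eq_sum_iff_of_le hle).mp (by
        rw [← h.mult_eq, hm', Finset.sum_const, Finset.card_univ, smul_eq_mul])
      exact fun i => this i (Finset.mem_univ i)
    exact ⟨hq2, fun i => ⟨hm i, hsemi' i⟩, (hI hm).mpr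
      ((h.forall_interNum_iff (P := fun v => (v : ℝ≥0∞) = (N' * m' : ℕ))).mp hinter)⟩
  · rintro ⟨hq2, hmS, hinter⟩
    have hm : mult f = r * q := by
      rw [h.mult_eq, Finset.sum_congr rfl fun i _ => (hmS i).1, Finset.sum_const, Finset.card_univ,
        smul_eq_mul]
    refine ⟨by omega, r * p, r, by rw [hm, hcontact], by rw [hm, hgcd], h.numBranches_eq, ?_, ?_⟩
    · rw [hm, Nat.mul_div_cancel_left _ hr0, Nat.mul_div_cancel_left _ hr0,
        h.forall_isBranchOf_iff (P := fun g => semigroup g = _)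
          fun g g' hgg' => by rw [semigroup_congr hgg']]
      exact fun i => (hmS i).2
    · rw [hm, hint, h.forall_interNum_iff (P := fun v => (v : ℝ≥0∞) = (p * q : ℕ))]
      exact (hI fun i => (hmS i).1).mp hinter

end IsFactorization

end AlgebroidCurve

/-! ### The third type and the comparison with vanishing defects. -/

namespace AlgebroidCurve
open IsLocalRing

variable {K : Type*} [Field K] [IsAlgClosed K] {p q : ℕ}

omit [IsAlgClosed K] in
theorem branch_of_associated {g g' : Series K} (h : Associated g g')
    (hg' : mult g' = q ∧ semigroup g' = (AddSubmonoid.closure {q, p} : AddSubmonoid ℕ)) :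
    mult g = q ∧ semigroup g = (AddSubmonoid.closure {q, p} : AddSubmonoid ℕ) := by
  rwa [mult_congr h, semigroup_congr h]

namespace IsFactorization

variable {ι : Type*} [Fintype ι] {F : ι → Series K} {f : Series K} (h : IsFactorization F f)
  (hp : 0 < p) (hq : 0 < q) (hpq : Nat.Coprime p q) (hd : contactExponent f = (p : ℝ≥0∞) / q)
  (hlow : ∃ w, IsSmoothBranch w ∧ ∀ i, ((p * mult (F i) : ℕ) : ℕ∞) ≤ q * interNum (F i) w)
include h hp hq hpq hd hlow

/-- On a branch with semigroup `⟨q, p⟩`, maximal contact of `L` means intersection number `p`, which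
is the zero pair defect for multiplicities `q` and `1`. -/
theorem typeThree_iff (hred : IsReducedCurve f) (hm : 2 ≤ mult f) : TypeThree f ↔ 2 ≤ q ∧
    (∃ i₀, mult (F i₀) = 1 ∧ ∀ i, i ≠ i₀ →
      mult (F i) = q ∧ semigroup (F i) = (AddSubmonoid.closure {q, p} : AddSubmonoid ℕ)) ∧
    ∀ i j, i ≠ j → q * interNum (F i) (F j) = (p * mult (F i) * mult (F j) : ℕ) := by
  classical
  obtain ⟨w, hw, hlow⟩ := hlow
  have hmf : ∀ {l f' : Series K}, f = l * f' → mult l = 1 → mult f' + 1 = mult f := by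
    rintro l f' rfl hl
    rw [mult_mul (left_ne_zero_of_mul hred.1.1) (right_ne_zero_of_mul hred.1.1), hl, add_comm]
  have hcontact : ∀ {g l : Series K}, Irreducible g → IsSmoothBranch l →
      ((mult g = q ∧ semigroup g = (AddSubmonoid.closure {q, p} : AddSubmonoid ℕ))) → 2 ≤ q →
      ((p * mult g : ℕ) : ℕ∞) ≤ q * interNum g w →
      (contact g l = contactExponent g ↔ interNum g l = p) := by
    intro g l hg hl hgS hq2 hgw
    have hq0 : (q : ℝ≥0∞) ≠ 0 := by exact_mod_cast hq.ne'
    rw [contact_eq_div hg hl, contactExponent_eq_of_semigroup_eq hg hgS.1 hgS.2 hq2 hp ⟨w, hw, hgw⟩,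
      hgS.1, ENNReal.div_eq_div_iff hq0 (ENNReal.natCast_ne_top q) hq0 (ENNReal.natCast_ne_top q),
      ENNReal.mul_right_inj hq0 (ENNReal.natCast_ne_top q)]
    exact_mod_cast Iff.rfl
  have hsub : ∀ {i₀ : ι}, mult (F i₀) = 1 → Nonempty {i // i ≠ i₀} := by
    intro i₀ hi₀
    by_contra hne
    have hall : ∀ i ∈ Finset.univ, i ≠ i₀ → mult (F i) = 0 := fun i _ hi =>
      (hne ⟨⟨i, hi⟩⟩).elim
    rw [h.mult_eq, Finset.sum_eq_single i₀ hall (by simp), hi₀] at hm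
    omega
  constructor
  · rintro ⟨-, l, f', hf, hl, hred', h2, hd', -, hmax⟩
    obtain ⟨i₀, hi₀⟩ := h.isBranchOf_iff.mp ⟨hl.1, ⟨f', hf⟩⟩
    have hm₀ : mult (F i₀) = 1 := (h.isSmoothBranch_iff hi₀).mp hl
    have h' := h.erase hi₀ hf
    have := hsub hm₀
    obtain ⟨hq2, hS, hI⟩ := (h'.typeTwo_iff hq hpq (hd'.trans hd)).mp h2
    have hi₀I : ∀ i, i ≠ i₀ → interNum (F i) (F i₀) = p := fun i hi => by
      rw [← interNum_congr (Associated.refl (F i)) hi₀]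
      exact (hcontact (h.irreducible i) hl (hS ⟨i, hi⟩) hq2 (hlow i)).mp
        (hmax _ (h'.isBranchOf ⟨i, hi⟩)).2
    refine ⟨hq2, ⟨i₀, hm₀, fun i hi => hS ⟨i, hi⟩⟩, fun i j hij => ?_⟩
    rcases eq_or_ne i i₀ with rfl | hi
    · rw [interNum_comm, hi₀I j hij.symm, hm₀, (hS ⟨j, hij.symm⟩).1, mul_one, mul_comm p]
      push_cast; rfl
    · rcases eq_or_ne j i₀ with rfl | hj
      · rw [hi₀I i hij, hm₀, (hS ⟨i, hij⟩).1, mul_one, mul_comm p]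
        push_cast; rfl
      · exact hI ⟨i, hi⟩ ⟨j, hj⟩ fun h' => hij (congrArg Subtype.val h')
  · rintro ⟨hq2, ⟨i₀, hm₀, hS⟩, hI⟩
    obtain ⟨f', hf⟩ := h.dvd i₀
    have h' := h.erase (Associated.refl (F i₀)) hf
    have := hsub hm₀
    have hl : IsSmoothBranch (F i₀) := (h.isSmoothBranch_iff (Associated.refl _)).mpr hm₀
    -- Removing `L` cannot raise the contact exponent: any one remaining branch has contact at most
    -- `p/q` with every smooth branch.
    have hd' : contactExponent f' = (p : ℝ≥0∞) / q := by
      refine h'.contactExponent_eq hq ⟨w, hw, fun i => hlow i⟩ fun v hv => ?_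
      obtain ⟨i⟩ := this
      refine ⟨i, ?_⟩
      rw [(hS i i.2).1, mul_comm p]
      push_cast
      gcongr
      exact interNum_le_of_semigroup_eq (h.irreducible i) hv (hS i i.2).2 (hS i i.2).1 hq2 hp
    have hm' := hmf hf hm₀
    have hm'q : q ∣ mult f' := by
      rw [h'.mult_eq]
      exact Finset.dvd_sum fun i _ => (hS i i.2).1 ▸ dvd_rfl
    have hred' : IsReducedCurve f' := by
      refine ⟨⟨h'.ne_zero, mem_maximalIdeal_series.mp fun hu => ?_⟩,
        hred.2.squarefree_of_dvd ⟨F i₀, by rw [hf, mul_comm]⟩⟩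
      rw [mult_of_isUnit hu] at hm'
      omega
    refine ⟨?_, F i₀, f', hf, hl, hred', ?_, hd'.trans hd.symm, hm', fun g hg => ⟨hl, ?_⟩⟩
    -- `q ≥ 2` divides `m(f')` and is prime to `p`, so it cannot divide `(m(f') + 1) p`.
    · rw [hd, isNat_natCast_mul_div_iff hq, ← hm']
      intro hdvd
      have := (Nat.dvd_add_right hm'q).mp (hpq.symm.dvd_of_dvd_mul_right hdvd)
      have := Nat.dvd_one.mp this
      omega
    · rw [h'.typeTwo_iff hq hpq hd']
      exact ⟨hq2, fun i => hS i i.2, fun i j hij => hI i j fun h' => hij (Subtype.ext h')⟩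
    · obtain ⟨i, hi⟩ := h'.isBranchOf_iff.mp hg
      have hi1 := hI i i₀ i.2
      rw [(hS i i.2).1, hm₀, mul_one, mul_comm p, natCast_mul_eq_natCast_mul_iff hq] at hi1
      rw [hcontact hg.1.2 hl (branch_of_associated hi (hS i i.2)) hq2 (by
        rw [mult_congr hi, interNum_congr hi (Associated.refl w)]; exact hlow i),
        interNum_congr hi (Associated.refl _), hi1]

theorem milnor_eq_iff_types (hred : IsReducedCurve f) (hm : 2 ≤ mult f) :
    milnor f = ((contactExponent f : EReal) * (mult f : EReal) - 1) * ((mult f : EReal) - 1) ↔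
      TypeOne f ∨ TypeTwo f ∨ TypeThree f := by
  have hne : Nonempty ι := by
    by_contra hne
    rw [not_nonempty_iff] at hne
    rw [h.mult_eq, Finset.univ_eq_empty, Finset.sum_empty] at hm
    omega
  rw [h.milnor_eq_iff hq hd hlow, h.typeOne_iff hq hpq hd, h.typeTwo_iff hq hpq hd,
    h.typeThree_iff hp hq hpq hd hlow hred hm]
  obtain ⟨w, hw, hlow⟩ := hlow
  have hcOne : ∀ i, mult (F i) = 1 →
      ((mult (F i) : ℤ) - 1) * (p * mult (F i) - q) = q * condExp (F i) := fun i hi => by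
    rw [condExp_eq_zero_of_mult_eq_one (h.irreducible i) hi, hi]; simp
  have hcTwo : ∀ i, mult (F i) = q ∧
      semigroup (F i) = (AddSubmonoid.closure {q, p} : AddSubmonoid ℕ) →
      ((mult (F i) : ℤ) - 1) * (p * mult (F i) - q) = q * condExp (F i) := fun i hi => by
    have : Fact (Irreducible (F i)) := ⟨h.irreducible i⟩
    rw [condExp_eq_of_semigroup_eq hi.2, hi.1]
    push_cast [Nat.cast_pred hq, Nat.cast_pred hp]
    ring
  constructor
  · rintro ⟨hE, hI⟩
    have hcases : ∀ i, mult (F i) ≠ 1 → mult (F i) = q ∧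
        semigroup (F i) = (AddSubmonoid.closure {q, p} : AddSubmonoid ℕ) := fun i hi =>
      mult_eq_of_mul_condExp_eq (h.irreducible i) hw hq hp hpq (hlow i) hi (hE i)
    rcases eq_or_ne q 1 with hq1 | hq1
    · refine Or.inl ⟨hq1, fun i => ?_, hI⟩
      by_contra hi
      exact hi ((hcases i hi).1.trans hq1)
    have hq2 : 2 ≤ q := by omega
    right
    by_cases hex : ∃ i₀, mult (F i₀) = 1
    · obtain ⟨i₀, hi₀⟩ := hex
      refine Or.inr ⟨hq2, ⟨i₀, hi₀, fun i hi => hcases i fun hi1 => ?_⟩, hI⟩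
      -- A second smooth branch would give `q k = p`, so `q = 1`.
      have h1 := hI i i₀ hi
      obtain ⟨k, hk⟩ := ENat.ne_top_iff_exists.mp (h.interNum_ne_top hi)
      rw [hi₀, hi1, ← hk, mul_one, mul_one] at h1
      have h2 : q * k = p := by exact_mod_cast h1
      exact hq1 (Nat.eq_one_of_dvd_coprimes hpq ⟨k, h2.symm⟩ dvd_rfl)
    · push Not at hex
      exact Or.inl ⟨hq2, fun i => hcases i (hex i), hI⟩
  · rintro (⟨-, hS, hI⟩ | ⟨-, hS, hI⟩ | ⟨-, ⟨i₀, hi₀, hS⟩, hI⟩)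
    · exact ⟨fun i => hcOne i (hS i), hI⟩
    · exact ⟨fun i => hcTwo i (hS i), hI⟩
    · refine ⟨fun i => ?_, hI⟩
      rcases eq_or_ne i i₀ with rfl | hi
      · exact hcOne i hi₀
      · exact hcTwo i (hS i hi)

end IsFactorization

end AlgebroidCurve

theorem mainTheorem6 {K : Type*} [Field K] [IsAlgClosed K] (f : AlgebroidCurve.Series K)
    (hred : AlgebroidCurve.IsReducedCurve f) (hsing : AlgebroidCurve.IsSingularCurve f) :
    (AlgebroidCurve.milnor f =
        ((AlgebroidCurve.contactExponent f : EReal) * (AlgebroidCurve.mult f : EReal) - 1) *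
          ((AlgebroidCurve.mult f : EReal) - 1) ↔
      AlgebroidCurve.TypeOne f ∨ AlgebroidCurve.TypeTwo f ∨ AlgebroidCurve.TypeThree f) ∧
    ¬ (AlgebroidCurve.TypeOne f ∧ AlgebroidCurve.TypeTwo f) ∧
    ¬ (AlgebroidCurve.TypeOne f ∧ AlgebroidCurve.TypeThree f) ∧
    ¬ (AlgebroidCurve.TypeTwo f ∧ AlgebroidCurve.TypeThree f) := by
  obtain ⟨r, F, h⟩ := AlgebroidCurve.exists_isFactorization hred
  obtain ⟨p, q, hp, hq, hpq, hd, hlow⟩ := h.exists_contactExponent_eq hsing.2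
  -- Exclusivity rests on integrality alone: `d` is an integer in type one and not in type two, and
  -- `m d` is an integer in both but not in type three.
  refine ⟨h.milnor_eq_iff_types hp hq hpq hd hlow hred hsing.2, fun h12 => h12.2.1 h12.1.1,
    fun h13 => h13.2.1 ?_, fun h23 => h23.2.1 ?_⟩
  · obtain ⟨n, hn⟩ := h13.1.1
    exact ⟨AlgebroidCurve.mult f * n, by rw [hn, Nat.cast_mul]⟩
  · obtain ⟨-, N, -, hN, -⟩ := h23.1
    exact ⟨N, hN⟩
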